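/- Let $k$ be a field, $r \ge 0$, $R = k[x_0,\ldots,x_r]$ the standard graded polynomial ring, $\mathfrak{m} = (x_0,\ldots,x_r) \subset R$, $A = k[t]$, and $S = A[x_0,\ldots,x_r]$, graded by $\deg x_j = 1$ and $\deg t = 0$. Let $I_0, I_1 \subset R$ be homogeneous ideals and let $\mathcal{I} \subset S$ be a one-parameter flat family of homogeneous ideals with special fiber $I_0$ and general fiber $I_1$, that is: 1. $\mathcal{I}$ is a homogeneous ideal of $S$ and $S/\mathcal{I}$ is flat over $A$; 2. there are isomorphisms of graded algebras $R/I_0 \cong S/\mathcal{I} \otimes_A A/tA$ (over $k$) and $R/I_1 \otimes_k k[t,t^{-1}] \cong S/\mathcal{I} \otimes_A k[t,t^{-1}]$ (over $k[t,t^{-1}]$). For a homogeneous ideal $I \subset R$, let $H^i_{\mathfrak{m}}(R/I)$ be the $i$-th local cohomology module of $R/I$ with support in $\mathfrak{m}$, that is, the $i$-th cohomology of the Čech complex of $R/I$ on $x_0,\ldots,x_r$, with its natural $\mathbb{Z}$-grading; $[\,\cdot\,]_\nu$ denotes the graded piece of degree $\nu$. Suppose that, for all $1 \le i \le r$, the zero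 map is the only $R$-linear map $H^{i-1}_{\mathfrak{m}}(R/I_0) \to H^{i}_{\mathfrak{m}}(R/I_0)$ that is homogeneous of degree zero, i.e. $$\left[\operatorname{Hom}_R\big(H^{i-1}_{\mathfrak{m}}(R/I_0),\, H^{i}_{\mathfrak{m}}(R/I_0)\big)\right]_0 = 0 \qquad \text{for all } 1 \le i \le r.$$ Then $$\dim_k \left[H^i_{\mathfrak{m}}(R/I_0)\right]_\nu = \dim_k \left[H^i_{\mathfrak{m}}(R/I_1)\right]_\nu \qquad \text{for all } i \ge 0 \text{ and } \nu \in \mathbb{Z}.$$ -/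

import Mathlib

open scoped TensorProduct Polynomial LaurentPolynomial

/-! ### Graded local cohomology at the irrelevant ideal, through the Cech complex

`R = k[x_0, …, x_{n-1}]` is `MvPolynomial (Fin n) k` with its standard grading, `M` is an
`R`-module, and `H^p_𝔪(M)` is the `p`-th cohomology of the (extended, alternating) Cech complex
`0 → M → ⨁_j M_{x_j} → ⨁_{j < l} M_{x_j x_l} → ⋯ → M_{x_0 ⋯ x_{n-1}} → 0`. -/

namespace GradedLC

/-- The multiplicative set of the monomials in the variables `x_j`, `j ∈ s`. -/
noncomputable abbrev varMonoid (k : Type*) [CommRing k] {n : ℕ} (s : Finset (Fin n)) :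
    Submonoid (MvPolynomial (Fin n) k) :=
  Submonoid.closure (MvPolynomial.X '' (s : Set (Fin n)))

theorem varMonoid_mono (k : Type*) [CommRing k] {n : ℕ} {s t : Finset (Fin n)} (h : s ⊆ t) :
    varMonoid k s ≤ varMonoid k t :=
  Submonoid.closure_mono (Set.image_mono (by exact_mod_cast h))

/-- `M_{x_s}`, the localization of `M` at `x_s = ∏_{j ∈ s} x_j`. -/
abbrev Loc (k : Type*) [CommRing k] {n : ℕ} (M : Type*) [AddCommGroup M]
    [Module (MvPolynomial (Fin n) k) M] (s : Finset (Fin n)) : Type _ :=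
  LocalizedModule (varMonoid k s) M

/-- The localization map `M_{x_s} → M_{x_t}` for `s ⊆ t`. -/
noncomputable def res (k : Type*) [CommRing k] {n : ℕ} (M : Type*) [AddCommGroup M]
    [Module (MvPolynomial (Fin n) k) M] {s t : Finset (Fin n)} (h : s ⊆ t) :
    Loc k M s →ₗ[MvPolynomial (Fin n) k] Loc k M t :=
  IsLocalizedModule.liftOfLE (varMonoid k s) (varMonoid k t) (varMonoid_mono k h)
    (LocalizedModule.mkLinearMap (varMonoid k s) M)
    (LocalizedModule.mkLinearMap (varMonoid k t) M)

/-- The Cech cochains of degree `p`: families `(c_s)` with `c_s ∈ M_{x_s}`, indexed by the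
`p`-element sets `s` of variables. -/
abbrev Cochain (k : Type*) [CommRing k] (n : ℕ) (M : Type*) [AddCommGroup M]
    [Module (MvPolynomial (Fin n) k) M] (p : ℕ) : Type _ :=
  (s : {s : Finset (Fin n) // s.card = p}) → Loc k M s.1

/-- The Cech differential `(dc)_t = ∑_{j ∈ t} (-1)^{#{l ∈ t | l < j}} c_{t \ j}|_{M_{x_t}}`. -/
noncomputable def cechD (k : Type*) [CommRing k] (n : ℕ) (M : Type*) [AddCommGroup M]
    [Module (MvPolynomial (Fin n) k) M] (p : ℕ) :
    Cochain k n M p →ₗ[MvPolynomial (Fin n) k] Cochain k n M (p + 1) :=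
  LinearMap.pi fun t => ∑ j : {j : Fin n // j ∈ t.1},
    ((-1 : MvPolynomial (Fin n) k) ^ (t.1.filter (· < j.1)).card) •
      (res k M (Finset.erase_subset j.1 t.1) ∘ₗ
        LinearMap.proj (⟨t.1.erase j.1, by
          rw [Finset.card_erase_of_mem j.2, t.2, Nat.add_sub_cancel]⟩ :
            {s : Finset (Fin n) // s.card = p}))

/-- The Cech coboundaries of degree `p`. -/
noncomputable def coboundaries (k : Type*) [CommRing k] (n : ℕ) (M : Type*) [AddCommGroup M]
    [Module (MvPolynomial (Fin n) k) M] :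
    (p : ℕ) → Submodule (MvPolynomial (Fin n) k) (Cochain k n M p)
  | 0 => ⊥
  | p + 1 => LinearMap.range (cechD k n M p)

/-- The local cohomology module `H^p_𝔪(M)`, `𝔪 = (x_0, …, x_{n-1})`. -/
abbrev H (k : Type*) [CommRing k] (n : ℕ) (M : Type*) [AddCommGroup M]
    [Module (MvPolynomial (Fin n) k) M] (p : ℕ) : Type _ :=
  LinearMap.ker (cechD k n M p) ⧸ (coboundaries k n M p).submoduleOf (LinearMap.ker (cechD k n M p))

section Grading

variable {k : Type*} [CommRing k] (n : ℕ) {M : Type*} [AddCommGroup M]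
  [Module (MvPolynomial (Fin n) k) M] [Module k M] [IsScalarTower k (MvPolynomial (Fin n) k) M]

/-- The degree `ν` piece of `M_{x_s}`, for `M` graded by `𝓜`: it is spanned by the fractions
`m / u` with `m ∈ M_d`, `u` a monomial of degree `e` in the `x_j`, `j ∈ s`, and `d - e = ν`. -/
noncomputable def locPiece (𝓜 : ℕ → Submodule k M) (s : Finset (Fin n)) (ν : ℤ) :
    Submodule k (Loc k M s) :=
  Submodule.span k {z | ∃ (d e : ℕ) (m : M) (u : varMonoid k s), m ∈ 𝓜 d ∧
    (u : MvPolynomial (Fin n) k).IsHomogeneous e ∧ (d : ℤ) - e = ν ∧ z = LocalizedModule.mk m u}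

/-- The degree `ν` piece of the module of Cech cochains. -/
noncomputable def cochainPiece (𝓜 : ℕ → Submodule k M) (p : ℕ) (ν : ℤ) :
    Submodule k (Cochain k n M p) :=
  Submodule.pi Set.univ fun s => locPiece n 𝓜 s.1 ν

/-- `[H^p_𝔪(M)]_ν`: the classes of the cocycles that are homogeneous of degree `ν`. -/
noncomputable def piece (𝓜 : ℕ → Submodule k M) (p : ℕ) (ν : ℤ) : Submodule k (H k n M p) :=
  ((cochainPiece n 𝓜 p ν).comap ((LinearMap.ker (cechD k n M p)).subtype.restrictScalars k)).map
    (((coboundaries k n M p).submoduleOf (LinearMap.ker (cechD k n M p))).mkQ.restrictScalars k)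

end Grading

end GradedLC

/-! ### One-parameter flat families of homogeneous ideals -/

/-- The degree `d` piece of `k[x_0, …, x_{n-1}] / I`. -/
noncomputable def quotGrading {k : Type*} [CommRing k] {n : ℕ} (I : Ideal (MvPolynomial (Fin n) k)) (d : ℕ) :
    Submodule k (MvPolynomial (Fin n) k ⧸ I) :=
  (MvPolynomial.homogeneousSubmodule (Fin n) k d).map (Ideal.Quotient.mkₐ k I).toLinearMap

section Family

attribute [local instance] MvPolynomial.gradedAlgebra

/-- `𝓘 ⊆ S = k[t][x_0, …, x_r]` is a one-parameter flat family of homogeneous ideals with special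
fiber `I₀` and general fiber `I₁`. Both isomorphisms are isomorphisms of graded algebras: over
`k = k[t]/(t)` for the special fiber, and over `k[t, t⁻¹]` for the general fiber. -/
structure IsOneParameterFlatFamily {k : Type*} [Field k] {r : ℕ}
    (𝓘 : Ideal (MvPolynomial (Fin (r + 1)) k[X]))
    (I₀ I₁ : Ideal (MvPolynomial (Fin (r + 1)) k)) : Prop where
  homogeneous : 𝓘.IsHomogeneous (MvPolynomial.homogeneousSubmodule (Fin (r + 1)) k[X])
  homogeneous_special : I₀.IsHomogeneous (MvPolynomial.homogeneousSubmodule (Fin (r + 1)) k)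
  homogeneous_general : I₁.IsHomogeneous (MvPolynomial.homogeneousSubmodule (Fin (r + 1)) k)
  flat : Module.Flat k[X] (MvPolynomial (Fin (r + 1)) k[X] ⧸ 𝓘)
  /-- `R/I₀ ≅ S/𝓘 ⊗_{k[t]} k[t]/(t)`. -/
  special : ∃ e : (MvPolynomial (Fin (r + 1)) k ⧸ I₀) ≃ₐ[k]
      ((k[X] ⧸ Ideal.span {(Polynomial.X : k[X])}) ⊗[k[X]]
        (MvPolynomial (Fin (r + 1)) k[X] ⧸ 𝓘)),
    ∀ d : ℕ, (quotGrading I₀ d).map e.toLinearMap =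
      ((quotGrading 𝓘 d).baseChange (k[X] ⧸ Ideal.span {(Polynomial.X : k[X])})).restrictScalars k
  /-- `R/I₁ ⊗_k k[t, t⁻¹] ≅ S/𝓘 ⊗_{k[t]} k[t, t⁻¹]`. -/
  general : ∃ e : (k[T;T⁻¹] ⊗[k] (MvPolynomial (Fin (r + 1)) k ⧸ I₁)) ≃ₐ[k[T;T⁻¹]]
      (k[T;T⁻¹] ⊗[k[X]] (MvPolynomial (Fin (r + 1)) k[X] ⧸ 𝓘)),
    ∀ d : ℕ, ((quotGrading I₁ d).baseChange k[T;T⁻¹]).map e.toLinearMap =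
      (quotGrading 𝓘 d).baseChange k[T;T⁻¹]

end Family

/-! Let M = S/𝓘, and let H^p(M) be its Čech cohomology. For τ = 0, 1 the fiber of the family over t
= τ is a quotient M/(t − τ)M, and t − τ is a nonzerodivisor on M by flatness. Hence there is a long
exact sequence H^p(M) → H^p(M) → H^p(fiber) → H^{p+1}(M) whose first map is multiplication by t − τ.
Each graded piece of H^p(M) is a finitely generated k[t]-module (`finite_pieces`). If t − τ is
injective on all these pieces, then the degree ν piece of H^p(fiber) is the fiber at τ of the degree
ν piece V of H^p(M), and its dimension is the rank of V modulo torsion (`rank_fiber_eq`,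
`SpecSeq.rank_piece`). This rank does not depend on τ, so it remains to prove injectivity at τ = 0
and at τ = 1.

At τ = 1 injectivity is automatic (`eq_zero_of_trivial_family`). After inverting t the family is a
product, evaluation at t = 1 has a section, and so the connecting map vanishes. The passage to k[t,
t⁻¹] only loses t-power torsion, on which t − 1 is injective.

At τ = 0 the hypothesis enters through higher Bockstein maps (`exists_pow_smul_eq_of_hom_eq_zero`).
If the t-torsion of H^{p+1}(M) is divisible by t^e, then lifting δ(y) through t^e and specializing
gives a graded R-linear map H^p(R/I₀) → H^{p+1}(R/I₀). Its vanishing makes the torsion divisible by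
t^(e+1). So the torsion is infinitely divisible, and Krull's intersection theorem on a finitely
generated piece makes it zero. The map H^r → H^{r+1}, about which nothing is assumed, vanishes
because its source or its target does (`eq_zero_or_top_eq_zero`).

The isomorphisms of the fibers are isomorphisms of graded algebras and need not send variables to
variables. Hence the need for `exists_equiv`: cohomology depends only on the ideal generated by the
chosen elements, compatibly with scalars and gradings. -/

set_option linter.unusedSectionVars false

namespace GradedLC

open MvPolynomial

/-! ### Monomials and their exponents, over varying coefficient rings -/

section Monomials

variable {A : Type*} [CommRing A] {n : ℕ} {s t : Finset (Fin n)}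

theorem exists_eq_monomial (u : varMonoid A s) :
    ∃ a : Fin n →₀ ℕ, (∀ j ∉ s, a j = 0) ∧ (u : MvPolynomial (Fin n) A) = monomial a 1 := by
  obtain ⟨u, hu⟩ := u
  induction hu using Submonoid.closure_induction with
  | mem x hx =>
    obtain ⟨j, hj, rfl⟩ := hx
    refine ⟨Finsupp.single j 1, fun l hl => ?_, rfl⟩
    rw [Finsupp.single_apply, if_neg]
    rintro rfl
    exact hl hj
  | one => exact ⟨0, fun _ _ => rfl, rfl⟩
  | mul x y _ _ hx hy =>
    obtain ⟨a, ha, ea⟩ := hx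
    obtain ⟨b, hb, eb⟩ := hy
    refine ⟨a + b, fun j hj => by simp [ha j hj, hb j hj], ?_⟩
    simp only at ea eb ⊢
    rw [ea, eb, monomial_mul, one_mul]

theorem monomial_mem_varMonoid (A : Type*) [CommRing A] {a : Fin n →₀ ℕ}
    (h : ∀ j ∉ s, a j = 0) : monomial a (1 : A) ∈ varMonoid A s := by
  rw [monomial_eq, C_1, one_mul, Finsupp.prod]
  refine Submonoid.prod_mem _ fun j hj => Submonoid.pow_mem _ (Submonoid.subset_closure ?_) _
  refine Set.mem_image_of_mem _ ?_
  by_contra hjs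
  exact Finsupp.mem_support_iff.1 hj (h j hjs)

theorem X_mem_varMonoid (A : Type*) [CommRing A] {j : Fin n} (hj : j ∈ s) :
    (X j : MvPolynomial (Fin n) A) ∈ varMonoid A s :=
  Submonoid.subset_closure ⟨j, hj, rfl⟩

/-- The exponent of a monomial. -/
noncomputable def expo (u : varMonoid A s) : Fin n →₀ ℕ := (exists_eq_monomial u).choose

theorem expo_apply (u : varMonoid A s) {j : Fin n} (hj : j ∉ s) : expo u j = 0 :=
  (exists_eq_monomial u).choose_spec.1 j hj

theorem coe_eq_monomial (u : varMonoid A s) : (u : MvPolynomial (Fin n) A) = monomial (expo u) 1 :=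
  (exists_eq_monomial u).choose_spec.2

theorem expo_eq [Nontrivial A] (u : varMonoid A s) {a : Fin n →₀ ℕ}
    (h : (u : MvPolynomial (Fin n) A) = monomial a 1) : expo u = a := by
  rw [coe_eq_monomial] at h
  exact monomial_left_injective one_ne_zero h

@[simp] theorem expo_one [Nontrivial A] : expo (1 : varMonoid A s) = 0 := expo_eq _ rfl

@[simp] theorem expo_mul [Nontrivial A] (u v : varMonoid A s) : expo (u * v) = expo u + expo v := by
  apply expo_eq
  rw [Submonoid.coe_mul, coe_eq_monomial u, coe_eq_monomial v, monomial_mul, one_mul]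

/-- The degree of a monomial. -/
noncomputable def mdeg (u : varMonoid A s) : ℤ := ((expo u).degree : ℕ)

@[simp] theorem mdeg_one [Nontrivial A] : mdeg (1 : varMonoid A s) = 0 := by simp [mdeg]

@[simp] theorem mdeg_mul [Nontrivial A] (u v : varMonoid A s) :
    mdeg (u * v) = mdeg u + mdeg v := by simp [mdeg]

/-- The same monomial over another ring of coefficients. -/
noncomputable def tr (A' : Type*) [CommRing A'] (u : varMonoid A s) : varMonoid A' s :=
  ⟨monomial (expo u) 1, monomial_mem_varMonoid A' fun _ => expo_apply u⟩

variable (A' : Type*) [CommRing A']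

theorem coe_tr (u : varMonoid A s) :
    (tr A' u : MvPolynomial (Fin n) A') = monomial (expo u) 1 := rfl

@[simp] theorem tr_one [Nontrivial A] : tr A' (1 : varMonoid A s) = 1 :=
  Subtype.ext (by rw [coe_tr, expo_one]; rfl)

@[simp] theorem tr_mul [Nontrivial A] (u v : varMonoid A s) :
    tr A' (u * v) = tr A' u * tr A' v :=
  Subtype.ext (by rw [coe_tr, expo_mul, Submonoid.coe_mul, coe_tr, coe_tr, monomial_mul, one_mul])

@[simp] theorem expo_tr [Nontrivial A'] (u : varMonoid A s) : expo (tr A' u) = expo u :=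
  expo_eq _ rfl

@[simp] theorem mdeg_tr [Nontrivial A'] (u : varMonoid A s) : mdeg (tr A' u) = mdeg u := by
  simp [mdeg]

@[simp] theorem tr_tr (A'' : Type*) [CommRing A''] [Nontrivial A'] (u : varMonoid A s) :
    tr A'' (tr A' u) = tr A'' u :=
  Subtype.ext (by rw [coe_tr, coe_tr, expo_tr])

@[simp] theorem tr_self (u : varMonoid A s) : tr A u = u :=
  Subtype.ext (by rw [coe_tr, coe_eq_monomial u])

/-- Inclusion of monoids of monomials. -/
def incl (h : s ⊆ t) (u : varMonoid A s) : varMonoid A t := ⟨u, varMonoid_mono A h u.2⟩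

theorem coe_incl (h : s ⊆ t) (u : varMonoid A s) :
    (incl h u : MvPolynomial (Fin n) A) = u := rfl

@[simp] theorem expo_incl [Nontrivial A] (h : s ⊆ t) (u : varMonoid A s) :
    expo (incl h u) = expo u := expo_eq _ (coe_eq_monomial u)

@[simp] theorem mdeg_incl [Nontrivial A] (h : s ⊆ t) (u : varMonoid A s) :
    mdeg (incl h u) = mdeg u := by simp [mdeg]

@[simp] theorem tr_incl [Nontrivial A] (h : s ⊆ t) (u : varMonoid A s) :
    tr A' (incl h u) = incl h (tr A' u) :=
  Subtype.ext (by rw [coe_tr, coe_incl, coe_tr, expo_incl])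

end Monomials

/-! ### Fractions, restriction maps and the differential -/

section Localization

variable {A : Type*} [CommRing A] {n : ℕ} {M : Type*} [AddCommGroup M]
  [Module (MvPolynomial (Fin n) A) M] {s t : Finset (Fin n)}

theorem mk_eq_zero_iff (m : M) (u : varMonoid A s) :
    (LocalizedModule.mk m u : Loc A M s) = 0 ↔ ∃ v : varMonoid A s, v • m = 0 := by
  rw [← LocalizedModule.zero_mk 1, LocalizedModule.mk_eq]
  simp

theorem res_mk (h : s ⊆ t) (m : M) (u : varMonoid A s) :
    res A M h (LocalizedModule.mk m u) = LocalizedModule.mk m (incl h u) := by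
  rw [IsLocalizedModule.mk_eq_mk', res, IsLocalizedModule.liftOfLE_mk',
    IsLocalizedModule.mk_eq_mk']
  rfl

theorem cechD_apply (p : ℕ) (c : Cochain A n M p) (t : {t : Finset (Fin n) // t.card = p + 1}) :
    cechD A n M p c t = ∑ j : {j : Fin n // j ∈ t.1},
      ((-1 : MvPolynomial (Fin n) A) ^ (t.1.filter (· < j.1)).card) •
        res A M (Finset.erase_subset j.1 t.1) (c ⟨t.1.erase j.1, by
          rw [Finset.card_erase_of_mem j.2, t.2, Nat.add_sub_cancel]⟩) := by
  simp [cechD]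

end Localization

/-! ### Functoriality for degree-indexed families: linear maps and graded projections alike -/

/-- A family of additive maps `φ_μ : M → N` with `φ_{μ+1} (x_j m) = x_j φ_μ (m)`. -/
structure ShiftHom (A A' : Type*) [CommRing A] [CommRing A'] (n : ℕ) (M N : Type*)
    [AddCommGroup M] [Module (MvPolynomial (Fin n) A) M]
    [AddCommGroup N] [Module (MvPolynomial (Fin n) A') N] where
  /-- The underlying family of additive maps. -/
  toFun : ℤ → M →+ N
  map_X_smul : ∀ (μ : ℤ) (j : Fin n) (m : M), toFun (μ + 1) ((X j : MvPolynomial (Fin n) A) • m) =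
    (X j : MvPolynomial (Fin n) A') • toFun μ m

namespace ShiftHom

variable {A A' A'' : Type*} [CommRing A] [CommRing A'] [CommRing A''] {n : ℕ} {M N L : Type*}
  [AddCommGroup M] [Module (MvPolynomial (Fin n) A) M]
  [AddCommGroup N] [Module (MvPolynomial (Fin n) A') N]
  [AddCommGroup L] [Module (MvPolynomial (Fin n) A'') L]

instance : CoeFun (ShiftHom A A' n M N) fun _ => ℤ → M →+ N := ⟨ShiftHom.toFun⟩

/-- A single additive map commuting with the variables. -/
noncomputable def const (f : M →+ N) (hf : ∀ (j : Fin n) (m : M), f ((X j : MvPolynomial (Fin n) A) • m) =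
    (X j : MvPolynomial (Fin n) A') • f m) : ShiftHom A A' n M N where
  toFun _ := f
  map_X_smul _ := hf

/-- A linear map. -/
noncomputable def ofLinear {M' : Type*} [AddCommGroup M'] [Module (MvPolynomial (Fin n) A) M']
    (f : M →ₗ[MvPolynomial (Fin n) A] M') : ShiftHom A A n M M' :=
  const f.toAddMonoidHom fun _ m => f.map_smul _ m

/-- Composition of families. -/
noncomputable def comp (ψ : ShiftHom A' A'' n N L) (φ : ShiftHom A A' n M N) : ShiftHom A A'' n M L where
  toFun μ := (ψ μ).comp (φ μ)
  map_X_smul μ j m := by simp [φ.map_X_smul, ψ.map_X_smul]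

/-- Sum of families. -/
noncomputable def add (ψ φ : ShiftHom A A' n M N) : ShiftHom A A' n M N where
  toFun μ := ψ μ + φ μ
  map_X_smul μ j m := by simp [φ.map_X_smul, ψ.map_X_smul, smul_add]

/-- The family with its index shifted. -/
noncomputable def shift (φ : ShiftHom A A' n M N) (d : ℤ) : ShiftHom A A' n M N where
  toFun μ := φ (μ + d)
  map_X_smul μ j m := by rw [add_right_comm, φ.map_X_smul]

@[simp] theorem ofLinear_apply {M' : Type*} [AddCommGroup M'] [Module (MvPolynomial (Fin n) A) M']
    (f : M →ₗ[MvPolynomial (Fin n) A] M') (μ : ℤ) (m : M) : ofLinear f μ m = f m := rfl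

@[simp] theorem comp_apply (ψ : ShiftHom A' A'' n N L) (φ : ShiftHom A A' n M N) (μ : ℤ) (m : M) :
    ψ.comp φ μ m = ψ μ (φ μ m) := rfl

@[simp] theorem add_apply (ψ φ : ShiftHom A A' n M N) (μ : ℤ) (m : M) :
    ψ.add φ μ m = ψ μ m + φ μ m := rfl

@[simp] theorem shift_apply (φ : ShiftHom A A' n M N) (d μ : ℤ) :
    φ.shift d μ = φ (μ + d) := rfl

theorem monomial_add_smul (a b : Fin n →₀ ℕ) (m : M) :
    monomial (a + b) (1 : A) • m = monomial a (1 : A) • monomial b (1 : A) • m := by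
  rw [smul_smul, monomial_mul, one_mul]

theorem map_monomial_smul (φ : ShiftHom A A' n M N) (a : Fin n →₀ ℕ) (μ : ℤ) (m : M) :
    φ (μ + (a.degree : ℕ)) (monomial a (1 : A) • m) = monomial a (1 : A') • φ μ m := by
  induction a using Finsupp.induction_linear generalizing μ m with
  | zero => simp
  | add a b ha hb =>
    rw [monomial_add_smul, monomial_add_smul, ← hb, ← ha]
    congr 2
    simp only [map_add]
    push_cast
    ring
  | single j b =>
    induction b generalizing μ m with
    | zero => simp
    | succ b ihb =>
      rw [add_comm b 1, Finsupp.single_add, monomial_add_smul, monomial_add_smul, ← ihb, ← X, ← X,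
        ← φ.map_X_smul]
      congr 2
      simp only [map_add, Finsupp.degree_single]
      push_cast
      ring

variable {s : Finset (Fin n)}

theorem map_smul (φ : ShiftHom A A' n M N) (u : varMonoid A s) (μ : ℤ) (m : M) :
    φ (μ + mdeg u) (u • m) = tr A' u • φ μ m := by
  rw [Submonoid.smul_def, coe_eq_monomial, Submonoid.smul_def, coe_tr, mdeg, map_monomial_smul]

variable [Nontrivial A] [Nontrivial A']

/-- Multiplying a numerator by a monomial raises the index by its degree. After cross-multiplication
both numerators are therefore evaluated at the same index, μ plus the degrees of both denominators
and of the auxiliary monomial. -/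
theorem locMap_wd (φ : ShiftHom A A' n M N) (μ : ℤ) (p p' : M × varMonoid A s) (h : p ≈ p') :
    (LocalizedModule.mk (φ (μ + mdeg p.2) p.1) (tr A' p.2) : Loc A' N s) =
      LocalizedModule.mk (φ (μ + mdeg p'.2) p'.1) (tr A' p'.2) := by
  obtain ⟨m, u⟩ := p
  obtain ⟨m', u'⟩ := p'
  obtain ⟨v, hv⟩ := h
  rw [LocalizedModule.mk_eq]
  refine ⟨tr A' v, ?_⟩
  dsimp only at hv ⊢
  rw [smul_smul, smul_smul] at hv ⊢
  rw [← tr_mul, ← tr_mul, ← map_smul, ← map_smul, hv]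
  congr 2
  simp only [mdeg_mul]
  ring

/-- The map induced on localizations, `m / u ↦ φ_{μ + deg u}(m) / u`. -/
noncomputable def locMap (φ : ShiftHom A A' n M N) (μ : ℤ) (s : Finset (Fin n)) :
    Loc A M s →+ Loc A' N s :=
  AddMonoidHom.mk' (fun z => LocalizedModule.liftOn z
    (fun p => LocalizedModule.mk (φ (μ + mdeg p.2) p.1) (tr A' p.2)) (φ.locMap_wd μ)) (by
    intro x y
    induction x, y using LocalizedModule.induction_on₂ with | _ m m' u u'
    rw [LocalizedModule.mk_add_mk, LocalizedModule.liftOn_mk, LocalizedModule.liftOn_mk,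
      LocalizedModule.liftOn_mk, LocalizedModule.mk_add_mk, map_add]
    dsimp only
    rw [tr_mul, ← map_smul, ← map_smul, mdeg_mul]
    congr 3
    · congr 1; ring
    · rw [add_assoc, add_comm (mdeg u)])

@[simp] theorem locMap_mk (φ : ShiftHom A A' n M N) (μ : ℤ) (m : M) (u : varMonoid A s) :
    φ.locMap μ s (LocalizedModule.mk m u) = LocalizedModule.mk (φ (μ + mdeg u) m) (tr A' u) :=
  LocalizedModule.liftOn_mk (φ.locMap_wd μ) m u

variable {t : Finset (Fin n)}

theorem locMap_res (φ : ShiftHom A A' n M N) (μ : ℤ) (h : s ⊆ t) (z : Loc A M s) :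
    φ.locMap μ t (res A M h z) = res A' N h (φ.locMap μ s z) := by
  induction z using LocalizedModule.induction_on with | _ m u
  rw [res_mk, locMap_mk, locMap_mk, res_mk, mdeg_incl, tr_incl]

theorem locMap_comp [Nontrivial A''] (ψ : ShiftHom A' A'' n N L) (φ : ShiftHom A A' n M N) (μ : ℤ)
    (z : Loc A M s) : (ψ.comp φ).locMap μ s z = ψ.locMap μ s (φ.locMap μ s z) := by
  induction z using LocalizedModule.induction_on with | _ m u
  simp

theorem locMap_congr {φ ψ : ShiftHom A A' n M N} {μ ν : ℤ} (h : ∀ d : ℤ, φ (μ + d) = ψ (ν + d)) :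
    φ.locMap μ s = ψ.locMap ν s := by
  ext z
  induction z using LocalizedModule.induction_on with | _ m u
  simp [h]

theorem locMap_id {φ : ShiftHom A A n M M} {μ : ℤ} (h : ∀ (d : ℤ) (m : M), φ (μ + d) m = m)
    (z : Loc A M s) : φ.locMap μ s z = z := by
  induction z using LocalizedModule.induction_on with | _ m u
  simp [h]

theorem locMap_zero {φ : ShiftHom A A' n M N} {μ : ℤ} (h : ∀ (d : ℤ) (m : M), φ (μ + d) m = 0)
    (z : Loc A M s) : φ.locMap μ s z = 0 := by
  induction z using LocalizedModule.induction_on with | _ m u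
  simp [h]

theorem locMap_add (φ ψ : ShiftHom A A' n M N) (μ : ℤ) (z : Loc A M s) :
    (φ.add ψ).locMap μ s z = φ.locMap μ s z + ψ.locMap μ s z := by
  induction z using LocalizedModule.induction_on with | _ m u
  simp only [locMap_mk, add_apply]
  rw [LocalizedModule.mk_add_mk, ← smul_add, LocalizedModule.mk_cancel_common_left]

/-- The map induced on Cech cochains. -/
noncomputable def cochainMap (φ : ShiftHom A A' n M N) (μ : ℤ) (p : ℕ) :
    Cochain A n M p →+ Cochain A' n N p where
  toFun c s := φ.locMap μ s.1 (c s)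
  map_zero' := by ext s; simp
  map_add' c c' := by ext s; simp

@[simp] theorem cochainMap_apply (φ : ShiftHom A A' n M N) (μ : ℤ) (p : ℕ) (c : Cochain A n M p)
    (s : {s : Finset (Fin n) // s.card = p}) : φ.cochainMap μ p c s = φ.locMap μ s.1 (c s) := rfl

theorem locMap_neg_one_pow_smul (φ : ShiftHom A A' n M N) (μ : ℤ) (e : ℕ) (z : Loc A M s) :
    φ.locMap μ s ((-1 : MvPolynomial (Fin n) A) ^ e • z) =
      (-1 : MvPolynomial (Fin n) A') ^ e • φ.locMap μ s z := by
  rcases Nat.even_or_odd e with h | h <;> simp [h.neg_one_pow]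

theorem cechD_cochainMap (φ : ShiftHom A A' n M N) (μ : ℤ) (p : ℕ) (c : Cochain A n M p) :
    cechD A' n N p (φ.cochainMap μ p c) = φ.cochainMap μ (p + 1) (cechD A n M p c) := by
  ext t
  rw [cochainMap_apply, cechD_apply, cechD_apply, map_sum]
  refine Finset.sum_congr rfl fun j _ => ?_
  rw [locMap_neg_one_pow_smul, locMap_res, cochainMap_apply]

end ShiftHom

/-! ### Cohomology classes and the maps induced on them -/

section Classes

variable {A : Type*} [CommRing A] {n : ℕ} {M : Type*} [AddCommGroup M]
  [Module (MvPolynomial (Fin n) A) M] {p : ℕ}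

/-- The class of a cocycle. -/
noncomputable def cls (c : Cochain A n M p) (hc : cechD A n M p c = 0) : H A n M p :=
  Submodule.Quotient.mk ⟨c, hc⟩

theorem cls_surjective (z : H A n M p) : ∃ c hc, cls (A := A) (M := M) (p := p) c hc = z := by
  obtain ⟨⟨c, hc⟩, rfl⟩ := Submodule.Quotient.mk_surjective _ z
  exact ⟨c, hc, rfl⟩

theorem cls_eq_zero_iff (c : Cochain A n M p) (hc) :
    cls c hc = 0 ↔ c ∈ coboundaries A n M p := by
  rw [cls, Submodule.Quotient.mk_eq_zero]
  rfl

theorem cls_zero : cls (0 : Cochain A n M p) (map_zero _) = 0 :=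
  (cls_eq_zero_iff _ _).2 (zero_mem _)

theorem cls_add (c c' : Cochain A n M p) (hc hc') :
    cls (c + c') (by rw [map_add, hc, hc', add_zero]) = cls c hc + cls c' hc' := rfl

theorem cls_sub (c c' : Cochain A n M p) (hc hc') :
    cls (c - c') (by rw [map_sub, hc, hc', sub_zero]) = cls c hc - cls c' hc' := rfl

theorem cls_smul (g : MvPolynomial (Fin n) A) (c : Cochain A n M p) (hc) :
    g • cls c hc = cls (g • c) (by rw [map_smul, hc, smul_zero]) := rfl

theorem cls_congr {c c' : Cochain A n M p} (h : c = c') (hc) :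
    cls c hc = cls c' (h ▸ hc) := by subst h; rfl

theorem cls_eq_iff (c c' : Cochain A n M p) (hc hc') :
    cls c hc = cls c' hc' ↔ c - c' ∈ coboundaries A n M p := by
  rw [← sub_eq_zero, ← cls_sub, cls_eq_zero_iff]

theorem mem_coboundaries_succ {c : Cochain A n M (p + 1)} :
    c ∈ coboundaries A n M (p + 1) ↔ ∃ b, cechD A n M p b = c := Iff.rfl

theorem mem_coboundaries_zero {c : Cochain A n M 0} :
    c ∈ coboundaries A n M 0 ↔ c = 0 := Iff.rfl

end Classes

namespace ShiftHom

variable {A A' A'' : Type*} [CommRing A] [CommRing A'] [CommRing A''] {n : ℕ} {M N L : Type*}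
  [AddCommGroup M] [Module (MvPolynomial (Fin n) A) M]
  [AddCommGroup N] [Module (MvPolynomial (Fin n) A') N]
  [AddCommGroup L] [Module (MvPolynomial (Fin n) A'') L]
  [Nontrivial A] [Nontrivial A'] [Nontrivial A'']

theorem cochainMap_mem_coboundaries (φ : ShiftHom A A' n M N) (μ : ℤ) {p : ℕ}
    {c : Cochain A n M p} (hc : c ∈ coboundaries A n M p) :
    φ.cochainMap μ p c ∈ coboundaries A' n N p := by
  cases p with
  | zero => rw [mem_coboundaries_zero] at hc ⊢; rw [hc, map_zero]
  | succ p =>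
    obtain ⟨b, rfl⟩ := mem_coboundaries_succ.1 hc
    exact mem_coboundaries_succ.2 ⟨_, φ.cechD_cochainMap μ p b⟩

theorem cechD_cochainMap_eq_zero (φ : ShiftHom A A' n M N) (μ : ℤ) {p : ℕ}
    {c : Cochain A n M p} (hc : cechD A n M p c = 0) :
    cechD A' n N p (φ.cochainMap μ p c) = 0 := by
  rw [cechD_cochainMap, hc, map_zero]

theorem exists_Hmap (φ : ShiftHom A A' n M N) (μ : ℤ) (p : ℕ) : ∃ F : H A n M p →+ H A' n N p,
    ∀ c hc, F (cls c hc) = cls (φ.cochainMap μ p c) (φ.cechD_cochainMap_eq_zero μ hc) := by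
  have key : ∀ z : H A n M p, ∃ w : H A' n N p, ∀ c hc, cls c hc = z →
      w = cls (φ.cochainMap μ p c) (φ.cechD_cochainMap_eq_zero μ hc) := by
    intro z
    obtain ⟨c, hc, rfl⟩ := cls_surjective z
    refine ⟨cls _ (φ.cechD_cochainMap_eq_zero μ hc), fun c' hc' h => ?_⟩
    rw [cls_eq_iff, ← map_sub]
    exact φ.cochainMap_mem_coboundaries μ ((cls_eq_iff _ _ _ _).1 h.symm)
  choose F hF using key
  refine ⟨AddMonoidHom.mk' F fun z w => ?_, fun c hc => hF _ c hc rfl⟩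
  obtain ⟨c, hc, rfl⟩ := cls_surjective z
  obtain ⟨c', hc', rfl⟩ := cls_surjective w
  rw [hF _ c hc rfl, hF _ c' hc' rfl, hF _ (c + c') _ (cls_add _ _ hc hc'), ← cls_add]
  exact cls_congr (map_add _ _ _) _

/-- The map induced on local cohomology. -/
noncomputable def Hmap (φ : ShiftHom A A' n M N) (μ : ℤ) (p : ℕ) : H A n M p →+ H A' n N p :=
  (φ.exists_Hmap μ p).choose

theorem Hmap_cls (φ : ShiftHom A A' n M N) (μ : ℤ) (p : ℕ) (c : Cochain A n M p) (hc) :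
    φ.Hmap μ p (cls c hc) = cls (φ.cochainMap μ p c) (φ.cechD_cochainMap_eq_zero μ hc) :=
  (φ.exists_Hmap μ p).choose_spec c hc

theorem Hmap_comp (ψ : ShiftHom A' A'' n N L) (φ : ShiftHom A A' n M N) (μ : ℤ) (p : ℕ)
    (z : H A n M p) : (ψ.comp φ).Hmap μ p z = ψ.Hmap μ p (φ.Hmap μ p z) := by
  obtain ⟨c, hc, rfl⟩ := cls_surjective z
  rw [Hmap_cls, Hmap_cls, Hmap_cls]
  exact cls_congr (by ext s; exact locMap_comp _ _ _ _) _

theorem Hmap_congr {φ ψ : ShiftHom A A' n M N} {μ ν : ℤ} (h : ∀ d : ℤ, φ (μ + d) = ψ (ν + d))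
    (p : ℕ) : φ.Hmap μ p = ψ.Hmap ν p := by
  ext z
  obtain ⟨c, hc, rfl⟩ := cls_surjective z
  rw [Hmap_cls, Hmap_cls]
  exact cls_congr (by ext s; exact DFunLike.congr_fun (locMap_congr h) _) _

theorem Hmap_id {φ : ShiftHom A A n M M} {μ : ℤ} (h : ∀ (d : ℤ) (m : M), φ (μ + d) m = m)
    (p : ℕ) (z : H A n M p) : φ.Hmap μ p z = z := by
  obtain ⟨c, hc, rfl⟩ := cls_surjective z
  rw [Hmap_cls]
  exact cls_congr (by ext s; exact locMap_id h _) _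

theorem Hmap_zero {φ : ShiftHom A A' n M N} {μ : ℤ} (h : ∀ (d : ℤ) (m : M), φ (μ + d) m = 0)
    (p : ℕ) (z : H A n M p) : φ.Hmap μ p z = 0 := by
  obtain ⟨c, hc, rfl⟩ := cls_surjective z
  rw [Hmap_cls, ← cls_zero]
  exact cls_congr (by ext s; exact locMap_zero h _) _

theorem Hmap_add (φ ψ : ShiftHom A A' n M N) (μ : ℤ) (p : ℕ) (z : H A n M p) :
    (φ.add ψ).Hmap μ p z = φ.Hmap μ p z + ψ.Hmap μ p z := by
  obtain ⟨c, hc, rfl⟩ := cls_surjective z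
  rw [Hmap_cls, Hmap_cls, Hmap_cls, ← cls_add]
  exact cls_congr (by ext s; exact locMap_add _ _ _ _) _

/-- Commutative squares of families induce commutative squares on local cohomology. -/
theorem Hmap_comm {B : Type*} [CommRing B] [Nontrivial B] {Q : Type*} [AddCommGroup Q]
    [Module (MvPolynomial (Fin n) B) Q]
    {ψ : ShiftHom A' A'' n N L} {φ : ShiftHom A A' n M N}
    {ψ' : ShiftHom B A'' n Q L} {φ' : ShiftHom A B n M Q} {μ μ' ν ν' : ℤ}
    (h : ∀ (d : ℤ) (m : M), ψ (ν + d) (φ (μ + d) m) = ψ' (ν' + d) (φ' (μ' + d) m)) (p : ℕ)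
    (z : H A n M p) : ψ.Hmap ν p (φ.Hmap μ p z) = ψ'.Hmap ν' p (φ'.Hmap μ' p z) := by
  have e1 : ψ.Hmap ν p = (ψ.shift (ν - μ)).Hmap μ p :=
    Hmap_congr (fun d => by rw [shift_apply]; congr 1; ring) p
  have e2 : ψ'.Hmap ν' p = (ψ'.shift (ν' - μ')).Hmap μ' p :=
    Hmap_congr (fun d => by rw [shift_apply]; congr 1; ring) p
  rw [e1, e2, ← Hmap_comp, ← Hmap_comp]
  refine DFunLike.congr_fun (Hmap_congr (fun d => ?_) p) z
  ext m
  have := h d m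
  simp only [comp_apply, shift_apply]
  convert! this using 3 <;> ring_nf

/-- This turns the module structure of cohomology into an instance of functoriality, so that
linearity of induced and connecting maps follows from naturality. -/
theorem Hmap_ofLinear_smul (g : MvPolynomial (Fin n) A) (μ : ℤ) (p : ℕ) (z : H A n M p) :
    (ofLinear (g • (LinearMap.id : M →ₗ[MvPolynomial (Fin n) A] M))).Hmap μ p z = g • z := by
  obtain ⟨c, hc, rfl⟩ := cls_surjective z
  rw [Hmap_cls, cls_smul]
  refine cls_congr ?_ _
  ext s
  rw [cochainMap_apply, Pi.smul_apply]
  induction c s using LocalizedModule.induction_on with | _ m u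
  rw [locMap_mk, LocalizedModule.smul'_mk]
  simp

end ShiftHom

end GradedLC

namespace GradedLC

open MvPolynomial

/-! ### The square of the Čech differential -/

section DSquared

variable {A : Type*} [CommRing A] {n : ℕ} {M : Type*} [AddCommGroup M]
  [Module (MvPolynomial (Fin n) A) M] {s t t' : Finset (Fin n)} {p : ℕ}

theorem res_res (h : s ⊆ t) (h' : t ⊆ t') (z : Loc A M s) :
    res A M h' (res A M h z) = res A M (h.trans h') z := by
  induction z using LocalizedModule.induction_on with | _ m u
  simp only [res_mk]
  rfl

/-- The restriction to `t'` of the component at `s` of a cochain, zero if this makes no sense. -/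
noncomputable def resExt (c : Cochain A n M p) (t' s : Finset (Fin n)) : Loc A M t' := by
  classical
  exact if h : s ⊆ t' ∧ s.card = p then res A M h.1 (c ⟨s, h.2⟩) else 0

theorem resExt_eq (c : Cochain A n M p) (h : s ⊆ t') (hs : s.card = p) :
    resExt c t' s = res A M h (c ⟨s, hs⟩) := dif_pos ⟨h, hs⟩

theorem res_cechD (c : Cochain A n M p) (ht : t.card = p + 1) (h : t ⊆ t') :
    res A M h (cechD A n M p c ⟨t, ht⟩) = ∑ j ∈ t,
      ((-1 : MvPolynomial (Fin n) A) ^ (t.filter (· < j)).card) • resExt c t' (t.erase j) := by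
  rw [cechD_apply, map_sum, ← Finset.sum_coe_sort t]
  refine Finset.sum_congr rfl fun j _ => ?_
  rw [map_smul, res_res, resExt_eq]

theorem cechD_apply' (c : Cochain A n M p) (ht : t.card = p + 1) :
    cechD A n M p c ⟨t, ht⟩ = ∑ j ∈ t,
      ((-1 : MvPolynomial (Fin n) A) ^ (t.filter (· < j)).card) • resExt c t (t.erase j) := by
  rw [cechD_apply, ← Finset.sum_coe_sort t]
  refine Finset.sum_congr rfl fun j _ => ?_
  rw [resExt_eq]

/-- Deleting l lowers the position of the larger index j by one, while deleting j does not move l.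
So the two orders of deletion carry opposite signs. -/
theorem card_filter_erase {j l : Fin n} (hl : l ∈ t) (h : l < j) :
    (-1 : MvPolynomial (Fin n) A) ^ (t.filter (· < j)).card *
      (-1) ^ ((t.erase j).filter (· < l)).card =
    -((-1) ^ (t.filter (· < l)).card * (-1) ^ ((t.erase l).filter (· < j)).card) := by
  have h1 : (t.erase j).filter (· < l) = t.filter (· < l) := by
    ext i
    simp only [Finset.mem_filter, Finset.mem_erase]
    constructor
    · rintro ⟨⟨_, h⟩, h'⟩; exact ⟨h, h'⟩
    · rintro ⟨hi, h'⟩; exact ⟨⟨(h'.trans h).ne, hi⟩, h'⟩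
  have h2 : (t.filter (· < j)).card = ((t.erase l).filter (· < j)).card + 1 := by
    rw [← Finset.card_erase_add_one (a := l) (s := t.filter (· < j)) (by simp [hl, h]),
      Finset.filter_erase]
  rw [h1, h2, pow_succ]
  ring

/-- The terms are indexed by ordered pairs of distinct deleted indices, and exchanging the two is a
fixed-point-free involution that reverses signs. -/
theorem cechD_cechD (c : Cochain A n M p) :
    cechD A n M (p + 1) (cechD A n M p c) = 0 := by
  ext ⟨t, ht⟩
  rw [cechD_apply']
  have h1 : ∀ j ∈ t, ((-1 : MvPolynomial (Fin n) A) ^ (t.filter (· < j)).card) •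
      resExt (cechD A n M p c) t (t.erase j) = ∑ l ∈ t.erase j,
      ((-1 : MvPolynomial (Fin n) A) ^ (t.filter (· < j)).card *
        (-1) ^ ((t.erase j).filter (· < l)).card) • resExt c t ((t.erase j).erase l) := by
    intro j hj
    rw [resExt_eq _ (Finset.erase_subset j t) (by rw [Finset.card_erase_of_mem hj, ht]; rfl),
      res_cechD, Finset.smul_sum]
    simp only [smul_smul]
  rw [Finset.sum_congr rfl h1, Finset.sum_sigma']
  refine Finset.sum_involution (fun x _ => ⟨x.2, x.1⟩) ?_ ?_ ?_ ?_
  · rintro ⟨j, l⟩ h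
    simp only [Finset.mem_sigma, Finset.mem_erase] at h
    obtain ⟨hj, hne, hl⟩ := h
    dsimp only
    rw [Finset.erase_right_comm (a := l), ← add_smul]
    rcases lt_or_gt_of_ne hne with h | h
    · rw [card_filter_erase hl h, neg_add_cancel, zero_smul]
    · rw [card_filter_erase hj h, add_neg_cancel, zero_smul]
  · rintro ⟨j, l⟩ h _ e
    simp only [Finset.mem_sigma, Finset.mem_erase] at h
    exact h.2.1 (congrArg Sigma.fst e)
  · rintro ⟨j, l⟩ h
    simp only [Finset.mem_sigma, Finset.mem_erase] at h ⊢
    exact ⟨h.2.2, fun e => h.2.1 e.symm, h.1⟩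
  · intros; rfl

theorem cechD_eq_zero_of_mem {c : Cochain A n M p} (hc : c ∈ coboundaries A n M p) :
    cechD A n M p c = 0 := by
  cases p with
  | zero => rw [mem_coboundaries_zero] at hc; rw [hc, map_zero]
  | succ p => obtain ⟨b, rfl⟩ := mem_coboundaries_succ.1 hc; exact cechD_cechD b

end DSquared

/-! ### Long exact sequences in Čech cohomology -/

/-- A short exact sequence `0 → K → M → N → 0` whose first map is only required to be injective
up to elements that are torsion with respect to every variable. -/
structure WeakSES (A₁ A₂ A₃ : Type*) [CommRing A₁] [CommRing A₂] [CommRing A₃] (n : ℕ)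
    {K M N : Type*} [AddCommGroup K] [Module (MvPolynomial (Fin n) A₁) K]
    [AddCommGroup M] [Module (MvPolynomial (Fin n) A₂) M]
    [AddCommGroup N] [Module (MvPolynomial (Fin n) A₃) N] (f : K →+ M) (g : M →+ N) : Prop where
  map_X_left : ∀ (j : Fin n) (m : K), f ((X j : MvPolynomial (Fin n) A₁) • m) =
    (X j : MvPolynomial (Fin n) A₂) • f m
  map_X_right : ∀ (j : Fin n) (m : M), g ((X j : MvPolynomial (Fin n) A₂) • m) =
    (X j : MvPolynomial (Fin n) A₃) • g m
  torsion : ∀ k, f k = 0 → ∀ j : Fin n, ∃ e : ℕ, (X j : MvPolynomial (Fin n) A₁) ^ e • k = 0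
  comp_zero : ∀ k, g (f k) = 0
  exact : ∀ m, g m = 0 → ∃ k, f k = m
  surj : Function.Surjective g

namespace WeakSES

variable {A₁ A₂ A₃ : Type*} [CommRing A₁] [CommRing A₂] [CommRing A₃] {n : ℕ}
    {K M N : Type*} [AddCommGroup K] [Module (MvPolynomial (Fin n) A₁) K]
    [AddCommGroup M] [Module (MvPolynomial (Fin n) A₂) M]
    [AddCommGroup N] [Module (MvPolynomial (Fin n) A₃) N] {f : K →+ M} {g : M →+ N}
    (S : WeakSES A₁ A₂ A₃ n f g)

/-- The first map. -/
noncomputable def left : ShiftHom A₁ A₂ n K M := ShiftHom.const f S.map_X_left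

/-- The second map. -/
noncomputable def right : ShiftHom A₂ A₃ n M N := ShiftHom.const g S.map_X_right

@[simp] theorem left_apply (μ : ℤ) (k : K) : S.left μ k = f k := rfl

@[simp] theorem right_apply (μ : ℤ) (m : M) : S.right μ m = g m := rfl

variable [Nontrivial A₁] [Nontrivial A₂] [Nontrivial A₃] {s : Finset (Fin n)}

theorem left_smul (S : WeakSES A₁ A₂ A₃ n f g) (u : varMonoid A₁ s) (k : K) : f (u • k) = tr A₂ u • f k :=
  S.left.map_smul u 0 k

theorem right_smul (S : WeakSES A₁ A₂ A₃ n f g) (u : varMonoid A₂ s) (m : M) : g (u • m) = tr A₃ u • g m :=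
  S.right.map_smul u 0 m

theorem locMap_right_surjective (z : Loc A₃ N s) : ∃ w, S.right.locMap 0 s w = z := by
  induction z using LocalizedModule.induction_on with | _ m u
  obtain ⟨m, rfl⟩ := S.surj m
  exact ⟨LocalizedModule.mk m (tr A₂ u), by simp⟩

theorem locMap_exact (z : Loc A₂ M s) (hz : S.right.locMap 0 s z = 0) :
    ∃ w, S.left.locMap 0 s w = z := by
  induction z using LocalizedModule.induction_on with | _ m u
  rw [ShiftHom.locMap_mk, mk_eq_zero_iff] at hz
  obtain ⟨v, hv⟩ := hz
  have h1 : g (tr A₂ v • m) = 0 := by rw [S.right_smul, tr_tr, tr_self]; exact hv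
  obtain ⟨k, hk⟩ := S.exact _ h1
  refine ⟨LocalizedModule.mk k (tr A₁ (tr A₂ v * u)), ?_⟩
  rw [ShiftHom.locMap_mk, left_apply, hk, tr_tr, tr_self, LocalizedModule.mk_cancel_common_left]

theorem locMap_comp_zero (z : Loc A₁ K s) : S.right.locMap 0 s (S.left.locMap 0 s z) = 0 := by
  rw [← ShiftHom.locMap_comp]
  exact ShiftHom.locMap_zero (fun _ m => S.comp_zero m) z

/-- The kernel of f is torsion for every variable, so inverting a single one kills it. Only the
empty set, that is cochain degree zero, escapes; this is why weak exactness suffices for the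
connecting maps. -/
theorem locMap_left_injective (hs : s.Nonempty) (z : Loc A₁ K s) (hz : S.left.locMap 0 s z = 0) :
    z = 0 := by
  obtain ⟨j, hj⟩ := hs
  induction z using LocalizedModule.induction_on with | _ m u
  rw [ShiftHom.locMap_mk, mk_eq_zero_iff] at hz
  obtain ⟨v, hv⟩ := hz
  have h1 : f (tr A₁ v • m) = 0 := by rw [S.left_smul, tr_tr, tr_self]; exact hv
  obtain ⟨e, he⟩ := S.torsion _ h1 j
  rw [mk_eq_zero_iff]
  refine ⟨⟨X j, X_mem_varMonoid A₁ hj⟩ ^ e * tr A₁ v, ?_⟩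
  rw [mul_smul]
  exact he

theorem locMap_left_injective' (hf : Function.Injective f) (z : Loc A₁ K s)
    (hz : S.left.locMap 0 s z = 0) : z = 0 := by
  induction z using LocalizedModule.induction_on with | _ m u
  rw [ShiftHom.locMap_mk, mk_eq_zero_iff] at hz
  obtain ⟨v, hv⟩ := hz
  have h1 : f (tr A₁ v • m) = 0 := by rw [S.left_smul, tr_tr, tr_self]; exact hv
  exact (mk_eq_zero_iff _ _).2 ⟨_, hf (h1.trans (map_zero f).symm)⟩

theorem right_surjective {p : ℕ} (c : Cochain A₃ n N p) : ∃ b, S.right.cochainMap 0 p b = c := by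
  choose b hb using fun s => S.locMap_right_surjective (c s)
  exact ⟨b, funext hb⟩

theorem cochain_exact {p : ℕ} (b : Cochain A₂ n M p) (hb : S.right.cochainMap 0 p b = 0) :
    ∃ a, S.left.cochainMap 0 p a = b := by
  choose a ha using fun s => S.locMap_exact (b s) (congrFun hb s)
  exact ⟨a, funext ha⟩

theorem cochain_comp_zero {p : ℕ} (a : Cochain A₁ n K p) :
    S.right.cochainMap 0 p (S.left.cochainMap 0 p a) = 0 :=
  funext fun s => S.locMap_comp_zero (a s)

theorem left_injective {p : ℕ} (a : Cochain A₁ n K (p + 1))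
    (ha : S.left.cochainMap 0 (p + 1) a = 0) : a = 0 := by
  ext s : 1
  rw [Pi.zero_apply]
  refine S.locMap_left_injective (Finset.card_pos.1 (by rw [s.2]; exact Nat.succ_pos p)) _ ?_
  rw [← ShiftHom.cochainMap_apply, ha, Pi.zero_apply]

theorem left_injective_zero (hf : Function.Injective f) (a : Cochain A₁ n K 0)
    (ha : S.left.cochainMap 0 0 a = 0) : a = 0 := by
  ext s : 1
  rw [Pi.zero_apply]
  refine S.locMap_left_injective' hf _ ?_
  rw [← ShiftHom.cochainMap_apply, ha, Pi.zero_apply]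

/-- Lifting a coboundary, up to the image of `K`. -/
theorem exists_lift_of_mem_coboundaries {p : ℕ} (b : Cochain A₂ n M p)
    (hb : S.right.cochainMap 0 p b ∈ coboundaries A₃ n N p) :
    ∃ a : Cochain A₁ n K p, b - S.left.cochainMap 0 p a ∈ coboundaries A₂ n M p := by
  cases p with
  | zero =>
    obtain ⟨a, ha⟩ := S.cochain_exact b (mem_coboundaries_zero.1 hb)
    exact ⟨a, by rw [ha, sub_self]; exact zero_mem _⟩
  | succ p =>
    obtain ⟨c, hc⟩ := mem_coboundaries_succ.1 hb
    obtain ⟨e, rfl⟩ := S.right_surjective c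
    obtain ⟨a, ha⟩ := S.cochain_exact (b - cechD A₂ n M p e) (by
      rw [map_sub, ← ShiftHom.cechD_cochainMap, hc, sub_self])
    exact ⟨a, mem_coboundaries_succ.2 ⟨e, by rw [ha]; abel⟩⟩

theorem exists_conn {p : ℕ} (z : H A₃ n N p) :
    ∃ (b : Cochain A₂ n M p) (a : Cochain A₁ n K (p + 1))
      (hb : cechD A₃ n N p (S.right.cochainMap 0 p b) = 0) (_ : cechD A₁ n K (p + 1) a = 0),
      S.left.cochainMap 0 (p + 1) a = cechD A₂ n M p b ∧ z = cls _ hb := by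
  obtain ⟨c, hc, rfl⟩ := cls_surjective z
  obtain ⟨b, rfl⟩ := S.right_surjective c
  obtain ⟨a, ha⟩ := S.cochain_exact (cechD A₂ n M p b) (by rw [← ShiftHom.cechD_cochainMap, hc])
  refine ⟨b, a, hc, S.left_injective _ ?_, ha, rfl⟩
  rw [← ShiftHom.cechD_cochainMap, ha, cechD_cechD]

/-- Equality of the classes in N makes b − b' the image of some cochain k of K, up to a coboundary.
Applying d and cancelling the injective first map gives a − a' = dk. -/
theorem conn_unique {p : ℕ} {b b' : Cochain A₂ n M p} {a a' : Cochain A₁ n K (p + 1)}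
    (hb : cechD A₃ n N p (S.right.cochainMap 0 p b) = 0)
    (hb' : cechD A₃ n N p (S.right.cochainMap 0 p b') = 0)
    (ha : cechD A₁ n K (p + 1) a = 0) (ha' : cechD A₁ n K (p + 1) a' = 0)
    (h : S.left.cochainMap 0 (p + 1) a = cechD A₂ n M p b)
    (h' : S.left.cochainMap 0 (p + 1) a' = cechD A₂ n M p b')
    (e : cls _ hb = cls _ hb') : cls a ha = cls a' ha' := by
  rw [cls_eq_iff, ← map_sub] at e
  rw [cls_eq_iff]
  obtain ⟨k, hk⟩ := S.exists_lift_of_mem_coboundaries _ e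
  refine mem_coboundaries_succ.2 ⟨k, ?_⟩
  rw [← sub_eq_zero]
  apply S.left_injective
  have := cechD_eq_zero_of_mem hk
  rw [map_sub, map_sub, ← h, ← h', ShiftHom.cechD_cochainMap, sub_eq_zero] at this
  rw [map_sub, map_sub, ← this, sub_self]

theorem exists_delta (p : ℕ) : ∃ δ : H A₃ n N p →+ H A₁ n K (p + 1),
    ∀ (b : Cochain A₂ n M p) (a : Cochain A₁ n K (p + 1)) (hb) (ha),
      S.left.cochainMap 0 (p + 1) a = cechD A₂ n M p b →
        δ (cls (S.right.cochainMap 0 p b) hb) = cls a ha := by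
  choose b a hb ha h e using fun z => S.exists_conn (p := p) z
  refine ⟨AddMonoidHom.mk' (fun z => cls (a z) (ha z)) fun z w => ?_, fun b' a' hb' ha' h' => ?_⟩
  · rw [← cls_add]
    refine S.conn_unique (hb _) (b' := b z + b w) ?_ (ha _) _ (h _) ?_ ?_
    · rw [map_add, map_add, hb, hb, add_zero]
    · rw [map_add, map_add, h, h]
    · rw [← e, cls_congr (map_add _ _ _), cls_add _ _ (hb z) (hb w), ← e, ← e]
  · exact S.conn_unique (hb _) hb' (ha _) ha' (h _) h' (e _).symm

/-- The connecting map. -/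
noncomputable def delta (p : ℕ) : H A₃ n N p →+ H A₁ n K (p + 1) := (S.exists_delta p).choose

theorem delta_cls {p : ℕ} (b : Cochain A₂ n M p) (a : Cochain A₁ n K (p + 1)) (hb) (ha)
    (h : S.left.cochainMap 0 (p + 1) a = cechD A₂ n M p b) :
    S.delta p (cls (S.right.cochainMap 0 p b) hb) = cls a ha :=
  (S.exists_delta p).choose_spec b a hb ha h

theorem Hmap_comp_zero {p : ℕ} (z : H A₁ n K p) :
    S.right.Hmap 0 p (S.left.Hmap 0 p z) = 0 := by
  rw [← ShiftHom.Hmap_comp]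
  exact ShiftHom.Hmap_zero (fun _ m => S.comp_zero m) p z

/-- Exactness at `H^p(M)`. -/
theorem exact_middle {p : ℕ} (z : H A₂ n M p) (hz : S.right.Hmap 0 p z = 0) :
    ∃ w, S.left.Hmap 0 p w = z := by
  obtain ⟨b, hb, rfl⟩ := cls_surjective z
  rw [ShiftHom.Hmap_cls, cls_eq_zero_iff] at hz
  obtain ⟨a, ha⟩ := S.exists_lift_of_mem_coboundaries _ hz
  have h1 : cechD A₁ n K p a = 0 := by
    apply S.left_injective
    have := cechD_eq_zero_of_mem ha
    rw [map_sub, hb, zero_sub, neg_eq_zero] at this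
    rw [← ShiftHom.cechD_cochainMap, this]
  refine ⟨cls a h1, ?_⟩
  rw [ShiftHom.Hmap_cls, eq_comm, cls_eq_iff]
  exact ha

/-- Exactness at `H^p(N)`. -/
theorem exact_right {p : ℕ} (z : H A₃ n N p) (hz : S.delta p z = 0) :
    ∃ w, S.right.Hmap 0 p w = z := by
  obtain ⟨b, a, hb, ha, h, rfl⟩ := S.exists_conn z
  rw [S.delta_cls b a hb ha h, cls_eq_zero_iff] at hz
  obtain ⟨k, rfl⟩ := mem_coboundaries_succ.1 hz
  have h1 : cechD A₂ n M p (b - S.left.cochainMap 0 p k) = 0 := by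
    rw [map_sub, ← h, ShiftHom.cechD_cochainMap, sub_self]
  refine ⟨cls _ h1, ?_⟩
  rw [ShiftHom.Hmap_cls]
  exact cls_congr (by rw [map_sub, S.cochain_comp_zero, sub_zero]) _

theorem delta_Hmap {p : ℕ} (z : H A₂ n M p) : S.delta p (S.right.Hmap 0 p z) = 0 := by
  obtain ⟨b, hb, rfl⟩ := cls_surjective z
  rw [ShiftHom.Hmap_cls, S.delta_cls b 0 _ (map_zero _) (by rw [hb, map_zero]), cls_zero]

/-- Exactness at `H^{p+1}(K)`. -/
theorem exact_left {p : ℕ} (z : H A₁ n K (p + 1)) (hz : S.left.Hmap 0 (p + 1) z = 0) :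
    ∃ w, S.delta p w = z := by
  obtain ⟨a, ha, rfl⟩ := cls_surjective z
  rw [ShiftHom.Hmap_cls, cls_eq_zero_iff] at hz
  obtain ⟨b, hb⟩ := mem_coboundaries_succ.1 hz
  have h1 : cechD A₃ n N p (S.right.cochainMap 0 p b) = 0 := by
    rw [ShiftHom.cechD_cochainMap, hb, S.cochain_comp_zero]
  exact ⟨cls _ h1, S.delta_cls b a h1 ha hb.symm⟩

theorem Hmap_delta {p : ℕ} (z : H A₃ n N p) : S.left.Hmap 0 (p + 1) (S.delta p z) = 0 := by
  obtain ⟨b, a, hb, ha, h, rfl⟩ := S.exists_conn z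
  rw [S.delta_cls b a hb ha h, ShiftHom.Hmap_cls, cls_eq_zero_iff]
  exact mem_coboundaries_succ.2 ⟨b, h.symm⟩

theorem exact_left_zero (hf : Function.Injective f) (z : H A₁ n K 0)
    (hz : S.left.Hmap 0 0 z = 0) : z = 0 := by
  obtain ⟨a, ha, rfl⟩ := cls_surjective z
  rw [ShiftHom.Hmap_cls, cls_eq_zero_iff, mem_coboundaries_zero] at hz
  rw [cls_eq_zero_iff, mem_coboundaries_zero]
  exact S.left_injective_zero hf a hz

section Naturality

variable {A₁' A₂' A₃' : Type*} [CommRing A₁'] [CommRing A₂'] [CommRing A₃']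
    {K' M' N' : Type*} [AddCommGroup K'] [Module (MvPolynomial (Fin n) A₁') K']
    [AddCommGroup M'] [Module (MvPolynomial (Fin n) A₂') M']
    [AddCommGroup N'] [Module (MvPolynomial (Fin n) A₃') N'] {f' : K' →+ M'} {g' : M' →+ N'}
    (S' : WeakSES A₁' A₂' A₃' n f' g') [Nontrivial A₁'] [Nontrivial A₂'] [Nontrivial A₃']

/-- Naturality of the connecting map. -/
theorem delta_natural {α : ShiftHom A₁ A₁' n K K'} {β : ShiftHom A₂ A₂' n M M'}
    {γ : ShiftHom A₃ A₃' n N N'} (μ : ℤ) (h₁ : ∀ d k, β d (f k) = f' (α d k))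
    (h₂ : ∀ d m, γ d (g m) = g' (β d m)) (p : ℕ) (z : H A₃ n N p) :
    S'.delta p (γ.Hmap μ p z) = α.Hmap μ (p + 1) (S.delta p z) := by
  obtain ⟨b, a, hb, ha, h, rfl⟩ := S.exists_conn z
  have e1 : ∀ (q : ℕ) (c : Cochain A₂ n M q), γ.cochainMap μ q (S.right.cochainMap 0 q c) =
      S'.right.cochainMap 0 q (β.cochainMap μ q c) := by
    intro q c
    ext s
    simp only [ShiftHom.cochainMap_apply]
    induction c s using LocalizedModule.induction_on with | _ m u
    simp [h₂]
  have e2 : ∀ (q : ℕ) (c : Cochain A₁ n K q), β.cochainMap μ q (S.left.cochainMap 0 q c) =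
      S'.left.cochainMap 0 q (α.cochainMap μ q c) := by
    intro q c
    ext s
    simp only [ShiftHom.cochainMap_apply]
    induction c s using LocalizedModule.induction_on with | _ m u
    simp [h₁]
  rw [S.delta_cls b a hb ha h, ShiftHom.Hmap_cls, ShiftHom.Hmap_cls,
    cls_congr (e1 p b), S'.delta_cls _ (α.cochainMap μ (p + 1) a) _ _ _]
  rw [← e2, h, ShiftHom.cechD_cochainMap]

end Naturality

/-- If the middle term has no cohomology, the connecting map is bijective. -/
theorem delta_bijective {p : ℕ} (h₀ : ∀ z : H A₂ n M p, z = 0)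
    (h₁ : ∀ z : H A₂ n M (p + 1), z = 0) : Function.Bijective (S.delta p) := by
  constructor
  · rw [injective_iff_map_eq_zero]
    intro z hz
    obtain ⟨w, rfl⟩ := S.exact_right z hz
    rw [h₀ w, map_zero]
  · exact fun z => S.exact_left z (h₁ _)

end WeakSES

/-! ### Every class is killed by a power of each variable -/

section Torsion

variable {A : Type*} [CommRing A] {n : ℕ} {M : Type*} [AddCommGroup M]
  [Module (MvPolynomial (Fin n) A) M] {s t : Finset (Fin n)} {p : ℕ}

theorem varMonoid_insert (A : Type*) [CommRing A] (j : Fin n) (s : Finset (Fin n)) :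
    varMonoid A (insert j s) = Submonoid.closure {(X j : MvPolynomial (Fin n) A)} ⊔
      varMonoid A s := by
  rw [varMonoid, Finset.coe_insert, Set.image_insert_eq, Set.insert_eq, Submonoid.closure_union]

theorem exists_pow_smul_eq_zero_of_res (j : Fin n) (h : s ⊆ insert j s)
    (z : Loc A M s) (hz : res A M h z = 0) :
    ∃ e : ℕ, (X j : MvPolynomial (Fin n) A) ^ e • z = 0 := by
  induction z using LocalizedModule.induction_on with | _ m u
  rw [res_mk, mk_eq_zero_iff] at hz
  obtain ⟨⟨v, hv⟩, hvm⟩ := hz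
  rw [varMonoid_insert, Submonoid.mem_sup] at hv
  obtain ⟨y, hy, w, hw, rfl⟩ := hv
  obtain ⟨e, rfl⟩ := Submonoid.mem_closure_singleton.1 hy
  refine ⟨e, ?_⟩
  rw [LocalizedModule.smul'_mk, mk_eq_zero_iff]
  refine ⟨⟨w, hw⟩, ?_⟩
  rw [Submonoid.smul_def] at hvm ⊢
  rw [smul_smul, mul_comm]
  exact hvm

theorem exists_pow_smul_mem_range_res (j : Fin n) (h : s ⊆ insert j s)
    (z : Loc A M (insert j s)) :
    ∃ (e : ℕ) (w : Loc A M s), (X j : MvPolynomial (Fin n) A) ^ e • z = res A M h w := by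
  induction z using LocalizedModule.induction_on with | _ m u
  obtain ⟨v, hv⟩ := u
  have hv' := hv
  rw [varMonoid_insert, Submonoid.mem_sup] at hv'
  obtain ⟨y, hy, w, hw, rfl⟩ := hv'
  obtain ⟨e, rfl⟩ := Submonoid.mem_closure_singleton.1 hy
  refine ⟨e, LocalizedModule.mk m ⟨w, hw⟩, ?_⟩
  rw [LocalizedModule.smul'_mk, res_mk, LocalizedModule.mk_eq]
  refine ⟨1, ?_⟩
  rw [one_smul, one_smul, Submonoid.smul_def, Submonoid.smul_def, coe_incl, smul_smul, mul_comm]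

theorem exists_uniform_pow {ι : Type*} [Finite ι] {T : ι → Type*} [∀ i, AddCommGroup (T i)]
    [∀ i, Module (MvPolynomial (Fin n) A) (T i)] (g : MvPolynomial (Fin n) A)
    (P : (i : ι) → T i → Prop) (hP : ∀ i z, P i z → P i (g • z)) (z : (i : ι) → T i)
    (h : ∀ i, ∃ e : ℕ, P i (g ^ e • z i)) : ∃ e : ℕ, ∀ i, P i (g ^ e • z i) := by
  cases nonempty_fintype ι
  choose e he using h
  refine ⟨∑ i, e i, fun i => ?_⟩
  have h1 : ∀ d, P i (g ^ (d + e i) • z i) := by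
    intro d
    induction d with
    | zero => rw [zero_add]; exact he i
    | succ d ih => rw [add_right_comm, pow_succ', mul_smul]; exact hP i _ ih
  have h2 := h1 (∑ i, e i - e i)
  rwa [Nat.sub_add_cancel (Finset.single_le_sum (fun _ _ => Nat.zero_le _) (Finset.mem_univ i))]
    at h2

/-- A cocycle vanishing on all sets that contain `j` is `x_j`-torsion. -/
theorem exists_pow_smul_cochain_eq_zero (j : Fin n) (c : Cochain A n M p)
    (hc : cechD A n M p c = 0) (h : ∀ t, j ∈ t.1 → c t = 0) :
    ∃ e : ℕ, (X j : MvPolynomial (Fin n) A) ^ e • c = 0 := by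
  have key : ∀ t, ∃ e : ℕ, (X j : MvPolynomial (Fin n) A) ^ e • c t = 0 := by
    rintro ⟨t, ht⟩
    by_cases hj : j ∈ t
    · exact ⟨0, by rw [h _ hj, smul_zero]⟩
    refine exists_pow_smul_eq_zero_of_res j (Finset.subset_insert j t) _ ?_
    -- In the component of dc at `insert j t`, every deletion other than that of j leaves a set
    -- containing j and so contributes nothing. What remains says that c t restricts to zero once
    -- x_j is inverted.
    have h1 := congrFun hc ⟨insert j t, by rw [Finset.card_insert_of_notMem hj, ht]⟩
    rw [cechD_apply', Finset.sum_eq_single_of_mem j (Finset.mem_insert_self j t)] at h1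
    · rw [resExt_eq _ (Finset.erase_subset _ _) (by
        rw [Finset.erase_insert hj, ht])] at h1
      have h2 : ∀ (s : {s : Finset (Fin n) // s.card = p}) (hs : s.1 ⊆ insert j t)
          (e : s.1 = t), res A M hs (c s) = 0 → res A M (Finset.subset_insert j t) (c ⟨t, ht⟩) = 0 := by
        rintro ⟨s, hs'⟩ hs rfl h
        exact h
      refine h2 ⟨(insert j t).erase j, by rw [Finset.erase_insert hj, ht]⟩ (Finset.erase_subset _ _)
        (Finset.erase_insert hj) ?_
      rcases neg_one_pow_eq_or (MvPolynomial (Fin n) A)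
        ((insert j t).filter (· < j)).card with h3 | h3 <;> rw [h3] at h1
      · simpa using h1
      · simpa using h1
    · intro l hl hlj
      have hl' : l ∈ t := (Finset.mem_insert.1 hl).resolve_left hlj
      rw [resExt_eq _ (Finset.erase_subset _ _) (by
        rw [Finset.card_erase_of_mem hl, Finset.card_insert_of_notMem hj, ht]; rfl), h, map_zero,
        smul_zero]
      exact Finset.mem_erase.2 ⟨fun e => hlj e.symm, Finset.mem_insert_self j t⟩
  obtain ⟨e, he⟩ := exists_uniform_pow (X j) (fun _ z => z = 0)
    (fun _ z hz => by rw [hz, smul_zero]) c key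
  exact ⟨e, funext he⟩

theorem res_self (h : s ⊆ s) (z : Loc A M s) : res A M h z = z := by
  induction z using LocalizedModule.induction_on with | _ m u
  rw [res_mk]
  rfl

/-- This is a contracting homotopy up to denominators. A power of x_j makes every component at
`insert j s` the restriction of an element of M_{x_s}. Taking this element, with a sign, for j ∉ s
and zero for j ∈ s, only the deletion of j survives in db at a set containing j. -/
theorem exists_coboundary (j : Fin n) (c : Cochain A n M (p + 1)) :
    ∃ (e : ℕ) (b : Cochain A n M p), ∀ t, j ∈ t.1 →
      (X j : MvPolynomial (Fin n) A) ^ e • c t = cechD A n M p b t := by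
  obtain ⟨e, he⟩ := exists_uniform_pow (ι := {s : Finset (Fin n) // s.card = p})
    (T := fun s => Loc A M (insert j s.1)) (X j)
    (fun s z => ∃ w, z = res A M (Finset.subset_insert j s.1) w)
    (by rintro s z ⟨w, rfl⟩; exact ⟨X j • w, by rw [map_smul]⟩)
    (fun s => resExt c (insert j s.1) (insert j s.1))
    (fun s => exists_pow_smul_mem_range_res j _ _)
  choose w hw using he
  have hw' : ∀ (s t : Finset (Fin n)) (hs : s.card = p) (ht : t.card = p + 1)
      (_ : insert j s = t) (h : s ⊆ t), res A M h (w ⟨s, hs⟩) =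
        (X j : MvPolynomial (Fin n) A) ^ e • c ⟨t, ht⟩ := by
    rintro s _ hs ht rfl h
    have := hw ⟨s, hs⟩
    rw [resExt_eq c subset_rfl ht, res_self] at this
    exact this.symm
  clear hw
  classical
  refine ⟨e, fun s => if j ∈ s.1 then 0 else
    ((-1 : MvPolynomial (Fin n) A) ^ ((insert j s.1).filter (· < j)).card) • w s, ?_⟩
  rintro ⟨t, ht⟩ hj
  rw [cechD_apply', Finset.sum_eq_single_of_mem j hj]
  · have hcard : (t.erase j).card = p := by rw [Finset.card_erase_of_mem hj, ht]; rfl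
    rw [resExt_eq _ (Finset.erase_subset _ _) hcard, if_neg (Finset.notMem_erase j t), map_smul,
      smul_smul, hw' _ t hcard ht (Finset.insert_erase hj)]
    dsimp only
    rw [Finset.insert_erase hj, ← pow_add, Even.neg_one_pow ⟨_, rfl⟩, one_smul]
  · intro l hl hlj
    rw [resExt_eq _ (Finset.erase_subset _ _) (by rw [Finset.card_erase_of_mem hl, ht]; rfl),
      if_pos (Finset.mem_erase.2 ⟨fun e => hlj e.symm, hj⟩), map_zero, smul_zero]

/-- Local cohomology classes are torsion with respect to each variable. -/
theorem exists_pow_smul_eq_zero (j : Fin n) (z : H A n M p) :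
    ∃ e : ℕ, (X j : MvPolynomial (Fin n) A) ^ e • z = 0 := by
  obtain ⟨c, hc, rfl⟩ := cls_surjective z
  -- It is enough to multiply by a power of x_j and change by a coboundary so that the cocycle
  -- vanishes on all sets containing j. A further power of x_j then kills it as a cochain.
  suffices h : ∃ (e : ℕ) (b : Cochain A n M p) (_ : b ∈ coboundaries A n M p),
      ∀ t, j ∈ t.1 → ((X j : MvPolynomial (Fin n) A) ^ e • c - b) t = 0 by
    obtain ⟨e, b, hb, hv⟩ := h
    obtain ⟨e', he'⟩ := exists_pow_smul_cochain_eq_zero j _ (by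
      rw [map_sub, map_smul, hc, smul_zero, cechD_eq_zero_of_mem hb, sub_zero]) hv
    refine ⟨e' + e, ?_⟩
    rw [cls_smul, cls_eq_zero_iff, pow_add, mul_smul]
    rw [smul_sub, sub_eq_zero] at he'
    rw [he']
    exact Submodule.smul_mem _ _ hb
  cases p with
  | zero =>
    refine ⟨0, 0, zero_mem _, fun t ht => ?_⟩
    obtain ⟨t, h⟩ := t
    rw [Finset.card_eq_zero] at h
    subst h
    exact absurd ht (Finset.notMem_empty j)
  | succ p =>
    obtain ⟨e, b, hb⟩ := exists_coboundary j c
    refine ⟨e, _, mem_coboundaries_succ.2 ⟨b, rfl⟩, fun t ht => ?_⟩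
    rw [Pi.sub_apply, Pi.smul_apply, hb t ht, sub_self]

end Torsion

end GradedLC

namespace GradedLC

open MvPolynomial

/-! ### Cohomology in degree zero as torsion elements -/

section DegreeZero

variable {A : Type*} [CommRing A] {n : ℕ} {M : Type*} [AddCommGroup M]
  [Module (MvPolynomial (Fin n) A) M]

/-- The elements of `M` as Cech cochains of degree zero. -/
noncomputable def zeroCochain (A : Type*) [CommRing A] (n : ℕ) {M : Type*} [AddCommGroup M]
    [Module (MvPolynomial (Fin n) A) M] (m : M) : Cochain A n M 0 :=
  fun _ => LocalizedModule.mk m 1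

theorem zeroCochain_add (m m' : M) :
    zeroCochain A n (m + m') = zeroCochain A n m + zeroCochain A n m' := by
  ext s
  simp [zeroCochain]

theorem eq_one_of_empty (u : varMonoid A (∅ : Finset (Fin n))) : u = 1 := by
  obtain ⟨u, hu⟩ := u
  rw [varMonoid, Finset.coe_empty, Set.image_empty, Submonoid.closure_empty, Submonoid.mem_bot] at hu
  exact Subtype.ext hu

theorem zeroCochain_eq_zero_iff (m : M) : zeroCochain A n m = 0 ↔ m = 0 := by
  constructor
  · intro h
    have h1 := congrFun h ⟨∅, Finset.card_empty⟩
    rw [zeroCochain, Pi.zero_apply, mk_eq_zero_iff] at h1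
    obtain ⟨v, hv⟩ := h1
    rwa [eq_one_of_empty v, one_smul] at hv
  · rintro rfl
    ext s
    rw [zeroCochain, LocalizedModule.zero_mk]
    rfl

theorem exists_zeroCochain_eq (c : Cochain A n M 0) : ∃ m, zeroCochain A n m = c := by
  have key : ∀ z : Loc A M (∅ : Finset (Fin n)), ∃ m, z = LocalizedModule.mk m 1 := by
    intro z
    induction z using LocalizedModule.induction_on with | _ m u
    exact ⟨m, by rw [eq_one_of_empty u]⟩
  obtain ⟨m, hm⟩ := key (c ⟨∅, Finset.card_empty⟩)
  refine ⟨m, ?_⟩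
  ext ⟨s, hs⟩
  have hs' := hs
  rw [Finset.card_eq_zero] at hs'
  subst hs'
  exact hm.symm

theorem cechD_zeroCochain_iff (m : M) : cechD A n M 0 (zeroCochain A n m) = 0 ↔
    ∀ j : Fin n, ∃ e : ℕ, (X j : MvPolynomial (Fin n) A) ^ e • m = 0 := by
  have key : ∀ (j : Fin n) (h : ({j} : Finset (Fin n)).card = 0 + 1),
      cechD A n M 0 (zeroCochain A n m) ⟨{j}, h⟩ = LocalizedModule.mk m 1 := by
    intro j h
    rw [cechD_apply', Finset.sum_singleton, resExt_eq _ (Finset.erase_subset _ _) (by simp),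
      zeroCochain, res_mk]
    have : (Finset.filter (· < j) ({j} : Finset (Fin n))).card = 0 := by simp
    rw [this, pow_zero, one_smul]
    rfl
  constructor
  · intro h j
    have h1 := (key j (by simp)).symm.trans (congrFun h _)
    rw [Pi.zero_apply, mk_eq_zero_iff] at h1
    obtain ⟨⟨v, hv⟩, hvm⟩ := h1
    rw [varMonoid, Finset.coe_singleton, Set.image_singleton] at hv
    obtain ⟨e, rfl⟩ := Submonoid.mem_closure_singleton.1 hv
    exact ⟨e, hvm⟩
  · intro h
    ext ⟨t, ht⟩
    obtain ⟨j, rfl⟩ := Finset.card_eq_one.1 ht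
    rw [key, Pi.zero_apply, mk_eq_zero_iff]
    obtain ⟨e, he⟩ := h j
    exact ⟨⟨X j, X_mem_varMonoid A (Finset.mem_singleton_self j)⟩ ^ e, he⟩

end DegreeZero

/-! ### Cohomology with respect to arbitrary elements of a ring -/

section Twist

variable {B : Type*} [CommRing B] {n : ℕ}

/-- A `B`-module, seen as a module over `ℤ[x_0, …, x_{n-1}]` through elements `y_j` of `B`. -/
@[nolint unusedArguments]
def Tw {B : Type*} [CommRing B] {n : ℕ} (_y : Fin n → B) (M : Type*) : Type _ := M

variable (x y : Fin n → B) (M N : Type*) [AddCommGroup M] [Module B M] [AddCommGroup N] [Module B N]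

noncomputable instance : AddCommGroup (Tw y M) := inferInstanceAs (AddCommGroup M)

noncomputable instance : Module (MvPolynomial (Fin n) ℤ) (Tw y M) :=
  Module.compHom M (aeval y : MvPolynomial (Fin n) ℤ →ₐ[ℤ] B).toRingHom

/-- The identity of `M`. -/
def toTw {B : Type*} [CommRing B] {n : ℕ} (y : Fin n → B) (M : Type*) [AddCommGroup M] :
    M ≃+ Tw y M := AddEquiv.refl M

variable {M N}

theorem smul_toTw (g : MvPolynomial (Fin n) ℤ) (m : M) :
    g • toTw y M m = toTw y M (aeval y g • m) := rfl

theorem X_smul_toTw (j : Fin n) (m : M) :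
    (X j : MvPolynomial (Fin n) ℤ) • toTw y M m = toTw y M (y j • m) := by
  rw [smul_toTw, aeval_X]

theorem X_smul_Tw (j : Fin n) (m : Tw y M) :
    (X j : MvPolynomial (Fin n) ℤ) • m = toTw y M (y j • (toTw y M).symm m) :=
  X_smul_toTw y j ((toTw y M).symm m)

/-- A family of maps on `M` compatible with both `x` and `y`. -/
structure BiShift (x y : Fin n → B) (M N : Type*) [AddCommGroup M] [Module B M]
    [AddCommGroup N] [Module B N] where
  /-- The underlying family of additive maps. -/
  toFun : ℤ → M →+ N
  map_left : ∀ μ j m, toFun (μ + 1) (x j • m) = x j • toFun μ m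
  map_right : ∀ μ j m, toFun (μ + 1) (y j • m) = y j • toFun μ m

/-- The first family underlying a `BiShift`. -/
noncomputable def BiShift.fst {x y : Fin n → B} (φ : BiShift x y M N) :
    ShiftHom ℤ ℤ n (Tw x M) (Tw x N) where
  toFun μ := (toTw x N).toAddMonoidHom.comp ((φ.toFun μ).comp (toTw x M).symm.toAddMonoidHom)
  map_X_smul μ j m := (congrArg (φ.toFun (μ + 1)) (X_smul_Tw x j m)).trans
    ((φ.map_left μ j _).trans (X_smul_Tw x j _).symm)

/-- The second family underlying a `BiShift`. -/
noncomputable def BiShift.snd {x y : Fin n → B} (φ : BiShift x y M N) :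
    ShiftHom ℤ ℤ n (Tw y M) (Tw y N) where
  toFun μ := (toTw y N).toAddMonoidHom.comp ((φ.toFun μ).comp (toTw y M).symm.toAddMonoidHom)
  map_X_smul μ j m := (congrArg (φ.toFun (μ + 1)) (X_smul_Tw y j m)).trans
    ((φ.map_right μ j _).trans (X_smul_Tw y j _).symm)

/-- A `B`-linear map as a family. -/
noncomputable def twLin (f : M →ₗ[B] N) : ShiftHom ℤ ℤ n (Tw y M) (Tw y N) :=
  ShiftHom.const ((toTw y N).toAddMonoidHom.comp (f.toAddMonoidHom.comp
    (toTw y M).symm.toAddMonoidHom)) fun j m => (congrArg f (X_smul_Tw y j m)).trans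
    ((f.map_smul (y j) _).trans (X_smul_Tw y j _).symm)

theorem twLin_apply' (f : M →ₗ[B] N) (μ : ℤ) (m : Tw y M) :
    twLin y f μ m = toTw y N (f ((toTw y M).symm m)) := rfl

variable (M)

/-- Multiplication by an element of `B`. -/
noncomputable def mulTw (b : B) : ShiftHom ℤ ℤ n (Tw y M) (Tw y M) :=
  twLin y (b • (LinearMap.id : M →ₗ[B] M))

variable {M}

theorem mulTw_apply (b : B) (μ : ℤ) (m : M) :
    mulTw y M b μ (toTw y M m) = toTw y M (b • m) := rfl

theorem mulTw_apply' (b : B) (μ : ℤ) (m : Tw y M) :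
    mulTw y M b μ m = toTw y M (b • (toTw y M).symm m) := rfl

/-- Multiplication by an element of `B`. -/
noncomputable def mulBi (x y : Fin n → B) (M : Type*) [AddCommGroup M] [Module B M] (b : B) :
    BiShift x y M M where
  toFun _ := (b • (LinearMap.id : M →ₗ[B] M)).toAddMonoidHom
  map_left _ j m := smul_comm b (x j) m
  map_right _ j m := smul_comm b (y j) m

theorem mulBi_fst (b : B) : (mulBi x y M b).fst = mulTw x M b := rfl

theorem mulBi_snd (b : B) : (mulBi x y M b).snd = mulTw y M b := rfl

/-- The elements of `B` annihilating a class in the local cohomology with respect to `y`. -/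
noncomputable def annIdeal {p : ℕ} (z : H ℤ n (Tw y M) p) : Ideal B where
  carrier := {b | (mulTw y M b).Hmap 0 p z = 0}
  zero_mem' := ShiftHom.Hmap_zero (fun _ m => by rw [mulTw_apply', zero_smul, map_zero]) p z
  add_mem' {a b} ha hb := by
    have e : (mulTw y M (a + b)).Hmap 0 p = ((mulTw y M a).add (mulTw y M b)).Hmap 0 p :=
      ShiftHom.Hmap_congr (fun d => AddMonoidHom.ext fun m => add_smul a b ((toTw y M).symm m)) p
    rw [Set.mem_ofPred_eq] at ha hb ⊢
    rw [e, ShiftHom.Hmap_add, ha, hb, add_zero]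
  smul_mem' a b hb := by
    have e : (mulTw y M (a • b)).Hmap 0 p = ((mulTw y M a).comp (mulTw y M b)).Hmap 0 p :=
      ShiftHom.Hmap_congr (fun d => AddMonoidHom.ext fun m => mul_smul a b ((toTw y M).symm m)) p
    rw [Set.mem_ofPred_eq] at hb ⊢
    rw [e, ShiftHom.Hmap_comp, hb, map_zero]

theorem mem_annIdeal {p : ℕ} (z : H ℤ n (Tw y M) p) (b : B) :
    b ∈ annIdeal y z ↔ (mulTw y M b).Hmap 0 p z = 0 := Iff.rfl

theorem Hmap_mulTw_aeval {p : ℕ} (g : MvPolynomial (Fin n) ℤ) (z : H ℤ n (Tw y M) p) :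
    (mulTw y M (aeval y g)).Hmap 0 p z = g • z := by
  rw [← ShiftHom.Hmap_ofLinear_smul g 0 p z]
  exact DFunLike.congr_fun (ShiftHom.Hmap_congr (fun d => rfl) p) z

variable {x y}

theorem exists_pow_mem_of_span {J : Ideal B} (hJ : ∀ j, ∃ e : ℕ, y j ^ e ∈ J) {b : B}
    (hb : b ∈ Ideal.span (Set.range y)) : ∃ e : ℕ, b ^ e ∈ J := by
  have : Ideal.span (Set.range y) ≤ J.radical := by
    rw [Ideal.span_le]
    rintro _ ⟨j, rfl⟩
    exact hJ j
  exact this hb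

/-- The annihilator of the class contains a power of every `y j`, so its radical contains the ideal
they generate. -/
theorem exists_pow_mem_annIdeal {p : ℕ} (z : H ℤ n (Tw y M) p) {b : B}
    (hb : b ∈ Ideal.span (Set.range y)) : ∃ e : ℕ, b ^ e ∈ annIdeal y z := by
  refine exists_pow_mem_of_span (fun j => ?_) hb
  obtain ⟨e, he⟩ := exists_pow_smul_eq_zero j z
  refine ⟨e, ?_⟩
  rw [mem_annIdeal]
  have := Hmap_mulTw_aeval y ((X j : MvPolynomial (Fin n) ℤ) ^ e) z
  rwa [map_pow, aeval_X, he] at this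

/-- If an element of the ideal generated by `y` acts bijectively on `M`, then the local cohomology
of `M` with respect to `y` is zero. -/
theorem eq_zero_of_bijective {b : B} (hb : b ∈ Ideal.span (Set.range y))
    (h : Function.Bijective fun m : M => b • m) {p : ℕ} (z : H ℤ n (Tw y M) p) : z = 0 := by
  have hinj : ∀ w : H ℤ n (Tw y M) p, (mulTw y M b).Hmap 0 p w = 0 → w = 0 := by
    intro w hw
    let E : M ≃ₗ[B] M := LinearEquiv.ofBijective (b • LinearMap.id) h
    rw [← ShiftHom.Hmap_id (φ := (twLin y E.symm.toLinearMap).comp (mulTw y M b)) (μ := 0)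
      (fun _ m => E.symm_apply_apply m) p w, ShiftHom.Hmap_comp, hw, map_zero]
  obtain ⟨e, he⟩ := exists_pow_mem_annIdeal z hb
  -- Since b acts injectively on cohomology, killing by b^(e+1) implies killing by b^e; the case e =
  -- 0 is z = 0.
  induction e with
  | zero =>
    rw [pow_zero, mem_annIdeal] at he
    rwa [ShiftHom.Hmap_id (fun _ m => by rw [mulTw_apply', one_smul, AddEquiv.apply_symm_apply])] at he
  | succ e ih =>
    refine ih ?_
    rw [mem_annIdeal] at he ⊢
    apply hinj
    rw [← ShiftHom.Hmap_comp, ← he]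
    refine DFunLike.congr_fun (ShiftHom.Hmap_congr (fun d => AddMonoidHom.ext fun m => ?_) p) z
    exact (smul_smul b (b ^ e) ((toTw y M).symm m)).trans (by rw [← pow_succ']; rfl)

/-- Cohomology is additive in the maps, and the identity of a finite product is the sum of the
composites projection-then-inclusion, each of which factors through a factor without cohomology. -/
theorem eq_zero_of_pi {ι : Type*} [Finite ι] {T : ι → Type*} [∀ i, AddCommGroup (T i)]
    [∀ i, Module B (T i)] {p : ℕ} (h : ∀ i, ∀ z : H ℤ n (Tw y (T i)) p, z = 0)
    (z : H ℤ n (Tw y ((i : ι) → T i)) p) : z = 0 := by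
  classical
  cases nonempty_fintype ι
  have key : ∀ s : Finset ι, (twLin y (∑ i ∈ s, (LinearMap.single B T i) ∘ₗ
      (LinearMap.proj i : ((i : ι) → T i) →ₗ[B] T i))).Hmap 0 p z = 0 := by
    intro s
    induction s using Finset.induction_on with
    | empty =>
      exact ShiftHom.Hmap_zero (fun _ m => by rw [twLin_apply', Finset.sum_empty]; rfl) p z
    | insert i s hi ih =>
      have e : (twLin y (∑ i ∈ insert i s, (LinearMap.single B T i) ∘ₗ
          (LinearMap.proj i : ((i : ι) → T i) →ₗ[B] T i))).Hmap 0 p =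
          (((twLin y (LinearMap.single B T i)).comp (twLin y (LinearMap.proj i))).add
          (twLin y (∑ i ∈ s, (LinearMap.single B T i) ∘ₗ
          (LinearMap.proj i : ((i : ι) → T i) →ₗ[B] T i)))).Hmap 0 p :=
        ShiftHom.Hmap_congr (fun d => AddMonoidHom.ext fun m => by
          rw [twLin_apply', Finset.sum_insert hi]; rfl) p
      rw [e, ShiftHom.Hmap_add, ih, ShiftHom.Hmap_comp, h i (ShiftHom.Hmap _ 0 p z), map_zero,
        add_zero]
  rw [← key Finset.univ]
  refine (ShiftHom.Hmap_id (fun _ m => ?_) p z).symm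
  rw [twLin_apply', ← AddEquiv.eq_symm_apply]
  ext i
  rw [LinearMap.sum_apply, Finset.sum_apply]
  simp only [LinearMap.comp_apply, LinearMap.proj_apply, LinearMap.single_apply,
    Finset.sum_pi_single, Finset.mem_univ, if_true]

end Twist

/-! ### Effacing cohomology by the embedding into the localizations -/

section Efface

variable {B : Type*} [CommRing B] {n : ℕ}

/-- The localization of `M` at `x_j`, as a `B`-module. -/
def Eff (x : Fin n → B) (j : Fin n) (M : Type*) [AddCommGroup M] [Module B M] : Type _ :=
  Loc ℤ (Tw x M) {j}

variable (x y : Fin n → B) (j : Fin n) (M : Type*) [AddCommGroup M] [Module B M]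

noncomputable instance : AddCommGroup (Eff x j M) := inferInstanceAs (AddCommGroup (Loc ℤ _ _))

/-- The fraction `m / u`. -/
noncomputable def Eff.mk {x : Fin n → B} {j : Fin n} {M : Type*} [AddCommGroup M] [Module B M]
    (m : M) (u : varMonoid ℤ ({j} : Finset (Fin n))) : Eff x j M :=
  (LocalizedModule.mk (toTw x M m) u : Loc ℤ (Tw x M) {j})

variable {x j M}

theorem Eff.ind {P : Eff x j M → Prop} (h : ∀ m u, P (Eff.mk m u)) (z : Eff x j M) : P z :=
  LocalizedModule.induction_on (β := P) h z

noncomputable instance : SMul B (Eff x j M) := ⟨fun b z => (mulTw x M b).locMap 0 {j} z⟩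

theorem Eff.smul_mk (b : B) (m : M) (u : varMonoid ℤ ({j} : Finset (Fin n))) :
    b • (Eff.mk m u : Eff x j M) = Eff.mk (b • m) u := by
  refine (ShiftHom.locMap_mk _ _ _ _).trans ?_
  rw [tr_self]
  rfl

theorem Eff.mk_add (m m' : M) (u : varMonoid ℤ ({j} : Finset (Fin n))) :
    (Eff.mk (m + m') u : Eff x j M) = Eff.mk m u + Eff.mk m' u := by
  refine Eq.trans ?_ (LocalizedModule.mk_add_mk (S := varMonoid ℤ ({j} : Finset (Fin n)))
    (M := Tw x M)).symm
  rw [← smul_add, LocalizedModule.mk_cancel_common_left]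
  rfl

noncomputable instance : Module B (Eff x j M) where
  one_smul z := by
    induction z using Eff.ind with | _ m u
    rw [Eff.smul_mk, one_smul]
  mul_smul a b z := by
    induction z using Eff.ind with | _ m u
    rw [Eff.smul_mk, Eff.smul_mk, Eff.smul_mk, mul_smul]
  smul_zero b := map_zero ((mulTw x M b).locMap 0 {j})
  smul_add b z w := map_add ((mulTw x M b).locMap 0 {j}) z w
  add_smul a b z := by
    induction z using Eff.ind with | _ m u
    rw [Eff.smul_mk, Eff.smul_mk, Eff.smul_mk, add_smul, Eff.mk_add]
  zero_smul z := by
    induction z using Eff.ind with | _ m u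
    rw [Eff.smul_mk, zero_smul]
    exact LocalizedModule.zero_mk _

theorem Eff.mk_eq_zero_iff (m : M) (u : varMonoid ℤ ({j} : Finset (Fin n))) :
    (Eff.mk m u : Eff x j M) = 0 ↔ ∃ e : ℕ, x j ^ e • m = 0 := by
  refine (GradedLC.mk_eq_zero_iff (toTw x M m) u).trans ⟨?_, ?_⟩
  · rintro ⟨⟨v, hv⟩, h⟩
    rw [varMonoid, Finset.coe_singleton, Set.image_singleton] at hv
    obtain ⟨e, rfl⟩ := Submonoid.mem_closure_singleton.1 hv
    refine ⟨e, ?_⟩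
    have : toTw x M (aeval x ((X j : MvPolynomial (Fin n) ℤ) ^ e) • m) = 0 := h
    rwa [map_pow, aeval_X] at this
  · rintro ⟨e, he⟩
    refine ⟨⟨X j, X_mem_varMonoid ℤ (Finset.mem_singleton_self j)⟩ ^ e, ?_⟩
    have : toTw x M (aeval x ((X j : MvPolynomial (Fin n) ℤ) ^ e) • m) = 0 := by
      rw [map_pow, aeval_X]
      exact he
    exact this

theorem Eff.bijective : Function.Bijective fun z : Eff x j M => x j • z := by
  constructor
  · intro z w h
    rw [← sub_eq_zero] at h ⊢
    dsimp only at h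
    rw [← smul_sub] at h
    revert h
    generalize z - w = v
    induction v using Eff.ind with | _ m u
    intro h
    rw [Eff.smul_mk, Eff.mk_eq_zero_iff] at h
    obtain ⟨e, he⟩ := h
    exact (Eff.mk_eq_zero_iff _ _).2 ⟨e + 1, by rwa [pow_succ, mul_smul]⟩
  · intro z
    induction z using Eff.ind with | _ m u
    let v : varMonoid ℤ ({j} : Finset (Fin n)) := ⟨X j, X_mem_varMonoid ℤ (Finset.mem_singleton_self j)⟩
    refine ⟨Eff.mk m (v * u), ?_⟩
    dsimp only
    rw [Eff.smul_mk]
    have h1 : toTw x M (x j • m) = v • toTw x M m := (X_smul_toTw x j m).symm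
    exact (congrArg (fun w => (LocalizedModule.mk w (v * u) : Loc ℤ (Tw x M) {j})) h1).trans
      (LocalizedModule.mk_cancel_common_left v u _)

variable (x M)

/-- The map `M → ⨁_j M_{x_j}`. -/
noncomputable def toEff : M →ₗ[B] ((j : Fin n) → Eff x j M) where
  toFun m _ := Eff.mk m 1
  map_add' m m' := funext fun _ => Eff.mk_add m m' 1
  map_smul' b m := funext fun _ => (Eff.smul_mk b m 1).symm

/-- The cokernel of `M → ⨁_j M_{x_j}`. -/
abbrev Coeff : Type _ := ((j : Fin n) → Eff x j M) ⧸ LinearMap.range (toEff x M)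

variable {x M} {y}

/-- An element dying in every M_{x_j} is killed by a power of each `x j`, hence by a power of
anything in the ideal they generate, in particular of each `y l`. The first map need not be
injective, which is why exactness on the left is only asked up to torsion. -/
theorem weakSES_toEff (hy : ∀ j, y j ∈ Ideal.span (Set.range x)) : WeakSES ℤ ℤ ℤ n
    ((toTw y ((j : Fin n) → Eff x j M)).toAddMonoidHom.comp
      ((toEff x M).toAddMonoidHom.comp (toTw y M).symm.toAddMonoidHom))
    ((toTw y (Coeff x M)).toAddMonoidHom.comp
      ((LinearMap.range (toEff x M)).mkQ.toAddMonoidHom.comp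
        (toTw y ((j : Fin n) → Eff x j M)).symm.toAddMonoidHom)) where
  map_X_left := (twLin y (toEff x M)).map_X_smul 0
  map_X_right := (twLin y (LinearMap.range (toEff x M)).mkQ).map_X_smul 0
  torsion m hm l := by
    have h1 : ∀ j, ∃ e : ℕ, x j ^ e ∈ Ideal.torsionOf B M ((toTw y M).symm m) := by
      intro j
      obtain ⟨e, he⟩ := (Eff.mk_eq_zero_iff (x := x) (j := j) ((toTw y M).symm m) 1).1
        (congrFun hm j)
      exact ⟨e, (Ideal.mem_torsionOf_iff _ _).2 he⟩
    obtain ⟨e, he⟩ := exists_pow_mem_of_span h1 (hy l)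
    refine ⟨e, ?_⟩
    have h2 := (Ideal.mem_torsionOf_iff _ _).1 he
    have h3 : (aeval y ((X l : MvPolynomial (Fin n) ℤ) ^ e)) • ((toTw y M).symm m) = 0 := by
      rwa [map_pow, aeval_X]
    exact h3
  comp_zero m := (Submodule.Quotient.mk_eq_zero (LinearMap.range (toEff x M))).2
    (LinearMap.mem_range_self (toEff x M) ((toTw y M).symm m))
  exact m hm := by
    have h : (toTw y ((j : Fin n) → Eff x j M)).symm m ∈ LinearMap.range (toEff x M) :=
      (Submodule.Quotient.mk_eq_zero _).1 hm
    obtain ⟨k, hk⟩ := h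
    exact ⟨toTw y M k, hk⟩
  surj := (LinearMap.range (toEff x M)).mkQ_surjective

/-- The extension of a family of maps to `M_{x_j}`. -/
noncomputable def BiShift.effOne (φ : BiShift x y M M) (μ : ℤ) (j : Fin n) :
    Eff x j M →+ Eff x j M :=
  φ.fst.locMap μ {j}

theorem BiShift.effOne_mk (φ : BiShift x y M M) (μ : ℤ) (m : M)
    (u : varMonoid ℤ ({j} : Finset (Fin n))) :
    φ.effOne μ j (Eff.mk m u) = Eff.mk (φ.toFun (μ + mdeg u) m) u := by
  refine (ShiftHom.locMap_mk _ _ _ _).trans ?_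
  rw [tr_self]
  rfl

theorem BiShift.effOne_smul (φ : BiShift x y M M) (b : B)
    (h : ∀ μ m, φ.toFun (μ + 1) (b • m) = b • φ.toFun μ m) (μ : ℤ) (z : Eff x j M) :
    φ.effOne (μ + 1) j (b • z) = b • φ.effOne μ j z := by
  induction z using Eff.ind with | _ m u
  rw [Eff.smul_mk, effOne_mk, effOne_mk, Eff.smul_mk, add_right_comm, h]

/-- The extension of a map to `⨁_j M_{x_j}`. -/
noncomputable def BiShift.effHom (φ : BiShift x y M M) (μ : ℤ) :
    ((j : Fin n) → Eff x j M) →+ ((j : Fin n) → Eff x j M) where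
  toFun z j := φ.effOne μ j (z j)
  map_zero' := funext fun _ => map_zero _
  map_add' _ _ := funext fun _ => map_add _ _ _

theorem BiShift.effHom_apply (φ : BiShift x y M M) (μ : ℤ) (z : (j : Fin n) → Eff x j M)
    (j : Fin n) : φ.effHom μ z j = φ.effOne μ j (z j) := rfl

/-- The extension of a family of maps to `⨁_j M_{x_j}`. -/
noncomputable def BiShift.eff (φ : BiShift x y M M) :
    BiShift x y ((j : Fin n) → Eff x j M) ((j : Fin n) → Eff x j M) where
  toFun := φ.effHom
  map_left μ l z := by
    ext j
    rw [Pi.smul_apply, effHom_apply, effHom_apply, Pi.smul_apply]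
    exact φ.effOne_smul (x l) (fun μ m => φ.map_left μ l m) μ (z j)
  map_right μ l z := by
    ext j
    rw [Pi.smul_apply, effHom_apply, effHom_apply, Pi.smul_apply]
    exact φ.effOne_smul (y l) (fun μ m => φ.map_right μ l m) μ (z j)

theorem BiShift.eff_toEff (φ : BiShift x y M M) (μ : ℤ) (m : M) :
    φ.eff.toFun μ (toEff x M m) = toEff x M (φ.toFun μ m) := by
  ext j
  exact (φ.effOne_mk μ m 1).trans (by rw [mdeg_one, add_zero]; rfl)

/-- The family of maps induced on the cokernel of `M → ⨁_j M_{x_j}`. -/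
noncomputable def BiShift.coeff (φ : BiShift x y M M) : BiShift x y (Coeff x M) (Coeff x M) where
  toFun μ := QuotientAddGroup.map (LinearMap.range (toEff x M)).toAddSubgroup
    (LinearMap.range (toEff x M)).toAddSubgroup (φ.eff.toFun μ) (by
      rintro _ ⟨m, rfl⟩
      exact ⟨_, (φ.eff_toEff μ m).symm⟩)
  map_left μ j z := by
    induction z using Submodule.Quotient.induction_on with | _ z
    exact congrArg (Submodule.Quotient.mk (p := LinearMap.range (toEff x M)))
      (φ.eff.map_left μ j z)
  map_right μ j z := by
    induction z using Submodule.Quotient.induction_on with | _ z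
    exact congrArg (Submodule.Quotient.mk (p := LinearMap.range (toEff x M)))
      (φ.eff.map_right μ j z)

/-- On M_{x_j} the element `x j` of the ideal generated by y acts bijectively, while a power of it
kills any given class. -/
theorem eq_zero_of_eff (hx : ∀ j, x j ∈ Ideal.span (Set.range y)) {p : ℕ}
    (z : H ℤ n (Tw y ((j : Fin n) → Eff x j M)) p) : z = 0 :=
  eq_zero_of_pi (fun j => eq_zero_of_bijective (hx j) Eff.bijective) z

end Efface

/-! ### Independence of the generators of the ideal -/

section Invariance

variable {B : Type*} [CommRing B] {n : ℕ} {x y : Fin n → B}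

/-- In degree zero the cohomology consists of the elements killed by powers of all generators, and
this set depends only on the ideal. -/
theorem exists_equiv_zero (hx : ∀ j, x j ∈ Ideal.span (Set.range y))
    (hy : ∀ j, y j ∈ Ideal.span (Set.range x)) (M : Type*) [AddCommGroup M] [Module B M] :
    ∃ e : H ℤ n (Tw x M) 0 ≃+ H ℤ n (Tw y M) 0,
      ∀ (φ : BiShift x y M M) (μ : ℤ) (z), e (φ.fst.Hmap μ 0 z) = φ.snd.Hmap μ 0 (e z) := by
  have tors : ∀ {x y : Fin n → B} (_ : ∀ j, y j ∈ Ideal.span (Set.range x)) (m : M),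
      cechD ℤ n (Tw x M) 0 (zeroCochain ℤ n (toTw x M m)) = 0 →
      cechD ℤ n (Tw y M) 0 (zeroCochain ℤ n (toTw y M m)) = 0 := by
    intro x y hy m hm
    rw [cechD_zeroCochain_iff] at hm ⊢
    intro j
    obtain ⟨e, he⟩ := exists_pow_mem_of_span (J := Ideal.torsionOf B M m) (fun j => by
      obtain ⟨e, he⟩ := hm j
      rw [smul_toTw, map_pow, aeval_X, EmbeddingLike.map_eq_zero_iff] at he
      exact ⟨e, (Ideal.mem_torsionOf_iff _ _).2 he⟩) (hy j)
    refine ⟨e, ?_⟩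
    rw [smul_toTw, map_pow, aeval_X, (Ideal.mem_torsionOf_iff _ _).1 he, map_zero]
  have rep : ∀ {x : Fin n → B} (z : H ℤ n (Tw x M) 0),
      ∃ (m : M) (hm : cechD ℤ n (Tw x M) 0 (zeroCochain ℤ n (toTw x M m)) = 0), z = cls _ hm := by
    intro x z
    obtain ⟨c, hc, rfl⟩ := cls_surjective z
    obtain ⟨m, rfl⟩ := exists_zeroCochain_eq c
    exact ⟨(toTw x M).symm m, hc, rfl⟩
  have uniq : ∀ {x : Fin n → B} {m m' : M} (hm) (hm'), cls (zeroCochain ℤ n (toTw x M m)) hm =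
      cls (zeroCochain ℤ n (toTw x M m')) hm' → m = m' := by
    intro x m m' hm hm' h
    rw [cls_eq_iff, mem_coboundaries_zero, sub_eq_zero] at h
    rw [← sub_eq_zero, ← EmbeddingLike.map_eq_zero_iff (f := toTw x M),
      ← zeroCochain_eq_zero_iff (A := ℤ) (n := n), sub_eq_add_neg, map_add, zeroCochain_add, h,
      ← zeroCochain_add, ← map_add, add_neg_cancel, map_zero, zeroCochain_eq_zero_iff]
  choose m hm em using fun z => rep (x := x) z
  have hadd : ∀ z w, m (z + w) = m z + m w := by
    intro z w
    refine uniq (hm _) (by rw [map_add, zeroCochain_add, map_add, hm, hm, add_zero]) ?_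
    rw [← em, cls_congr ((congrArg _ (map_add _ _ _)).trans (zeroCochain_add _ _)),
      cls_add _ _ (hm z) (hm w), ← em, ← em]
  let F : H ℤ n (Tw x M) 0 →+ H ℤ n (Tw y M) 0 := AddMonoidHom.mk'
    (fun z => cls _ (tors hy (m z) (hm z))) fun z w => by
      rw [← cls_add]
      exact cls_congr (by rw [hadd, map_add, zeroCochain_add]) _
  have hF : ∀ m₀ (h : cechD ℤ n (Tw x M) 0 (zeroCochain ℤ n (toTw x M m₀)) = 0),
      F (cls _ h) = cls _ (tors hy m₀ h) := by
    intro m₀ h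
    exact cls_congr (by rw [uniq (hm (cls _ h)) h (em _).symm]) _
  refine ⟨AddEquiv.ofBijective F ⟨?_, ?_⟩, fun φ μ z => ?_⟩
  · intro z w h
    have := uniq (tors hy _ (hm z)) (tors hy _ (hm w)) h
    rw [em z, em w]
    exact cls_congr (by rw [this]) _
  · intro z
    obtain ⟨m₀, h, rfl⟩ := rep z
    exact ⟨cls _ (tors hx m₀ h), hF _ _⟩
  · obtain ⟨m₀, h, rfl⟩ := rep z
    have e1 : φ.fst.cochainMap μ 0 (zeroCochain ℤ n (toTw x M m₀)) =
        zeroCochain ℤ n (toTw x M (φ.toFun μ m₀)) := by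
      ext s
      rw [ShiftHom.cochainMap_apply, zeroCochain, ShiftHom.locMap_mk, mdeg_one, tr_one, add_zero]
      rfl
    have e2 : φ.snd.cochainMap μ 0 (zeroCochain ℤ n (toTw y M m₀)) =
        zeroCochain ℤ n (toTw y M (φ.toFun μ m₀)) := by
      ext s
      rw [ShiftHom.cochainMap_apply, zeroCochain, ShiftHom.locMap_mk, mdeg_one, tr_one, add_zero]
      rfl
    change F _ = φ.snd.Hmap μ 0 (F _)
    rw [hF, ShiftHom.Hmap_cls,
      ShiftHom.Hmap_cls, cls_congr e1, hF, cls_congr e2]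

/-- Local cohomology only depends on the ideal generated by the elements, up to radical; the
isomorphism is compatible with all endomorphisms. -/
theorem exists_equiv (hx : ∀ j, x j ∈ Ideal.span (Set.range y))
    (hy : ∀ j, y j ∈ Ideal.span (Set.range x)) (p : ℕ) :
    ∀ (M : Type*) [AddCommGroup M] [Module B M], ∃ e : H ℤ n (Tw x M) p ≃+ H ℤ n (Tw y M) p,
      ∀ (φ : BiShift x y M M) (μ : ℤ) (z), e (φ.fst.Hmap μ p z) = φ.snd.Hmap μ p (e z) := by
  induction p with
  | zero => exact fun M _ _ => exists_equiv_zero hx hy M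
  | succ p ih =>
    intro M _ _
    have hxx : ∀ j, x j ∈ Ideal.span (Set.range x) := fun j => Ideal.subset_span ⟨j, rfl⟩
    let Sx := weakSES_toEff (M := M) hxx
    let Sy := weakSES_toEff (M := M) hy
    -- Dimension shifting: the middle term has no cohomology with respect to x nor with respect to
    -- y, so both cohomologies of M in degree p + 1 are those of the same cokernel `Coeff x M` in
    -- degree p.
    let dx := AddEquiv.ofBijective (Sx.delta p) (Sx.delta_bijective
      (fun z => eq_zero_of_eff hxx z) (fun z => eq_zero_of_eff hxx z))
    let dy := AddEquiv.ofBijective (Sy.delta p) (Sy.delta_bijective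
      (fun z => eq_zero_of_eff hx z) (fun z => eq_zero_of_eff hx z))
    obtain ⟨e, he⟩ := ih (Coeff x M)
    refine ⟨(dx.symm.trans e).trans dy, fun φ μ z => ?_⟩
    obtain ⟨w, rfl⟩ := dx.surjective z
    have h1 : φ.fst.Hmap μ (p + 1) (dx w) = dx (φ.coeff.fst.Hmap μ p w) :=
      (Sx.delta_natural Sx (α := φ.fst) (β := φ.eff.fst) (γ := φ.coeff.fst) μ
        (fun d k => φ.eff_toEff d ((toTw x M).symm k)) (fun d m => rfl) p w).symm
    have h2 : ∀ w, φ.snd.Hmap μ (p + 1) (dy w) = dy (φ.coeff.snd.Hmap μ p w) := fun w =>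
      (Sy.delta_natural Sy (α := φ.snd) (β := φ.eff.snd) (γ := φ.coeff.snd) μ
        (fun d k => φ.eff_toEff d ((toTw y M).symm k)) (fun d m => rfl) p w).symm
    rw [h1]
    simp only [AddEquiv.trans_apply, AddEquiv.symm_apply_apply]
    rw [he, h2]

end Invariance

end GradedLC

namespace GradedLC

open MvPolynomial

/-! ### Linearity over the coefficients, and gradings given by projections -/

section LinearStructure

variable {A : Type*} [CommRing A] [Nontrivial A] {n : ℕ}
  {M N : Type*} [AddCommGroup M] [Module (MvPolynomial (Fin n) A) M] [Module A M]
  [IsScalarTower A (MvPolynomial (Fin n) A) M]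
  [AddCommGroup N] [Module (MvPolynomial (Fin n) A) N] [Module A N]
  [IsScalarTower A (MvPolynomial (Fin n) A) N]

theorem C_smul_H {p : ℕ} (a : A) (z : H A n M p) :
    (C a : MvPolynomial (Fin n) A) • z = a • z := by
  rw [← algebraMap_eq, algebraMap_smul]

theorem C_smul' (a : A) (m : M) : (C a : MvPolynomial (Fin n) A) • m = a • m := by
  rw [← algebraMap_eq, algebraMap_smul]

namespace ShiftHom

variable (φ : ShiftHom A A n M N) (hφ : ∀ μ (a : A) m, φ μ (a • m) = a • φ μ m)

include hφ in
theorem Hmap_smul (μ : ℤ) {p : ℕ} (a : A) (z : H A n M p) :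
    φ.Hmap μ p (a • z) = a • φ.Hmap μ p z := by
  rw [← C_smul_H, ← C_smul_H, ← Hmap_ofLinear_smul _ 0, ← Hmap_ofLinear_smul _ 0]
  refine Hmap_comm (fun d m => ?_) p z
  rw [ofLinear_apply, ofLinear_apply]
  simp only [LinearMap.smul_apply, LinearMap.id_apply, C_smul', hφ]

/-- The map on local cohomology induced by a linear family, as a linear map. -/
noncomputable def HmapL (μ : ℤ) (p : ℕ) : H A n M p →ₗ[A] H A n N p where
  toFun := φ.Hmap μ p
  map_add' := map_add _
  map_smul' := φ.Hmap_smul hφ μ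

@[simp] theorem HmapL_apply (μ : ℤ) (p : ℕ) (z : H A n M p) :
    φ.HmapL hφ μ p z = φ.Hmap μ p z := rfl

end ShiftHom

end LinearStructure

/-- The image of the middle piece under b lies in the range of `P₃`, and the part of the piece
killed by b comes from the range of `P₁`. Both are finitely generated because A is noetherian. -/
theorem range_fg_of_exact {A : Type*} [CommRing A] [IsNoetherianRing A] {H₁ H₂ H₃ : Type*}
    [AddCommGroup H₁] [Module A H₁] [AddCommGroup H₂] [Module A H₂] [AddCommGroup H₃] [Module A H₃]
    (a : H₁ →ₗ[A] H₂) (b : H₂ →ₗ[A] H₃) (P₁ : H₁ →ₗ[A] H₁) (P₂ : H₂ →ₗ[A] H₂) (P₃ : H₃ →ₗ[A] H₃)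
    (exact : ∀ z, b z = 0 → ∃ w, a w = z) (idem : ∀ z, P₂ (P₂ z) = P₂ z)
    (ha : ∀ z, P₂ (a z) = a (P₁ z)) (hb : ∀ z, b (P₂ z) = P₃ (b z))
    (h₁ : (LinearMap.range P₁).FG) (h₃ : (LinearMap.range P₃).FG) : (LinearMap.range P₂).FG := by
  refine Submodule.fg_of_fg_map_of_fg_inf_ker b ?_ ?_
  · refine Submodule.FG.of_le h₃ ?_
    rintro _ ⟨_, ⟨z, rfl⟩, rfl⟩
    exact ⟨b z, (hb z).symm⟩
  · refine Submodule.FG.of_le (h₁.map a) ?_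
    rintro _ ⟨⟨z, rfl⟩, hz⟩
    obtain ⟨w, hw⟩ := exact _ hz
    exact ⟨P₁ w, ⟨w, rfl⟩, by rw [← ha, hw, idem]⟩

/-- A linear `ℤ`-grading, given by projections, that is locally bounded above. -/
structure Grading (A : Type*) [CommRing A] (n : ℕ) (M : Type*) [AddCommGroup M]
    [Module (MvPolynomial (Fin n) A) M] [Module A M] extends ShiftHom A A n M M where
  map_smul : ∀ μ (a : A) m, toFun μ (a • m) = a • toFun μ m
  idem : ∀ μ m, toFun μ (toFun μ m) = toFun μ m
  bdd : ∀ m, ∃ ν₀ : ℤ, ∀ ν ≥ ν₀, toFun ν m = 0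

namespace Grading

variable {A : Type*} [CommRing A] {n : ℕ} {M : Type*} [AddCommGroup M]
  [Module (MvPolynomial (Fin n) A) M] [Module A M] [IsScalarTower A (MvPolynomial (Fin n) A) M]
  (G : Grading A n M)

/-- The grading induced on a submodule. -/
noncomputable def restrict (S : Submodule (MvPolynomial (Fin n) A) M)
    (hS : ∀ μ, ∀ m ∈ S, G.toFun μ m ∈ S) : Grading A n S where
  toFun μ := ((G.toFun μ).comp S.subtype.toAddMonoidHom).codRestrict S fun m => hS μ m m.2
  map_X_smul μ j m := Subtype.ext (G.map_X_smul μ j m)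
  map_smul μ a m := Subtype.ext (G.map_smul μ a m)
  idem μ m := Subtype.ext (G.idem μ m)
  bdd m := by
    obtain ⟨ν₀, h⟩ := G.bdd m
    exact ⟨ν₀, fun ν hν => Subtype.ext (h ν hν)⟩

/-- The grading induced on a quotient. -/
noncomputable def quot (S : Submodule (MvPolynomial (Fin n) A) M)
    (hS : ∀ μ, ∀ m ∈ S, G.toFun μ m ∈ S) : Grading A n (M ⧸ S) where
  toFun μ := QuotientAddGroup.map S.toAddSubgroup S.toAddSubgroup (G.toFun μ) (hS μ)
  map_X_smul μ j m := by
    induction m using Submodule.Quotient.induction_on with | _ m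
    exact congrArg (Submodule.Quotient.mk (p := S)) (G.map_X_smul μ j m)
  map_smul μ a m := by
    induction m using Submodule.Quotient.induction_on with | _ m
    exact congrArg (Submodule.Quotient.mk (p := S)) (G.map_smul μ a m)
  idem μ m := by
    induction m using Submodule.Quotient.induction_on with | _ m
    exact congrArg (Submodule.Quotient.mk (p := S)) (G.idem μ m)
  bdd m := by
    induction m using Submodule.Quotient.induction_on with | _ m
    obtain ⟨ν₀, h⟩ := G.bdd m
    exact ⟨ν₀, fun ν hν => congrArg (Submodule.Quotient.mk (p := S)) (h ν hν)⟩

variable [Nontrivial A]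

theorem Hmap_idem (ν : ℤ) {p : ℕ} (z : H A n M p) :
    G.Hmap ν p (G.Hmap ν p z) = G.Hmap ν p z := by
  rw [← ShiftHom.Hmap_comp]
  exact DFunLike.congr_fun (ShiftHom.Hmap_congr (fun d => AddMonoidHom.ext fun m => G.idem _ m) p) z

theorem Hmap_X_smul (ν : ℤ) {p : ℕ} (j : Fin n) (z : H A n M p) :
    G.Hmap (ν + 1) p ((X j : MvPolynomial (Fin n) A) • z) =
      (X j : MvPolynomial (Fin n) A) • G.Hmap ν p z := by
  rw [← ShiftHom.Hmap_ofLinear_smul _ 0, ← ShiftHom.Hmap_ofLinear_smul _ 0]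
  refine ShiftHom.Hmap_comm (fun d m => ?_) p z
  rw [ShiftHom.ofLinear_apply, ShiftHom.ofLinear_apply]
  simp only [LinearMap.smul_apply, LinearMap.id_apply]
  rw [add_right_comm, G.map_X_smul]

/-- The projection to a graded piece of the local cohomology. -/
noncomputable def HmapL (ν : ℤ) (p : ℕ) : H A n M p →ₗ[A] H A n M p :=
  G.toShiftHom.HmapL G.map_smul ν p

@[simp] theorem HmapL_apply (ν : ℤ) (p : ℕ) (z : H A n M p) :
    G.HmapL ν p z = G.Hmap ν p z := rfl

end Grading

namespace WeakSES

variable {A : Type*} [CommRing A] [Nontrivial A] {n : ℕ} {K M N : Type*}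
  [AddCommGroup K] [Module (MvPolynomial (Fin n) A) K] [Module A K]
  [IsScalarTower A (MvPolynomial (Fin n) A) K]
  [AddCommGroup M] [Module (MvPolynomial (Fin n) A) M] [Module A M]
  [IsScalarTower A (MvPolynomial (Fin n) A) M]
  [AddCommGroup N] [Module (MvPolynomial (Fin n) A) N] [Module A N]
  [IsScalarTower A (MvPolynomial (Fin n) A) N]

/-- A short exact sequence of linear maps. -/
theorem ofLinear (f : K →ₗ[MvPolynomial (Fin n) A] M) (g : M →ₗ[MvPolynomial (Fin n) A] N)
    (hf : Function.Injective f) (hfg : Function.Exact f g) (hg : Function.Surjective g) :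
    WeakSES A A A n f.toAddMonoidHom g.toAddMonoidHom where
  map_X_left j m := f.map_smul _ m
  map_X_right j m := g.map_smul _ m
  torsion k hk j := ⟨0, by rw [hf (hk.trans (map_zero f).symm), smul_zero]⟩
  comp_zero k := hfg.apply_apply_eq_zero k
  exact m hm := (hfg m).1 hm
  surj := hg

variable {f : K →ₗ[MvPolynomial (Fin n) A] M} {g : M →ₗ[MvPolynomial (Fin n) A] N}
  (S : WeakSES A A A n f.toAddMonoidHom g.toAddMonoidHom)

theorem map_smul_of_linear (f : K →ₗ[MvPolynomial (Fin n) A] M) (a : A) (k : K) :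
    f (a • k) = a • f k := by
  rw [← C_smul' (n := n) a k, ← C_smul' (n := n) a, f.map_smul]

/-- The first map on local cohomology, as a linear map. -/
noncomputable def leftL (p : ℕ) : H A n K p →ₗ[A] H A n M p :=
  S.left.HmapL (fun _ => map_smul_of_linear f) 0 p

/-- The second map on local cohomology, as a linear map. -/
noncomputable def rightL (p : ℕ) : H A n M p →ₗ[A] H A n N p :=
  S.right.HmapL (fun _ => map_smul_of_linear g) 0 p

theorem delta_poly_smul (p : ℕ) (a : MvPolynomial (Fin n) A) (z : H A n N p) :
    S.delta p (a • z) = a • S.delta p z := by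
  rw [← ShiftHom.Hmap_ofLinear_smul a 0, ← ShiftHom.Hmap_ofLinear_smul a 0]
  exact S.delta_natural S (α := ShiftHom.ofLinear (a • LinearMap.id))
    (β := ShiftHom.ofLinear (a • LinearMap.id)) (γ := ShiftHom.ofLinear (a • LinearMap.id)) 0
    (fun _ k => by rw [ShiftHom.ofLinear_apply, ShiftHom.ofLinear_apply]; exact (f.map_smul a k).symm)
    (fun _ k => by rw [ShiftHom.ofLinear_apply, ShiftHom.ofLinear_apply]; exact (g.map_smul a k).symm) p z

/-- The connecting map, as a linear map. -/
noncomputable def deltaL (p : ℕ) : H A n N p →ₗ[A] H A n K (p + 1) where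
  toFun := S.delta p
  map_add' := map_add _
  map_smul' a z := by
    rw [← C_smul_H, delta_poly_smul, C_smul_H]
    rfl

end WeakSES

/-! ### Finite generation of the graded pieces of cohomology -/

section Finiteness

variable {A : Type*} [CommRing A] [Nontrivial A] [IsNoetherianRing A] {n : ℕ}

theorem smul_eq_constantCoeff_smul {M : Type*} [AddCommGroup M]
    [Module (MvPolynomial (Fin n) A) M] [Module A M] [IsScalarTower A (MvPolynomial (Fin n) A) M]
    (h : ∀ (j : Fin n) (x : M), (X j : MvPolynomial (Fin n) A) • x = 0)
    (g : MvPolynomial (Fin n) A) (x : M) : g • x = constantCoeff g • x := by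
  induction g using MvPolynomial.induction_on with
  | C a => rw [C_smul', constantCoeff_C]
  | add p q hp hq => rw [add_smul, hp, hq, map_add, add_smul]
  | mul_X p j _ => rw [mul_smul, h, smul_zero, map_mul, constantCoeff_X, mul_zero, zero_smul]

theorem finite_of_X_smul_eq_zero {M : Type*} [AddCommGroup M]
    [Module (MvPolynomial (Fin n) A) M] [Module A M] [IsScalarTower A (MvPolynomial (Fin n) A) M]
    [Module.Finite (MvPolynomial (Fin n) A) M]
    (h : ∀ (j : Fin n) (x : M), (X j : MvPolynomial (Fin n) A) • x = 0) : Module.Finite A M := by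
  obtain ⟨s, hs⟩ := (Module.Finite.fg_top : (⊤ : Submodule (MvPolynomial (Fin n) A) M).FG)
  refine ⟨⟨s, top_unique fun x _ => ?_⟩⟩
  have hx : x ∈ Submodule.span (MvPolynomial (Fin n) A) (s : Set M) := hs ▸ Submodule.mem_top
  induction hx using Submodule.span_induction with
  | mem x hx => exact Submodule.subset_span hx
  | zero => exact zero_mem _
  | add x y _ _ hx hy => exact add_mem (hx trivial) (hy trivial)
  | smul a x _ hx =>
    rw [smul_eq_constantCoeff_smul h]
    exact Submodule.smul_mem _ _ (hx trivial)

/-- When all variables kill M, every localization at a nonempty set of variables is zero. So only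
degree zero survives, where the cohomology is M itself, finitely generated over A. -/
theorem finite_pieces_base {M : Type*} [AddCommGroup M]
    [Module (MvPolynomial (Fin n) A) M] [Module A M] [IsScalarTower A (MvPolynomial (Fin n) A) M]
    [Module.Finite (MvPolynomial (Fin n) A) M] (G : Grading A n M)
    (h : ∀ (j : Fin n) (x : M), (X j : MvPolynomial (Fin n) A) • x = 0) (p : ℕ) :
    (∃ ν₀ : ℤ, ∀ ν ≥ ν₀, ∀ z : H A n M p, G.Hmap ν p z = 0) ∧
      ∀ ν, (LinearMap.range (G.HmapL ν p)).FG := by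
  have hfin := finite_of_X_smul_eq_zero h
  cases p with
  | succ p =>
    have h0 : ∀ z : H A n M (p + 1), z = 0 := by
      intro z
      obtain ⟨c, hc, rfl⟩ := cls_surjective z
      have : c = 0 := by
        ext s : 1
        obtain ⟨j, hj⟩ := Finset.card_pos.1 (s.2.symm ▸ Nat.succ_pos p : 0 < s.1.card)
        rw [Pi.zero_apply]
        induction c s using LocalizedModule.induction_on with | _ m u
        rw [mk_eq_zero_iff]
        exact ⟨⟨X j, X_mem_varMonoid A hj⟩, h j m⟩
      rw [cls_congr this, cls_zero]
    refine ⟨⟨0, fun ν _ z => h0 _⟩, fun ν => ?_⟩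
    rw [show LinearMap.range (G.HmapL ν (p + 1)) = ⊥ from (Submodule.eq_bot_iff _).2
      fun z _ => h0 z]
    exact Submodule.fg_bot
  | zero =>
    have hc : ∀ m : M, cechD A n M 0 (zeroCochain A n m) = 0 := fun m =>
      (cechD_zeroCochain_iff m).2 fun j => ⟨1, by rw [pow_one, h]⟩
    let F : M →ₗ[A] H A n M 0 :=
      { toFun := fun m => cls _ (hc m)
        map_add' := fun m m' => by
          rw [← cls_add]
          exact cls_congr (zeroCochain_add m m') _
        map_smul' := fun a m => by
          rw [RingHom.id_apply, ← C_smul_H, cls_smul]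
          refine cls_congr ?_ _
          ext s
          rw [Pi.smul_apply, zeroCochain, zeroCochain, LocalizedModule.smul'_mk, C_smul'] }
    have hF : Function.Surjective F := by
      intro z
      obtain ⟨c, hc, rfl⟩ := cls_surjective z
      obtain ⟨m, rfl⟩ := exists_zeroCochain_eq c
      exact ⟨m, rfl⟩
    have hFG : ∀ ν m, G.Hmap ν 0 (F m) = F (G.toFun ν m) := by
      intro ν m
      refine (ShiftHom.Hmap_cls _ _ _ _ _).trans (cls_congr ?_ _)
      ext s
      rw [ShiftHom.cochainMap_apply, zeroCochain, ShiftHom.locMap_mk, mdeg_one, tr_one, add_zero]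
      rfl
    have : Module.Finite A (H A n M 0) := Module.Finite.of_surjective F hF
    refine ⟨?_, fun ν => IsNoetherian.noetherian _⟩
    obtain ⟨s, hs⟩ := hfin.fg_top
    choose b hb using G.bdd
    obtain ⟨ν₀, hν₀⟩ := (s.image b).bddAbove
    refine ⟨ν₀, fun ν hν z => ?_⟩
    obtain ⟨m, rfl⟩ := hF z
    have hm : m ∈ Submodule.span A (s : Set M) := hs ▸ Submodule.mem_top
    rw [hFG]
    suffices h0 : G.toFun ν m = 0 by rw [h0, map_zero]
    induction hm using Submodule.span_induction with
    | mem x hx =>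
      exact hb x ν (le_trans (hν₀ (Finset.mem_coe.2 (Finset.mem_image_of_mem b hx))) hν)
    | zero => rw [map_zero]
    | add x y _ _ hx hy => rw [map_add, hx, hy, add_zero]
    | smul a x _ hx => rw [G.map_smul, hx, smul_zero]

/-- Multiplication by x_j factors as M → I → M with kernel K and cokernel Q, the first map raising
degrees by one. In large degrees K and Q do not contribute, so x_j is injective on the cohomology of
M; being locally nilpotent there, it forces vanishing. Below that, finite generation descends one
degree at a time through the two long exact sequences. -/
theorem finite_pieces_step {M : Type*} [AddCommGroup M]
    [Module (MvPolynomial (Fin n) A) M] [Module A M] [IsScalarTower A (MvPolynomial (Fin n) A) M]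
    (G : Grading A n M) (j : Fin n) {K I Q : Type*}
    [AddCommGroup K] [Module (MvPolynomial (Fin n) A) K] [Module A K]
    [IsScalarTower A (MvPolynomial (Fin n) A) K]
    [AddCommGroup I] [Module (MvPolynomial (Fin n) A) I] [Module A I]
    [IsScalarTower A (MvPolynomial (Fin n) A) I]
    [AddCommGroup Q] [Module (MvPolynomial (Fin n) A) Q] [Module A Q]
    [IsScalarTower A (MvPolynomial (Fin n) A) Q]
    (GK : Grading A n K) (GI : Grading A n I) (GQ : Grading A n Q)
    {f₁ : K →ₗ[MvPolynomial (Fin n) A] M} {g₁ : M →ₗ[MvPolynomial (Fin n) A] I}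
    {f₂ : I →ₗ[MvPolynomial (Fin n) A] M} {g₂ : M →ₗ[MvPolynomial (Fin n) A] Q}
    (S₁ : WeakSES A A A n f₁.toAddMonoidHom g₁.toAddMonoidHom)
    (S₂ : WeakSES A A A n f₂.toAddMonoidHom g₂.toAddMonoidHom)
    (hf₂ : Function.Injective f₂)
    (hX : ∀ m, f₂ (g₁ m) = (X j : MvPolynomial (Fin n) A) • m)
    (c₁ : ∀ ν m, G.toFun ν (f₁ m) = f₁ (GK.toFun ν m))
    (c₂ : ∀ ν m, GI.toFun (ν + 1) (g₁ m) = g₁ (G.toFun ν m))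
    (c₃ : ∀ ν m, G.toFun ν (f₂ m) = f₂ (GI.toFun ν m))
    (c₄ : ∀ ν m, GQ.toFun ν (g₂ m) = g₂ (G.toFun ν m))
    (hK : ∀ p, (∃ ν₀ : ℤ, ∀ ν ≥ ν₀, ∀ z : H A n K p, GK.Hmap ν p z = 0) ∧
      ∀ ν, (LinearMap.range (GK.HmapL ν p)).FG)
    (hQ : ∀ p, (∃ ν₀ : ℤ, ∀ ν ≥ ν₀, ∀ z : H A n Q p, GQ.Hmap ν p z = 0) ∧
      ∀ ν, (LinearMap.range (GQ.HmapL ν p)).FG) (p : ℕ) :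
    (∃ ν₀ : ℤ, ∀ ν ≥ ν₀, ∀ z : H A n M p, G.Hmap ν p z = 0) ∧
      ∀ ν, (LinearMap.range (G.HmapL ν p)).FG := by
  have hXH : ∀ (p) (z : H A n M p), S₂.left.Hmap 0 p (S₁.right.Hmap 0 p z) =
      (X j : MvPolynomial (Fin n) A) • z := by
    intro p z
    rw [← ShiftHom.Hmap_comp, ← ShiftHom.Hmap_ofLinear_smul _ 0]
    exact DFunLike.congr_fun (ShiftHom.Hmap_congr (fun d => AddMonoidHom.ext fun m => hX m) p) z
  have d₁ : ∀ (ν p) (z : H A n K p), G.Hmap ν p (S₁.left.Hmap 0 p z) =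
      S₁.left.Hmap 0 p (GK.Hmap ν p z) := fun ν p z =>
    ShiftHom.Hmap_comm (fun d m => c₁ _ m) p z
  have d₂ : ∀ (ν p) (z : H A n M p), GI.Hmap (ν + 1) p (S₁.right.Hmap 0 p z) =
      S₁.right.Hmap 0 p (G.Hmap ν p z) := fun ν p z =>
    ShiftHom.Hmap_comm (fun d m => by rw [add_right_comm]; exact c₂ _ m) p z
  have d₃ : ∀ (ν p) (z : H A n I p), G.Hmap ν p (S₂.left.Hmap 0 p z) =
      S₂.left.Hmap 0 p (GI.Hmap ν p z) := fun ν p z =>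
    ShiftHom.Hmap_comm (fun d m => c₃ _ m) p z
  have d₄ : ∀ (ν p) (z : H A n Q p), GI.Hmap ν (p + 1) (S₂.delta p z) =
      S₂.delta p (GQ.Hmap ν p z) := fun ν p z =>
    (S₂.delta_natural S₂ (α := GI.toShiftHom) (β := G.toShiftHom) (γ := GQ.toShiftHom) ν
      (fun d k => c₃ d k) (fun d m => c₄ d m) p z).symm
  have bound : ∃ ν₀ : ℤ, ∀ ν ≥ ν₀, ∀ z : H A n I p, S₂.left.Hmap 0 p z = 0 →
      GI.Hmap (ν + 1) p z = 0 := by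
    cases p with
    | zero => exact ⟨0, fun ν _ z hz => by rw [S₂.exact_left_zero hf₂ z hz, map_zero]⟩
    | succ p =>
      obtain ⟨ν₀, h⟩ := (hQ p).1
      refine ⟨ν₀, fun ν hν z hz => ?_⟩
      obtain ⟨w, rfl⟩ := S₂.exact_left z hz
      rw [d₄, h _ (by omega), map_zero]
  obtain ⟨ν₁, h₁⟩ := bound
  obtain ⟨ν₂, h₂⟩ := (hK p).1
  have inj : ∀ ν ≥ max ν₁ ν₂, ∀ z : H A n M p,
      (X j : MvPolynomial (Fin n) A) • G.Hmap ν p z = 0 → G.Hmap ν p z = 0 := by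
    intro ν hν z hz
    rw [← hXH] at hz
    have h3 := h₁ ν (le_trans (le_max_left _ _) hν) _ hz
    rw [d₂, G.Hmap_idem] at h3
    obtain ⟨k, hk⟩ := S₁.exact_middle _ h3
    rw [← G.Hmap_idem, ← hk, d₁, h₂ ν (le_trans (le_max_right _ _) hν), map_zero]
  have van : ∀ ν ≥ max ν₁ ν₂, ∀ z : H A n M p, G.Hmap ν p z = 0 := by
    intro ν hν z
    obtain ⟨e, he⟩ := exists_pow_smul_eq_zero j (G.Hmap ν p z)
    induction e generalizing ν z with
    | zero => rwa [pow_zero, one_smul] at he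
    | succ e ih =>
      refine inj ν hν z ?_
      rw [← G.Hmap_X_smul]
      refine ih (ν + 1) (by omega) _ ?_
      rwa [G.Hmap_X_smul, smul_smul, ← pow_succ]
  refine ⟨⟨_, van⟩, ?_⟩
  -- Degree ν + 1 of H^p(I) sits between H^{p−1}(Q) and H^p(M), both in degree ν + 1; degree ν of
  -- H^p(M) sits between H^p(K) in degree ν and H^p(I) in degree ν + 1.
  have step : ∀ ν, (LinearMap.range (G.HmapL (ν + 1) p)).FG →
      (LinearMap.range (G.HmapL ν p)).FG := by
    intro ν hν
    have hI : (LinearMap.range (GI.HmapL (ν + 1) p)).FG := by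
      cases p with
      | zero =>
        refine range_fg_of_exact (0 : H A n I 0 →ₗ[A] H A n I 0) (S₂.leftL 0) 0
          (GI.HmapL (ν + 1) 0) (G.HmapL (ν + 1) 0)
          (fun z hz => ⟨0, (S₂.exact_left_zero hf₂ z hz).symm⟩) (fun z => GI.Hmap_idem _ z)
          (fun z => by simp) (fun z => (d₃ _ _ z).symm) ?_ hν
        rw [LinearMap.range_zero]
        exact Submodule.fg_bot
      | succ p =>
        exact range_fg_of_exact (S₂.deltaL p) (S₂.leftL (p + 1))
          (GQ.HmapL (ν + 1) p) (GI.HmapL (ν + 1) (p + 1)) (G.HmapL (ν + 1) (p + 1))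
          (fun z hz => S₂.exact_left z hz) (fun z => GI.Hmap_idem _ z)
          (fun z => d₄ _ _ z) (fun z => (d₃ _ _ z).symm) ((hQ p).2 (ν + 1)) hν
    exact range_fg_of_exact (S₁.leftL p) (S₁.rightL p) (GK.HmapL ν p) (G.HmapL ν p)
      (GI.HmapL (ν + 1) p)
      (fun z hz => S₁.exact_middle z hz) (fun z => G.Hmap_idem _ z)
      (fun z => d₁ _ _ z) (fun z => (d₂ _ _ z).symm) ((hK p).2 ν) hI
  have down : ∀ (d : ℕ) (ν : ℤ), max ν₁ ν₂ ≤ ν + d → (LinearMap.range (G.HmapL ν p)).FG := by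
    intro d
    induction d with
    | zero =>
      intro ν hν
      rw [show LinearMap.range (G.HmapL ν p) = ⊥ by
        rw [Submodule.eq_bot_iff]
        rintro _ ⟨z, rfl⟩
        exact van ν (by simpa using hν) z]
      exact Submodule.fg_bot
    | succ d ih => exact fun ν hν => step ν (ih (ν + 1) (by push_cast at hν; omega))
  exact fun ν => down (max ν₁ ν₂ - ν).toNat ν (by omega)

/-- Graded pieces of the local cohomology of finitely generated graded modules are finitely
generated, and vanish in large degrees. -/
theorem finite_pieces (m : ℕ) : ∀ (M : Type*) [AddCommGroup M]
    [Module (MvPolynomial (Fin n) A) M] [Module A M] [IsScalarTower A (MvPolynomial (Fin n) A) M]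
    [Module.Finite (MvPolynomial (Fin n) A) M] (G : Grading A n M)
    (_ : ∀ j : Fin n, m ≤ j → ∀ x : M, (X j : MvPolynomial (Fin n) A) • x = 0) (p : ℕ),
    (∃ ν₀ : ℤ, ∀ ν ≥ ν₀, ∀ z : H A n M p, G.Hmap ν p z = 0) ∧
      ∀ ν, (LinearMap.range (G.HmapL ν p)).FG := by
  induction m with
  | zero => exact fun M _ _ _ _ _ G h p => finite_pieces_base G (fun j => h j (Nat.zero_le _)) p
  | succ m ih =>
    intro M _ _ _ _ _ G h p
    by_cases hm : m < n
    swap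
    · exact ih M G (fun j hj => absurd (lt_of_le_of_lt hj j.2) hm) p
    let j : Fin n := ⟨m, hm⟩
    -- The induction is on the number of variables allowed to act nontrivially. The kernel and the
    -- cokernel of x_m are killed by x_m in addition to the later variables.
    let T : M →ₗ[MvPolynomial (Fin n) A] M := (X j : MvPolynomial (Fin n) A) • LinearMap.id
    have hT : ∀ x, T x = (X j : MvPolynomial (Fin n) A) • x := fun x => rfl
    have kerst : ∀ μ, ∀ x ∈ LinearMap.ker T, G.toFun μ x ∈ LinearMap.ker T := by
      intro μ x hx
      rw [LinearMap.mem_ker, hT] at hx ⊢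
      rw [← G.map_X_smul, hx, map_zero]
    have rngst : ∀ μ, ∀ x ∈ LinearMap.range T, G.toFun μ x ∈ LinearMap.range T := by
      rintro μ _ ⟨x, rfl⟩
      refine ⟨G.toFun (μ - 1) x, ?_⟩
      rw [hT, hT, ← G.map_X_smul, sub_add_cancel]
    refine finite_pieces_step G j (G.restrict _ kerst) (G.restrict _ rngst) (G.quot _ rngst)
      (WeakSES.ofLinear (LinearMap.ker T).subtype T.rangeRestrict (Submodule.subtype_injective _)
        (fun x => by
          rw [← LinearMap.mem_ker, LinearMap.ker_rangeRestrict]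
          exact ⟨fun hx => ⟨⟨x, hx⟩, rfl⟩, by rintro ⟨w, rfl⟩; exact w.2⟩) T.surjective_rangeRestrict)
      (WeakSES.ofLinear (LinearMap.range T).subtype (LinearMap.range T).mkQ
        (Submodule.subtype_injective _)
        (LinearMap.exact_subtype_mkQ _) (Submodule.mkQ_surjective _))
      (Submodule.subtype_injective _) (fun x => rfl) (fun ν x => rfl)
      (fun ν x => Subtype.ext (G.map_X_smul ν j x)) (fun ν x => rfl) (fun ν x => rfl)
      (ih _ _ ?_) (ih _ _ ?_) p
    · rintro l hl ⟨x, hx⟩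
      rcases hl.lt_or_eq with hl | hl
      · exact Subtype.ext (h l hl x)
      · obtain rfl : j = l := Fin.ext hl
        exact Subtype.ext hx
    · intro l hl x
      induction x using Submodule.Quotient.induction_on with | _ x
      rw [← Submodule.Quotient.mk_smul, Submodule.Quotient.mk_eq_zero]
      rcases hl.lt_or_eq with hl | hl
      · rw [h l hl x]
        exact zero_mem _
      · obtain rfl : j = l := Fin.ext hl
        exact ⟨x, rfl⟩

end Finiteness

end GradedLC

namespace GradedLC

open MvPolynomial

/-! ### One of the two highest cohomology modules of R/I is zero -/

section TopVanishing

variable {k : Type*} [Field k] {r : ℕ}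

/-- The fraction `1 / x^a` in the localization of `R / I` at all the variables. -/
noncomputable def invMon (I : Ideal (MvPolynomial (Fin (r + 1)) k)) (a : Fin (r + 1) →₀ ℕ) :
    Loc k (MvPolynomial (Fin (r + 1)) k ⧸ I) (Finset.univ : Finset (Fin (r + 1))) :=
  LocalizedModule.mk 1 ⟨monomial a 1, monomial_mem_varMonoid k
    (fun j hj => absurd (Finset.mem_univ j) hj)⟩

variable (I : Ideal (MvPolynomial (Fin (r + 1)) k))

theorem monomial_smul_invMon (a b : Fin (r + 1) →₀ ℕ) :
    monomial b (1 : k) • invMon I (b + a) = invMon I a := by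
  rw [invMon, invMon, LocalizedModule.smul'_mk, LocalizedModule.mk_eq]
  refine ⟨1, ?_⟩
  rw [one_smul, one_smul, Submonoid.smul_def, Submonoid.smul_def, smul_smul, monomial_mul,
    one_mul, add_comm b a]

/-- The top Cech coboundaries. -/
noncomputable def topCoboundaries : Submodule (MvPolynomial (Fin (r + 1)) k)
    (Loc k (MvPolynomial (Fin (r + 1)) k ⧸ I) (Finset.univ : Finset (Fin (r + 1)))) :=
  (LinearMap.range (cechD k (r + 1) (MvPolynomial (Fin (r + 1)) k ⧸ I) r)).map
    (LinearMap.proj (⟨Finset.univ, by simp⟩ : {s : Finset (Fin (r + 1)) // s.card = r + 1}))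

theorem res_mem_topCoboundaries (j : Fin (r + 1))
    (w : Loc k (MvPolynomial (Fin (r + 1)) k ⧸ I) (Finset.univ.erase j)) :
    res k _ (Finset.erase_subset j Finset.univ) w ∈ topCoboundaries I := by
  classical
  have hc : ∀ l : Fin (r + 1), (Finset.univ.erase l).card = r := fun l => by simp
  have key : cechD k (r + 1) _ r (Pi.single (⟨Finset.univ.erase j, hc j⟩ :
      {s : Finset (Fin (r + 1)) // s.card = r}) w) ⟨Finset.univ, by simp⟩ =
      ((-1 : MvPolynomial (Fin (r + 1)) k) ^ (Finset.univ.filter (· < j)).card) •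
        res k _ (Finset.erase_subset j Finset.univ) w := by
    rw [cechD_apply', Finset.sum_eq_single_of_mem j (Finset.mem_univ j),
      resExt_eq _ (Finset.erase_subset _ _) (hc j), Pi.single_eq_same]
    intro l _ hl
    rw [resExt_eq _ (Finset.erase_subset _ _) (hc l), Pi.single_eq_of_ne, map_zero, smul_zero]
    intro h
    have h1 : Finset.univ.erase l = Finset.univ.erase j := congrArg Subtype.val h
    exact Finset.notMem_erase j _ (h1 ▸ Finset.mem_erase.2 ⟨hl.symm, Finset.mem_univ j⟩)
  have h2 : ((-1 : MvPolynomial (Fin (r + 1)) k) ^ (Finset.univ.filter (· < j)).card) •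
      res k _ (Finset.erase_subset j Finset.univ) w ∈ topCoboundaries I :=
    ⟨_, ⟨_, rfl⟩, key⟩
  have h3 := Submodule.smul_mem _
    ((-1 : MvPolynomial (Fin (r + 1)) k) ^ (Finset.univ.filter (· < j)).card) h2
  rwa [smul_smul, ← pow_add, Even.neg_one_pow ⟨_, rfl⟩, one_smul] at h3

/-- The fraction x^b / x^a needs no x_j in its denominator, so it is restricted from the
localization at the other variables. -/
theorem monomial_smul_mem {a b : Fin (r + 1) →₀ ℕ} {j : Fin (r + 1)} (h : a j ≤ b j) :
    monomial b (1 : k) • invMon I a ∈ topCoboundaries I := by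
  have hb : b = (b - Finsupp.single j (a j)) + Finsupp.single j (a j) := by
    ext l
    simp only [Finsupp.coe_add, Finsupp.coe_tsub, Pi.add_apply, Pi.sub_apply]
    by_cases hl : l = j
    · subst hl
      simp [h]
    · rw [Finsupp.single_eq_of_ne hl]
      simp
  rw [hb, ShiftHom.monomial_add_smul]
  refine Submodule.smul_mem _ _ ?_
  have : invMon I a = invMon I (Finsupp.single j (a j) + a.erase j) := by
    rw [Finsupp.single_add_erase]
  rw [this, monomial_smul_invMon]
  have hm : monomial (a.erase j) (1 : k) ∈ varMonoid k (Finset.univ.erase j) := by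
    refine monomial_mem_varMonoid k fun l hl => ?_
    have : l = j := by simpa using hl
    rw [this, Finsupp.erase_same]
  have := res_mem_topCoboundaries I j (LocalizedModule.mk 1 ⟨_, hm⟩)
  rwa [res_mk] at this

/-- Write u = (1, …, 1) and let m be the lexicographically smallest exponent of f. Since f acts as
zero, f / x^(m+e+u) = 0 expresses 1 / x^(e+u) through terms x^i / x^(m+e+u) with i > m. Such a term
either loses a variable from its denominator, and is a coboundary, or equals 1 / x^(e'+u) with e' =
m + e − i smaller than e. -/
theorem invMon_mem {f : MvPolynomial (Fin (r + 1)) k} (hf : f ∈ I) (hf0 : f ≠ 0)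
    (e : Fin (r + 1) →₀ ℕ) :
    invMon I (e + Finsupp.equivFunOnFinite.symm fun _ => 1) ∈ topCoboundaries I := by
  let o : MonomialOrder (Fin (r + 1)) := MonomialOrder.lex
  generalize hs : o.toSyn e = s
  induction s using WellFoundedLT.induction generalizing e with | _ s ih
  subst hs
  set u : Fin (r + 1) →₀ ℕ := Finsupp.equivFunOnFinite.symm fun _ => 1 with hu
  have hu1 : ∀ j, u j = 1 := fun j => rfl
  obtain ⟨m, hm, hmin⟩ := Finset.exists_min_image f.support o.toSyn (support_nonempty.2 hf0)
  have hfz : f • invMon I (m + (e + u)) = 0 := by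
    rw [invMon, LocalizedModule.smul'_mk]
    have : f • (1 : MvPolynomial (Fin (r + 1)) k ⧸ I) = 0 := by
      rw [← map_one (Ideal.Quotient.mk I)]
      change Ideal.Quotient.mk I (f * 1) = 0
      rw [mul_one]
      exact Ideal.Quotient.eq_zero_iff_mem.2 hf
    rw [this, LocalizedModule.zero_mk]
  have hterm : ∀ i, monomial i (f.coeff i) = C (f.coeff i) * monomial i 1 := fun i => by
    rw [C_mul_monomial, mul_one]
  rw [f.as_sum, ← Finset.add_sum_erase _ _ hm, add_smul, hterm m, mul_smul, monomial_smul_invMon,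
    Finset.sum_smul] at hfz
  have hG : (C (f.coeff m) : MvPolynomial (Fin (r + 1)) k) • invMon I (e + u) ∈
      topCoboundaries I := by
    rw [eq_neg_of_add_eq_zero_left hfz]
    refine neg_mem (Submodule.sum_mem _ fun i hi => ?_)
    rw [hterm i, mul_smul]
    refine Submodule.smul_mem _ _ ?_
    by_cases h : ∃ j, (m + (e + u)) j ≤ i j
    · obtain ⟨j, hj⟩ := h
      exact monomial_smul_mem I hj
    · push Not at h
      have h1 : ∀ j, i j ≤ m j + e j := by
        intro j
        have := h j
        simp only [Finsupp.coe_add, Pi.add_apply, hu1] at this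
        omega
      have h2 : m + e = i + (m + e - i) := by
        ext j
        have := h1 j
        simp only [Finsupp.coe_add, Finsupp.coe_tsub, Pi.add_apply, Pi.sub_apply]
        omega
      have h3 : m + (e + u) = i + ((m + e - i) + u) := by
        rw [← add_assoc, ← add_assoc, ← h2]
      rw [h3, monomial_smul_invMon]
      refine ih _ ?_ _ rfl
      obtain ⟨hne, hi⟩ := Finset.mem_erase.1 hi
      have h4 : o.toSyn m < o.toSyn i :=
        lt_of_le_of_ne (hmin i hi) fun h => hne (o.toSyn.injective h).symm
      have h5 := congrArg o.toSyn h2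
      rw [map_add, map_add] at h5
      by_contra hle
      push Not at hle
      exact absurd h5 (add_lt_add_of_lt_of_le h4 hle).ne
  have := Submodule.smul_mem _ (C (f.coeff m)⁻¹ : MvPolynomial (Fin (r + 1)) k) hG
  rwa [smul_smul, ← C_mul, inv_mul_cancel₀ (mem_support_iff.1 hm), C_1, one_smul] at this

/-- The top local cohomology of a proper quotient of the polynomial ring is zero. -/
theorem top_eq_zero (hI : I ≠ ⊥) (z : H k (r + 1) (MvPolynomial (Fin (r + 1)) k ⧸ I) (r + 1)) :
    z = 0 := by
  obtain ⟨f, hf, hf0⟩ := Submodule.exists_mem_ne_zero_of_ne_bot hI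
  obtain ⟨c, hc, rfl⟩ := cls_surjective z
  have key : ∀ w, w ∈ topCoboundaries I := by
    intro w
    induction w using LocalizedModule.induction_on with | _ m u
    obtain ⟨g, rfl⟩ := Ideal.Quotient.mk_surjective m
    have h1 : (LocalizedModule.mk (Ideal.Quotient.mk I g) u : Loc k _ _) =
        g • invMon I (expo u) := by
      rw [invMon, LocalizedModule.smul'_mk]
      congr 1
      · change _ = Ideal.Quotient.mk I (g * 1)
        rw [mul_one]
      · exact Subtype.ext (coe_eq_monomial u)
    -- Enlarging the denominator by the product of all variables brings it to the form covered by
    -- `invMon_mem`.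
    rw [h1, ← monomial_smul_invMon I (expo u) (Finsupp.equivFunOnFinite.symm fun _ => 1),
      add_comm _ (expo u)]
    exact Submodule.smul_mem _ _ (Submodule.smul_mem _ _ (invMon_mem I hf hf0 _))
  obtain ⟨_, ⟨b, rfl⟩, hb⟩ := key (c ⟨Finset.univ, by simp⟩)
  rw [cls_eq_zero_iff]
  refine mem_coboundaries_succ.2 ⟨b, ?_⟩
  ext ⟨s, hs⟩ : 1
  have h2 : s = Finset.univ := Finset.eq_univ_of_card s (by simp [hs])
  subst h2
  exact hb

/-- The ideal generated by the first `j` variables. -/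
noncomputable def firstVars (k : Type*) [Field k] (n j : ℕ) : Ideal (MvPolynomial (Fin n) k) :=
  Ideal.span (X '' {l : Fin n | (l : ℕ) < j})

/-- Membership in a monomial ideal is tested on exponents, and multiplying by x_j only changes the
exponent of a variable that is not among the generators. So the variables form a regular sequence.
-/
theorem X_mul_mem_firstVars {n j : ℕ} (hj : j < n) {a : MvPolynomial (Fin n) k}
    (h : X ⟨j, hj⟩ * a ∈ firstVars k n j) : a ∈ firstVars k n j := by
  rw [firstVars, mem_ideal_span_X_image] at h ⊢
  intro m hm
  obtain ⟨i, hi, hne⟩ := h (Finsupp.single ⟨j, hj⟩ 1 + m) (by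
    rw [mem_support_iff, coeff_X_mul]
    exact mem_support_iff.1 hm)
  refine ⟨i, hi, ?_⟩
  rwa [Finsupp.add_apply, Finsupp.single_eq_of_ne, zero_add] at hne
  rintro rfl
  exact lt_irrefl j hi

theorem firstVars_succ {n j : ℕ} (hj : j < n) :
    firstVars k n (j + 1) = Ideal.span {X ⟨j, hj⟩} ⊔ firstVars k n j := by
  rw [firstVars, firstVars, ← Ideal.span_union]
  congr 1
  ext q
  simp only [Set.mem_image, Set.mem_union, Set.mem_singleton_iff]
  constructor
  · rintro ⟨l, hl, rfl⟩
    rcases Nat.lt_succ_iff_lt_or_eq.1 hl with h | h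
    · exact Or.inr ⟨l, h, rfl⟩
    · exact Or.inl (by congr 1; exact Fin.ext h)
  · rintro (rfl | ⟨l, hl, rfl⟩)
    · exact ⟨_, Nat.lt_succ_self j, rfl⟩
    · exact ⟨l, Nat.lt_succ_of_lt hl, rfl⟩

theorem firstVars_le {n j : ℕ} (hj : j < n) : firstVars k n j ≤ firstVars k n (j + 1) := by
  rw [firstVars_succ hj]
  exact le_sup_right

theorem weakSES_firstVars {n j : ℕ} (hj : j < n) : WeakSES k k k n
    ((X ⟨j, hj⟩ : MvPolynomial (Fin n) k) • (LinearMap.id :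
      (MvPolynomial (Fin n) k ⧸ firstVars k n j) →ₗ[MvPolynomial (Fin n) k] _)).toAddMonoidHom
    (Submodule.factor (firstVars_le (k := k) hj)).toAddMonoidHom := by
  have hF : ∀ a, ((X ⟨j, hj⟩ : MvPolynomial (Fin n) k) • (LinearMap.id :
      (MvPolynomial (Fin n) k ⧸ firstVars k n j) →ₗ[MvPolynomial (Fin n) k] _))
        (Submodule.Quotient.mk a) = Submodule.Quotient.mk (X ⟨j, hj⟩ * a) := fun a => rfl
  have hG : ∀ a, Submodule.factor (firstVars_le (k := k) hj) (Submodule.Quotient.mk a) =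
      Submodule.Quotient.mk a := fun a => rfl
  refine WeakSES.ofLinear _ _ ?_ ?_ (Submodule.factor_surjective _)
  · rw [← LinearMap.ker_eq_bot, Submodule.eq_bot_iff]
    intro m hm
    obtain ⟨a, rfl⟩ := Submodule.Quotient.mk_surjective _ m
    rw [LinearMap.mem_ker, hF, Submodule.Quotient.mk_eq_zero] at hm
    exact (Submodule.Quotient.mk_eq_zero _).2 (X_mul_mem_firstVars hj hm)
  · intro m
    obtain ⟨a, rfl⟩ := Submodule.Quotient.mk_surjective _ m
    rw [hG, Submodule.Quotient.mk_eq_zero, firstVars_succ hj, Submodule.mem_sup]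
    constructor
    · rintro ⟨b, hb, c, hc, rfl⟩
      obtain ⟨d, rfl⟩ := Ideal.mem_span_singleton'.1 hb
      refine ⟨Submodule.Quotient.mk d, ?_⟩
      rw [hF, Submodule.Quotient.eq]
      have : X ⟨j, hj⟩ * d - (d * X ⟨j, hj⟩ + c) = -c := by ring
      rw [this]
      exact neg_mem hc
    · intro h
      obtain ⟨b, hb⟩ := h
      obtain ⟨c, rfl⟩ := Submodule.Quotient.mk_surjective _ b
      have h1 := (Submodule.Quotient.eq _).1 ((hF c).symm.trans hb)
      have h2 : a - X ⟨j, hj⟩ * c ∈ firstVars k n j := by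
        rw [← neg_sub]
        exact neg_mem h1
      have h3 : X ⟨j, hj⟩ * c ∈ Ideal.span {(X ⟨j, hj⟩ : MvPolynomial (Fin n) k)} :=
        Ideal.mul_mem_right _ _ (Ideal.mem_span_singleton_self _)
      exact ⟨_, h3, _, h2, add_sub_cancel _ _⟩

/-- This is vanishing below the depth. The kernel of x_j on H^p comes from H^{p−1} of the quotient
by one more variable, which is zero by induction; so x_j is injective on H^p and yet locally
nilpotent. -/
theorem eq_zero_of_firstVars {n : ℕ} (p : ℕ) : ∀ (j : ℕ) (_ : p + j < n)
    (z : H k n (MvPolynomial (Fin n) k ⧸ firstVars k n j) p), z = 0 := by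
  have step : ∀ (p j : ℕ) (hj : j < n),
      (∀ z : H k n (MvPolynomial (Fin n) k ⧸ firstVars k n j) p,
        (weakSES_firstVars (k := k) hj).left.Hmap 0 p z = 0 → z = 0) →
      ∀ z : H k n (MvPolynomial (Fin n) k ⧸ firstVars k n j) p, z = 0 := by
    intro p j hj h z
    have h1 : ∀ z : H k n (MvPolynomial (Fin n) k ⧸ firstVars k n j) p,
        (X ⟨j, hj⟩ : MvPolynomial (Fin n) k) • z = 0 → z = 0 := by
      intro z hz
      apply h
      rw [← hz, ← ShiftHom.Hmap_ofLinear_smul _ 0]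
      exact DFunLike.congr_fun (ShiftHom.Hmap_congr (fun d => rfl) p) z
    obtain ⟨e, he⟩ := exists_pow_smul_eq_zero ⟨j, hj⟩ z
    induction e with
    | zero => rwa [pow_zero, one_smul] at he
    | succ e ih => exact ih (h1 _ (by rwa [smul_smul, ← pow_succ']))
  induction p with
  | zero =>
    intro j hj
    refine step 0 j (by omega) fun z hz => (weakSES_firstVars _).exact_left_zero ?_ z hz
    intro a b hab
    obtain ⟨a, rfl⟩ := Submodule.Quotient.mk_surjective _ a
    obtain ⟨b, rfl⟩ := Submodule.Quotient.mk_surjective _ b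
    have h2 : (Submodule.Quotient.mk (X ⟨j, by omega⟩ * a) :
        MvPolynomial (Fin n) k ⧸ firstVars k n j) = Submodule.Quotient.mk (X ⟨j, by omega⟩ * b) :=
      hab
    rw [Submodule.Quotient.eq, ← mul_sub] at h2
    exact (Submodule.Quotient.eq _).2 (X_mul_mem_firstVars _ h2)
  | succ p ih =>
    intro j hj
    refine step (p + 1) j (by omega) fun z hz => ?_
    obtain ⟨w, rfl⟩ := (weakSES_firstVars _).exact_left z hz
    rw [ih (j + 1) (by omega) w, map_zero]

/-- For I = 0 the depth is r + 1, and for I ≠ 0 the top cohomology vanishes. Either way there is no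
nonzero map from H^r to H^{r+1}, the one case outside the range 1 ≤ i ≤ r. -/
theorem eq_zero_or_top_eq_zero : (∀ z : H k (r + 1) (MvPolynomial (Fin (r + 1)) k ⧸ I) r, z = 0) ∨
    ∀ z : H k (r + 1) (MvPolynomial (Fin (r + 1)) k ⧸ I) (r + 1), z = 0 := by
  by_cases hI : I = ⊥
  · left
    have : I = firstVars k (r + 1) 0 := by
      rw [hI, firstVars, eq_comm, Ideal.span_eq_bot]
      rintro _ ⟨l, hl, rfl⟩
      exact absurd hl (Nat.not_lt_zero _)
    rw [this]
    exact eq_zero_of_firstVars r 0 (by omega)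
  · exact Or.inr (top_eq_zero I hI)

end TopVanishing

end GradedLC

namespace GradedLC

open MvPolynomial

/-! ### The grading of a quotient by a homogeneous ideal -/

section PolynomialGrading

variable {A : Type*} [CommRing A] {n : ℕ}

/-- The homogeneous component of degree `μ`, zero for negative `μ`. -/
noncomputable def compZ (μ : ℤ) : MvPolynomial (Fin n) A →ₗ[A] MvPolynomial (Fin n) A :=
  if 0 ≤ μ then homogeneousComponent μ.toNat else 0

theorem coeff_compZ (μ : ℤ) (f : MvPolynomial (Fin n) A) (d : Fin n →₀ ℕ) :
    coeff d (compZ μ f) = if ((d.degree : ℕ) : ℤ) = μ then coeff d f else 0 := by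
  rw [compZ]
  split_ifs with h h' h'
  · rw [coeff_homogeneousComponent, if_pos (by omega)]
  · rw [coeff_homogeneousComponent, if_neg (by omega)]
  · omega
  · simp

theorem compZ_natCast (d : ℕ) (f : MvPolynomial (Fin n) A) :
    compZ (d : ℤ) f = homogeneousComponent d f := by
  rw [compZ, if_pos (by omega), Int.toNat_natCast]

theorem compZ_X_smul (μ : ℤ) (j : Fin n) (f : MvPolynomial (Fin n) A) :
    compZ (μ + 1) ((X j : MvPolynomial (Fin n) A) • f) = (X j : MvPolynomial (Fin n) A) • compZ μ f := by
  ext d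
  rw [smul_eq_mul, smul_eq_mul, coeff_compZ, coeff_X_mul', coeff_X_mul', coeff_compZ]
  by_cases hj : j ∈ d.support
  · obtain ⟨d', rfl⟩ : ∃ d', d = d' + Finsupp.single j 1 :=
      ⟨d - Finsupp.single j 1, (tsub_add_cancel_of_le (by
        rw [Finsupp.single_le_iff]
        have := Finsupp.mem_support_iff.1 hj
        omega)).symm⟩
    simp only [hj, if_true, add_tsub_cancel_right, map_add, Finsupp.degree_single]
    congr 1
    push_cast
    simp
  · simp [hj]

variable (A n) in
/-- The standard grading of the polynomial ring. -/
noncomputable def polyGrading : Grading A n (MvPolynomial (Fin n) A) where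
  toFun μ := (compZ μ).toAddMonoidHom
  map_X_smul μ j f := compZ_X_smul μ j f
  map_smul μ a f := map_smul (compZ μ) a f
  idem μ f := by
    ext d
    simp only [LinearMap.toAddMonoidHom_coe, coeff_compZ]
    split_ifs <;> rfl
  bdd f := by
    refine ⟨f.totalDegree + 1, fun ν hν => ?_⟩
    obtain ⟨e, rfl⟩ := Int.eq_ofNat_of_zero_le (show 0 ≤ ν by omega)
    exact (compZ_natCast e f).trans (homogeneousComponent_eq_zero _ _ (by omega))

section

attribute [local instance] MvPolynomial.gradedAlgebra

theorem compZ_mem {I : Ideal (MvPolynomial (Fin n) A)}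
    (hI : I.IsHomogeneous (homogeneousSubmodule (Fin n) A)) (μ : ℤ) (f : MvPolynomial (Fin n) A)
    (hf : f ∈ I) : compZ μ f ∈ I := by
  rw [compZ]
  split_ifs
  · exact homogeneousComponent_mem_of_mem hI hf _
  · exact zero_mem _

/-- The grading of the quotient by a homogeneous ideal. -/
noncomputable def quotPr (I : Ideal (MvPolynomial (Fin n) A))
    (hI : I.IsHomogeneous (homogeneousSubmodule (Fin n) A)) :
    Grading A n (MvPolynomial (Fin n) A ⧸ I) :=
  (polyGrading A n).quot I (compZ_mem hI)

variable {I : Ideal (MvPolynomial (Fin n) A)}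
  (hI : I.IsHomogeneous (homogeneousSubmodule (Fin n) A))

theorem quotPr_mk (μ : ℤ) (f : MvPolynomial (Fin n) A) :
    (quotPr I hI).toFun μ (Ideal.Quotient.mk I f) = Ideal.Quotient.mk I (compZ μ f) := rfl

theorem quotPr_mem (d : ℕ) (m : MvPolynomial (Fin n) A ⧸ I) :
    (quotPr I hI).toFun d m ∈ quotGrading I d := by
  obtain ⟨f, rfl⟩ := Ideal.Quotient.mk_surjective m
  rw [quotPr_mk, compZ_natCast]
  exact ⟨_, homogeneousComponent_mem _ _, rfl⟩

theorem quotPr_eq_zero {μ : ℤ} (hμ : μ < 0) (m : MvPolynomial (Fin n) A ⧸ I) :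
    (quotPr I hI).toFun μ m = 0 := by
  obtain ⟨f, rfl⟩ := Ideal.Quotient.mk_surjective m
  rw [quotPr_mk, compZ, if_neg (by omega), LinearMap.zero_apply, map_zero]

theorem quotPr_of_mem {d : ℕ} {m : MvPolynomial (Fin n) A ⧸ I} (hm : m ∈ quotGrading I d) (μ : ℤ) :
    (quotPr I hI).toFun μ m = if μ = d then m else 0 := by
  obtain ⟨f, hf, rfl⟩ := hm
  change (quotPr I hI).toFun μ (Ideal.Quotient.mk I f) = if μ = d then Ideal.Quotient.mk I f else 0
  split_ifs with h
  · rw [quotPr_mk, h, compZ_natCast, homogeneousComponent_of_mem hf, if_pos rfl]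
  · rcases lt_or_ge μ 0 with h0 | h0
    · exact quotPr_eq_zero hI h0 _
    · obtain ⟨e, rfl⟩ := Int.eq_ofNat_of_zero_le h0
      rw [quotPr_mk, compZ_natCast, homogeneousComponent_of_mem hf, if_neg, map_zero]
      rintro rfl
      exact h rfl

theorem quotGrading_le_span {m : MvPolynomial (Fin n) A ⧸ I} (hm : m ∈ quotGrading I 1) :
    m ∈ Ideal.span (Set.range fun j => Ideal.Quotient.mk I (X j)) := by
  obtain ⟨f, hf, rfl⟩ := hm
  rw [SetLike.mem_coe, homogeneousSubmodule_one_eq_span_X] at hf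
  have : Ideal.Quotient.mk I f ∈ Ideal.map (Ideal.Quotient.mk I)
      (Ideal.span (Set.range (X : Fin n → MvPolynomial (Fin n) A))) :=
    Ideal.mem_map_of_mem _ (Submodule.span_le_restrictScalars A _ _ hf)
  rwa [Ideal.map_span, ← Set.range_comp] at this

theorem mk_X_mem_quotGrading (j : Fin n) : Ideal.Quotient.mk I (X j) ∈ quotGrading I 1 :=
  ⟨X j, isHomogeneous_X A j, rfl⟩

theorem quotGrading_mul {d e : ℕ} {a b : MvPolynomial (Fin n) A ⧸ I} (ha : a ∈ quotGrading I d)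
    (hb : b ∈ quotGrading I e) : a * b ∈ quotGrading I (d + e) := by
  obtain ⟨f, hf, rfl⟩ := ha
  obtain ⟨g, hg, rfl⟩ := hb
  exact ⟨f * g, IsHomogeneous.mul hf hg, map_mul (Ideal.Quotient.mk I) _ _⟩

/-- The ring is spanned by the graded pieces. -/
theorem quotGrading_induction {P : (MvPolynomial (Fin n) A ⧸ I) → Prop}
    (h0 : P 0) (hadd : ∀ a b, P a → P b → P (a + b)) (hd : ∀ d, ∀ a ∈ quotGrading I d, P a)
    (a : MvPolynomial (Fin n) A ⧸ I) : P a := by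
  obtain ⟨f, rfl⟩ := Ideal.Quotient.mk_surjective a
  rw [← sum_homogeneousComponent f, map_sum]
  refine Finset.sum_induction _ P hadd h0 fun d _ => hd d _ ⟨_, homogeneousComponent_mem _ _, rfl⟩

theorem quotPr_mul {b : MvPolynomial (Fin n) A ⧸ I} (hb : b ∈ quotGrading I 1) (μ : ℤ)
    (m : MvPolynomial (Fin n) A ⧸ I) :
    (quotPr I hI).toFun (μ + 1) (b * m) = b * (quotPr I hI).toFun μ m := by
  induction m using quotGrading_induction with
  | h0 => simp
  | hadd m m' h h' => rw [mul_add, map_add, h, h', map_add, mul_add]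
  | hd d m hm =>
    rw [quotPr_of_mem hI hm, quotPr_of_mem hI (quotGrading_mul hb hm)]
    by_cases h : μ = d
    · rw [if_pos h, if_pos (by push_cast; omega)]
    · rw [if_neg h, if_neg (by push_cast; omega), mul_zero]

end

end PolynomialGrading

/-! ### Graded pieces of cohomology as fixed points of projections -/

section Pieces

variable {k : Type*} [Field k] {n : ℕ} {I : Ideal (MvPolynomial (Fin n) k)}

attribute [local instance] MvPolynomial.gradedAlgebra

variable (hI : I.IsHomogeneous (homogeneousSubmodule (Fin n) k))

theorem isHomogeneous_coe {s : Finset (Fin n)} (u : varMonoid k s) :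
    (u : MvPolynomial (Fin n) k).IsHomogeneous (expo u).degree := by
  rw [coe_eq_monomial u]
  exact isHomogeneous_monomial _ rfl

theorem locMap_of_mem_locPiece {s : Finset (Fin n)} {ν : ℤ}
    {z : Loc k (MvPolynomial (Fin n) k ⧸ I) s} (hz : z ∈ locPiece n (quotGrading I) s ν) :
    (quotPr I hI).toShiftHom.locMap ν s z = z := by
  induction hz using Submodule.span_induction with
  | mem z hz =>
    obtain ⟨d, e, m, u, hm, hu, hν, rfl⟩ := hz
    have he : e = (expo u).degree := hu.inj_right (isHomogeneous_coe u) (by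
      rw [coe_eq_monomial u]
      exact monomial_eq_zero.not.2 one_ne_zero)
    have hd : ν + mdeg u = d := by
      rw [mdeg, ← he]
      omega
    rw [ShiftHom.locMap_mk, tr_self, hd]
    exact congrArg (LocalizedModule.mk · u) ((quotPr_of_mem hI hm d).trans (if_pos rfl))
  | zero => exact map_zero _
  | add x y _ _ hx hy => rw [map_add, hx, hy]
  | smul a x _ hx =>
    nth_rw 2 [← hx]
    induction x using LocalizedModule.induction_on with | _ m u
    rw [ShiftHom.locMap_mk, LocalizedModule.smul'_mk, LocalizedModule.smul'_mk, ShiftHom.locMap_mk]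
    exact congrArg (LocalizedModule.mk · _) ((quotPr I hI).map_smul _ a m)

theorem locMap_mem_locPiece {s : Finset (Fin n)} (ν : ℤ)
    (z : Loc k (MvPolynomial (Fin n) k ⧸ I) s) :
    (quotPr I hI).toShiftHom.locMap ν s z ∈ locPiece n (quotGrading I) s ν := by
  induction z using LocalizedModule.induction_on with | _ m u
  rw [ShiftHom.locMap_mk, tr_self]
  rcases lt_or_ge (ν + mdeg u) 0 with h | h
  · have h0 : (quotPr I hI).toShiftHom (ν + mdeg u) m = 0 := quotPr_eq_zero hI h m
    rw [h0, LocalizedModule.zero_mk]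
    exact zero_mem _
  · obtain ⟨d, hd⟩ := Int.eq_ofNat_of_zero_le h
    refine Submodule.subset_span ⟨d, (expo u).degree, _, u, ?_, isHomogeneous_coe u, ?_, rfl⟩
    · rw [hd]
      exact quotPr_mem hI d m
    · change ν + ((expo u).degree : ℕ) = d at hd
      omega

/-- The projection fixes fractions that are homogeneous of degree ν and sends every fraction to such
a one. Statements about pieces thereby become statements about an idempotent that commutes with the
maps of the long exact sequences. -/
theorem mem_piece_iff {p : ℕ} {ν : ℤ} (z : H k n (MvPolynomial (Fin n) k ⧸ I) p) :
    z ∈ piece n (quotGrading I) p ν ↔ (quotPr I hI).Hmap ν p z = z := by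
  constructor
  · rintro ⟨⟨c, hc⟩, hcp, rfl⟩
    have hc' : cechD k n (MvPolynomial (Fin n) k ⧸ I) p c = 0 := hc
    change (quotPr I hI).Hmap ν p (cls c hc') = cls c hc'
    rw [ShiftHom.Hmap_cls]
    refine cls_congr (funext fun s => ?_) _
    exact locMap_of_mem_locPiece hI (hcp s trivial)
  · intro h
    rw [← h]
    obtain ⟨c, hc, rfl⟩ := cls_surjective z
    rw [ShiftHom.Hmap_cls]
    exact ⟨⟨_, _⟩, fun s _ => locMap_mem_locPiece hI ν (c s), rfl⟩

end Pieces

end GradedLC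

namespace GradedLC

open MvPolynomial

/-! ### Changing coefficients and variables -/

section Comparison

variable {A : Type*} [CommRing A] [Nontrivial A] {B : Type*} [CommRing B] {n : ℕ} {M : Type*}
  [AddCommGroup M] [Module (MvPolynomial (Fin n) A) M] [Module B M] (x : Fin n → B)
  (hx : ∀ j (m : M), (X j : MvPolynomial (Fin n) A) • m = x j • m)

/-- The identity of `M`, from the structure of `ℤ[x_0, …, x_{n-1}]`-module. -/
noncomputable def fromTw : ShiftHom ℤ A n (Tw x M) M :=
  ShiftHom.const (toTw x M).symm.toAddMonoidHom fun j m =>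
    (congrArg (toTw x M).symm (X_smul_Tw x j m)).trans (hx j _).symm

/-- The identity of `M`, to the structure of `ℤ[x_0, …, x_{n-1}]`-module. -/
noncomputable def intoTw : ShiftHom A ℤ n M (Tw x M) :=
  ShiftHom.const (toTw x M).toAddMonoidHom fun j m =>
    (congrArg (toTw x M) (hx j m)).trans (X_smul_toTw x j m).symm

/-- Only the action of the variables matters for local cohomology. -/
noncomputable def twEquiv (p : ℕ) : H ℤ n (Tw x M) p ≃+ H A n M p where
  toFun := (fromTw x hx).Hmap 0 p
  invFun := (intoTw x hx).Hmap 0 p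
  left_inv z := by
    rw [← ShiftHom.Hmap_comp]
    exact ShiftHom.Hmap_id (fun _ _ => rfl) p z
  right_inv z := by
    rw [← ShiftHom.Hmap_comp]
    exact ShiftHom.Hmap_id (fun _ _ => rfl) p z
  map_add' := map_add _

theorem twEquiv_apply (p : ℕ) (z : H ℤ n (Tw x M) p) :
    twEquiv x hx p z = (fromTw x hx).Hmap 0 p z := rfl

theorem twEquiv_Hmap {p : ℕ} (φ : ShiftHom ℤ ℤ n (Tw x M) (Tw x M)) (ψ : ShiftHom A A n M M)
    (h : ∀ μ m, φ μ (toTw x M m) = toTw x M (ψ μ m)) (μ : ℤ) (z : H ℤ n (Tw x M) p) :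
    twEquiv x hx p (φ.Hmap μ p z) = ψ.Hmap μ p (twEquiv x hx p z) := by
  rw [twEquiv_apply, twEquiv_apply]
  exact ShiftHom.Hmap_comm (fun d m => congrArg (toTw x M).symm (h _ ((toTw x M).symm m))) p z

/-- The local cohomology with respect to elements generating the same ideal as the variables. -/
theorem exists_comparison
    (hx : ∀ j (m : M), (X j : MvPolynomial (Fin n) A) • m = x j • m) (w : Fin n → B) (h : ∀ j, w j ∈ Ideal.span (Set.range x))
    (h' : ∀ j, x j ∈ Ideal.span (Set.range w)) (p : ℕ) :
    ∃ E : H ℤ n (Tw w M) p ≃+ H A n M p, ∀ (φ : BiShift w x M M) (ψ : ShiftHom A A n M M),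
      (∀ μ m, φ.toFun μ m = ψ μ m) → ∀ μ z, E (φ.fst.Hmap μ p z) = ψ.Hmap μ p (E z) := by
  obtain ⟨e, he⟩ := exists_equiv h h' p M
  refine ⟨e.trans (twEquiv _ hx p), fun φ ψ hφ μ z => ?_⟩
  rw [AddEquiv.trans_apply, AddEquiv.trans_apply, he]
  exact twEquiv_Hmap x hx φ.snd ψ (fun μ m => congrArg (toTw x M) (hφ μ m)) μ _

theorem C_smul_id_apply [Module A M] [IsScalarTower A (MvPolynomial (Fin n) A) M] (a : A) (m : M) :
    ((C a : MvPolynomial (Fin n) A) • (LinearMap.id : M →ₗ[MvPolynomial (Fin n) A] M)).toAddMonoidHom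
      m = a • m :=
  C_smul' a m

end Comparison

/-! ### The long exact sequence of a fiber -/

section Specialization

attribute [local instance] MvPolynomial.gradedAlgebra

variable {A k : Type*} [CommRing A] [Nontrivial A] [CommRing k] [Nontrivial k] {n : ℕ}
  {J : Ideal (MvPolynomial (Fin n) A)} {I : Ideal (MvPolynomial (Fin n) k)}
  (hJ : J.IsHomogeneous (homogeneousSubmodule (Fin n) A))
  (hI : I.IsHomogeneous (homogeneousSubmodule (Fin n) k))

/-- A graded ring `R / I`, presented as the quotient of `S / J` by a nonzerodivisor `a` of `A`. -/
structure IsSpecialization (a : A)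
    (θ : (MvPolynomial (Fin n) A ⧸ J) →+* (MvPolynomial (Fin n) k ⧸ I)) : Prop where
  surj : Function.Surjective θ
  map_smul_eq_zero : ∀ m, θ (a • m) = 0
  ker : ∀ m, θ m = 0 → ∃ m', a • m' = m
  inj : ∀ m : MvPolynomial (Fin n) A ⧸ J, a • m = 0 → m = 0
  graded : ∀ μ m, θ ((quotPr J hJ).toFun μ m) = (quotPr I hI).toFun μ (θ m)

/-- The long exact sequence of a specialization. -/
structure SpecSeq (a : A)
    (θ : (MvPolynomial (Fin n) A ⧸ J) →+* (MvPolynomial (Fin n) k ⧸ I)) where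
  /-- The specialization map. -/
  T : ∀ p, H A n (MvPolynomial (Fin n) A ⧸ J) p →+ H k n (MvPolynomial (Fin n) k ⧸ I) p
  /-- The connecting map. -/
  δ : ∀ p, H k n (MvPolynomial (Fin n) k ⧸ I) p →+ H A n (MvPolynomial (Fin n) A ⧸ J) (p + 1)
  T_smul : ∀ p z, T p (a • z) = 0
  exact_T : ∀ p z, T p z = 0 → ∃ w, a • w = z
  exact_δ : ∀ p y, δ p y = 0 → ∃ z, T p z = y
  smul_δ : ∀ p y, a • δ p y = 0
  exact_smul : ∀ p (z : H A n (MvPolynomial (Fin n) A ⧸ J) (p + 1)), a • z = 0 → ∃ y, δ p y = z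
  smul_zero : ∀ z : H A n (MvPolynomial (Fin n) A ⧸ J) 0, a • z = 0 → z = 0
  T_poly : ∀ p (g : MvPolynomial (Fin n) A) (r : MvPolynomial (Fin n) k),
    θ (Ideal.Quotient.mk J g) = Ideal.Quotient.mk I r → ∀ z, T p (g • z) = r • T p z
  δ_poly : ∀ p (g : MvPolynomial (Fin n) A) (r : MvPolynomial (Fin n) k),
    θ (Ideal.Quotient.mk J g) = Ideal.Quotient.mk I r → ∀ y, δ p (r • y) = g • δ p y
  T_graded : ∀ p ν z, T p ((quotPr J hJ).Hmap ν p z) = (quotPr I hI).Hmap ν p (T p z)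
  δ_graded : ∀ p ν y, δ p ((quotPr I hI).Hmap ν p y) = (quotPr J hJ).Hmap ν (p + 1) (δ p y)

namespace IsSpecialization

variable {hJ hI} {a : A} {θ : (MvPolynomial (Fin n) A ⧸ J) →+* (MvPolynomial (Fin n) k ⧸ I)}
  (hθ : IsSpecialization hJ hI a θ)

include hθ

theorem map_X_mem (j : Fin n) : θ (Ideal.Quotient.mk J (X j)) ∈ quotGrading I 1 := by
  have := quotPr_mem hI 1 (θ (Ideal.Quotient.mk J (X j)))
  rwa [← hθ.graded, quotPr_of_mem hJ (mk_X_mem_quotGrading j), if_pos rfl] at this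

theorem map_X_mem_span (j : Fin n) : θ (Ideal.Quotient.mk J (X j)) ∈
    Ideal.span (Set.range fun j => Ideal.Quotient.mk I (X j)) :=
  quotGrading_le_span (hθ.map_X_mem j)

/-- Lift the variable through θ and keep the component of degree one, which is a linear form in the
variables of S/J. -/
theorem X_mem_span (j : Fin n) : Ideal.Quotient.mk I (X j) ∈
    Ideal.span (Set.range fun j => θ (Ideal.Quotient.mk J (X j))) := by
  obtain ⟨m, hm⟩ := hθ.surj (Ideal.Quotient.mk I (X j))
  have h1 : θ ((quotPr J hJ).toFun (1 : ℕ) m) = Ideal.Quotient.mk I (X j) := by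
    rw [hθ.graded, hm, quotPr_of_mem hI (mk_X_mem_quotGrading j), if_pos rfl]
  rw [← h1]
  have := Ideal.mem_map_of_mem θ (quotGrading_le_span (quotPr_mem hJ 1 m))
  rwa [Ideal.map_span, ← Set.range_comp] at this

/-- The variables of S act on R/I through their images under θ, which are linear forms but not
necessarily the variables of R. Hence the twisted structure on the right-hand term. -/
theorem weakSES : WeakSES A A ℤ n
    ((C a : MvPolynomial (Fin n) A) • (LinearMap.id : (MvPolynomial (Fin n) A ⧸ J) →ₗ[
      MvPolynomial (Fin n) A] (MvPolynomial (Fin n) A ⧸ J))).toAddMonoidHom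
    ((toTw (fun j => θ (Ideal.Quotient.mk J (X j))) (MvPolynomial (Fin n) k ⧸ I)).toAddMonoidHom.comp
      θ.toAddMonoidHom) where
  map_X_left j m := smul_comm (C a : MvPolynomial (Fin n) A) (X j : MvPolynomial (Fin n) A) m
  map_X_right j m := (congrArg (toTw _ _) (map_mul θ (Ideal.Quotient.mk J (X j)) m)).trans
    (X_smul_toTw _ j _).symm
  torsion m hm j := ⟨0, by
    rw [pow_zero, one_smul]
    rw [C_smul_id_apply] at hm
    exact hθ.inj m hm⟩
  comp_zero m := by
    rw [C_smul_id_apply]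
    exact hθ.map_smul_eq_zero m
  exact m hm := by
    obtain ⟨m', hm'⟩ := hθ.ker m hm
    exact ⟨m', (C_smul_id_apply a m').trans hm'⟩
  surj := hθ.surj

theorem left_Hmap (p : ℕ) (z : H A n (MvPolynomial (Fin n) A ⧸ J) p) :
    hθ.weakSES.left.Hmap 0 p z = a • z := by
  rw [← C_smul_H]
  exact ShiftHom.Hmap_ofLinear_smul (C a) 0 p z

theorem right_smul (p : ℕ) {g : MvPolynomial (Fin n) A} {r : MvPolynomial (Fin n) k}
    (h : θ (Ideal.Quotient.mk J g) = Ideal.Quotient.mk I r)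
    (z : H A n (MvPolynomial (Fin n) A ⧸ J) p) :
    hθ.weakSES.right.Hmap 0 p (g • z) = (mulTw (fun j => θ (Ideal.Quotient.mk J (X j)))
      (MvPolynomial (Fin n) k ⧸ I) (Ideal.Quotient.mk I r)).Hmap 0 p
        (hθ.weakSES.right.Hmap 0 p z) := by
  rw [← ShiftHom.Hmap_ofLinear_smul g 0]
  refine ShiftHom.Hmap_comm (fun d m => ?_) p z
  exact (map_mul θ (Ideal.Quotient.mk J g) m).trans (congrArg (· * θ m) h)

theorem delta_smul (p : ℕ) {g : MvPolynomial (Fin n) A} {r : MvPolynomial (Fin n) k}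
    (h : θ (Ideal.Quotient.mk J g) = Ideal.Quotient.mk I r)
    (y : H ℤ n (Tw (fun j => θ (Ideal.Quotient.mk J (X j))) (MvPolynomial (Fin n) k ⧸ I)) p) :
    hθ.weakSES.delta p ((mulTw (fun j => θ (Ideal.Quotient.mk J (X j)))
      (MvPolynomial (Fin n) k ⧸ I) (Ideal.Quotient.mk I r)).Hmap 0 p y) =
        g • hθ.weakSES.delta p y := by
  rw [← ShiftHom.Hmap_ofLinear_smul g 0]
  refine hθ.weakSES.delta_natural hθ.weakSES (β := ShiftHom.ofLinear (g • LinearMap.id)) 0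
    (fun d m => ?_) (fun d m => ?_) p _
  · exact smul_comm g (C a : MvPolynomial (Fin n) A) m
  · exact (congrArg (· * θ m) h).symm.trans (map_mul θ (Ideal.Quotient.mk J g) m).symm

/-- The grading of `R / I`, with respect to the images of the variables of `S` as well. -/
noncomputable def grBi : BiShift (fun j => θ (Ideal.Quotient.mk J (X j)))
    (fun j => Ideal.Quotient.mk I (X j)) (MvPolynomial (Fin n) k ⧸ I)
    (MvPolynomial (Fin n) k ⧸ I) where
  toFun := (quotPr I hI).toFun
  map_left μ j m := quotPr_mul hI (hθ.map_X_mem j) μ m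
  map_right μ j m := quotPr_mul hI (mk_X_mem_quotGrading j) μ m

theorem right_graded (p : ℕ) (ν : ℤ) (z : H A n (MvPolynomial (Fin n) A ⧸ J) p) :
    hθ.weakSES.right.Hmap 0 p ((quotPr J hJ).Hmap ν p z) =
      hθ.grBi.fst.Hmap ν p (hθ.weakSES.right.Hmap 0 p z) :=
  ShiftHom.Hmap_comm (fun d m => by rw [zero_add]; exact hθ.graded _ m) p z

theorem delta_graded (p : ℕ) (ν : ℤ)
    (y : H ℤ n (Tw (fun j => θ (Ideal.Quotient.mk J (X j))) (MvPolynomial (Fin n) k ⧸ I)) p) :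
    hθ.weakSES.delta p (hθ.grBi.fst.Hmap ν p y) =
      (quotPr J hJ).Hmap ν (p + 1) (hθ.weakSES.delta p y) := by
  refine hθ.weakSES.delta_natural hθ.weakSES (β := (quotPr J hJ).toShiftHom) ν
    (fun d m => ?_) (fun d m => ?_) p _
  · rw [C_smul_id_apply, C_smul_id_apply]
    exact (quotPr J hJ).map_smul d a m
  · exact (hθ.graded d m).symm

set_option maxHeartbeats 1000000 in
-- The sequence of `weakSES` computes the cohomology of R/I with the elements θ(x_j). The comparison
-- isomorphism `E` carries it over to the variables of R; its compatibility with all `BiShift`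
-- families carries over both the R-action and the grading.
theorem exists_specSeq : Nonempty (SpecSeq hJ hI a θ) := by
  have hC := exists_comparison (A := k) (M := MvPolynomial (Fin n) k ⧸ I)
    (fun j => Ideal.Quotient.mk I (X j)) (fun _ _ => rfl)
    (fun j => θ (Ideal.Quotient.mk J (X j))) hθ.map_X_mem_span hθ.X_mem_span
  choose E hEφ using hC
  have hE : ∀ p (r : MvPolynomial (Fin n) k) z,
      E p ((mulTw _ _ (Ideal.Quotient.mk I r)).Hmap 0 p z) = r • E p z := by
    intro p r z
    rw [← ShiftHom.Hmap_ofLinear_smul r 0]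
    exact hEφ p (mulBi _ _ _ (Ideal.Quotient.mk I r)) _ (fun _ _ => rfl) 0 z
  have hG : ∀ p ν z, E p (hθ.grBi.fst.Hmap ν p z) = (quotPr I hI).Hmap ν p (E p z) :=
    fun p ν z => hEφ p hθ.grBi (quotPr I hI).toShiftHom (fun _ _ => rfl) ν z
  clear hEφ
  obtain ⟨T, hT⟩ : ∃ T : ∀ p, H A n (MvPolynomial (Fin n) A ⧸ J) p →+
      H k n (MvPolynomial (Fin n) k ⧸ I) p, ∀ p z, T p z = E p (hθ.weakSES.right.Hmap 0 p z) :=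
    ⟨fun p => (E p).toAddMonoidHom.comp (hθ.weakSES.right.Hmap 0 p), fun _ _ => rfl⟩
  obtain ⟨δ, hδ⟩ : ∃ δ : ∀ p, H k n (MvPolynomial (Fin n) k ⧸ I) p →+
      H A n (MvPolynomial (Fin n) A ⧸ J) (p + 1), ∀ p z, δ p (E p z) = hθ.weakSES.delta p z :=
    ⟨fun p => (hθ.weakSES.delta p).comp (E p).symm.toAddMonoidHom,
      fun p z => congrArg (hθ.weakSES.delta p) ((E p).symm_apply_apply z)⟩
  exact ⟨{
    T := T
    δ := δ
    T_smul := fun p z => by rw [hT, ← hθ.left_Hmap, WeakSES.Hmap_comp_zero, map_zero]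
    exact_T := fun p z hz => by
      rw [hT, AddEquiv.map_eq_zero_iff] at hz
      obtain ⟨w, hw⟩ := hθ.weakSES.exact_middle z hz
      exact ⟨w, by rw [← hθ.left_Hmap, hw]⟩
    exact_δ := fun p y hy => by
      obtain ⟨y, rfl⟩ := (E p).surjective y
      rw [hδ] at hy
      obtain ⟨z, hz⟩ := hθ.weakSES.exact_right _ hy
      exact ⟨z, (hT p z).trans (congrArg (E p) hz)⟩
    smul_δ := fun p y => by
      obtain ⟨y, rfl⟩ := (E p).surjective y
      rw [hδ, ← hθ.left_Hmap, WeakSES.Hmap_delta]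
    exact_smul := fun p z hz => by
      rw [← hθ.left_Hmap] at hz
      obtain ⟨y, hy⟩ := hθ.weakSES.exact_left z hz
      exact ⟨E p y, (hδ p y).trans hy⟩
    smul_zero := fun z hz => by
      rw [← hθ.left_Hmap] at hz
      refine hθ.weakSES.exact_left_zero ?_ z hz
      rw [injective_iff_map_eq_zero]
      intro m hm
      rw [C_smul_id_apply] at hm
      exact hθ.inj m hm
    T_poly := fun p g r h z => by rw [hT, hT, hθ.right_smul p h, hE]
    δ_poly := fun p g r h y => by
      obtain ⟨y, rfl⟩ := (E p).surjective y
      rw [← hE, hδ, hδ, hθ.delta_smul p h]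
    T_graded := fun p ν z => by rw [hT, hT, hθ.right_graded, hG]
    δ_graded := fun p ν y => by
      obtain ⟨y, rfl⟩ := (E p).surjective y
      rw [← hG, hδ, hδ, hθ.delta_graded] }⟩

end IsSpecialization

end Specialization

end GradedLC

namespace GradedLC

open MvPolynomial

/-! ### Classes that die after inverting a scalar -/

section Torsion

variable {A A' : Type*} [CommRing A] [Nontrivial A] [CommRing A'] [Nontrivial A'] {n : ℕ}
  {M : Type*} [AddCommGroup M] [Module (MvPolynomial (Fin n) A) M] [Module A M]
  [IsScalarTower A (MvPolynomial (Fin n) A) M]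
  {N : Type*} [AddCommGroup N] [Module (MvPolynomial (Fin n) A') N]

theorem ShiftHom.cochainMap_injective {φ : ShiftHom A A' n M N}
    (hφ : ∀ μ m, φ μ m = 0 → m = 0) {p : ℕ} (c : Cochain A n M p) (hc : φ.cochainMap 0 p c = 0) :
    c = 0 := by
  ext s : 1
  have h := congrFun hc s
  rw [cochainMap_apply] at h
  generalize c s = z at h
  induction z using LocalizedModule.induction_on with | _ m u
  rw [locMap_mk, Pi.zero_apply, mk_eq_zero_iff] at h
  obtain ⟨v, hv⟩ := h
  refine (mk_eq_zero_iff _ _).2 ⟨tr A v, hφ (0 + mdeg u + mdeg v) _ ?_⟩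
  rw [← mdeg_tr A v, φ.map_smul, tr_tr, tr_self, hv]

/-- If `N` is a union of translates `a⁻ᵉ M`, the kernel on local cohomology consists of elements
killed by powers of `a`. -/
theorem exists_pow_smul_eq_zero_of_Hmap (a : A) (φ : ShiftHom A A' n M N)
    (hφ : ∀ μ m, φ μ m = 0 → m = 0)
    (τ : ℕ → ShiftHom A' A' n N N)
    (hτ : ∀ μ v, ∃ e₀, ∀ e ≥ e₀, ∃ m, φ μ m = τ e μ v)
    (hφτ : ∀ e μ m, φ μ (a ^ e • m) = τ e μ (φ μ m)) {p : ℕ} (z : H A n M p)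
    (hz : φ.Hmap 0 p z = 0) : ∃ e : ℕ, a ^ e • z = 0 := by
  obtain ⟨c, hc, rfl⟩ := cls_surjective z
  rw [ShiftHom.Hmap_cls, cls_eq_zero_iff] at hz
  have key : ∀ e, φ.cochainMap 0 p ((C (a ^ e) : MvPolynomial (Fin n) A) • c) = (τ e).cochainMap 0 p (φ.cochainMap 0 p c) := by
    intro e
    ext s : 1
    rw [ShiftHom.cochainMap_apply, ShiftHom.cochainMap_apply, ShiftHom.cochainMap_apply,
      Pi.smul_apply]
    generalize c s = z
    induction z using LocalizedModule.induction_on with | _ m u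
    rw [ShiftHom.locMap_mk, ShiftHom.locMap_mk, LocalizedModule.smul'_mk, ShiftHom.locMap_mk,
      C_smul', hφτ, mdeg_tr, tr_tr]
  have hcls : ∀ e, (C (a ^ e) : MvPolynomial (Fin n) A) • c ∈ coboundaries A n M p → a ^ e • cls c hc = 0 := by
    intro e he
    rw [← C_smul_H, cls_smul, cls_eq_zero_iff]
    exact he
  cases p with
  | zero =>
    rw [mem_coboundaries_zero] at hz
    have : c = 0 := φ.cochainMap_injective hφ c hz
    refine ⟨0, hcls 0 ?_⟩
    rw [this, smul_zero]
    exact zero_mem _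
  | succ p =>
    -- The bounding cochain b has values in N. A common power of a, with the sum of the individual
    -- exponents, moves all its components into M, and injectivity of φ pulls the equation back to
    -- M.
    obtain ⟨b, hb⟩ := mem_coboundaries_succ.1 hz
    have h1 : ∀ s : {s : Finset (Fin n) // s.card = p}, ∃ e₀ : ℕ, ∀ e ≥ e₀, ∃ b' : Loc A M s.1,
        φ.locMap 0 s.1 b' = (τ e).locMap 0 s.1 (b s) := by
      intro s
      generalize b s = z
      induction z using LocalizedModule.induction_on with | _ v u
      obtain ⟨e₀, h⟩ := hτ (0 + mdeg u) v
      refine ⟨e₀, fun e he => ?_⟩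
      obtain ⟨m, hm⟩ := h e he
      refine ⟨LocalizedModule.mk m (tr A u), ?_⟩
      rw [ShiftHom.locMap_mk, ShiftHom.locMap_mk, mdeg_tr, hm, tr_tr]
    choose e₀ h1 using h1
    choose b' hb' using fun s => h1 s (∑ s, e₀ s)
      (Finset.single_le_sum (f := e₀) (fun _ _ => Nat.zero_le _) (Finset.mem_univ s))
    refine ⟨∑ s, e₀ s, hcls _ (mem_coboundaries_succ.2 ⟨b', ?_⟩)⟩
    rw [← sub_eq_zero]
    refine φ.cochainMap_injective hφ _ ?_
    have h2 : φ.cochainMap 0 p b' = (τ (∑ s, e₀ s)).cochainMap 0 p b := funext hb'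
    rw [map_sub, key, ← hb, ← ShiftHom.cechD_cochainMap, ← ShiftHom.cechD_cochainMap, h2, sub_self]

end Torsion

/-! ### The fiber over t = 0 -/

section Special

attribute [local instance] MvPolynomial.gradedAlgebra

theorem graded_of_map_mem {A k : Type*} [CommRing A] [CommRing k] {n : ℕ}
    {J : Ideal (MvPolynomial (Fin n) A)} {I : Ideal (MvPolynomial (Fin n) k)}
    (hJ : J.IsHomogeneous (homogeneousSubmodule (Fin n) A))
    (hI : I.IsHomogeneous (homogeneousSubmodule (Fin n) k))
    (θ : (MvPolynomial (Fin n) A ⧸ J) →+* (MvPolynomial (Fin n) k ⧸ I))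
    (h : ∀ d, ∀ m ∈ quotGrading J d, θ m ∈ quotGrading I d) (μ : ℤ)
    (m : MvPolynomial (Fin n) A ⧸ J) :
    θ ((quotPr J hJ).toFun μ m) = (quotPr I hI).toFun μ (θ m) := by
  induction m using quotGrading_induction with
  | h0 => simp
  | hadd m m' h h' => rw [map_add, map_add, h, h', map_add, map_add]
  | hd d m hm =>
    rw [quotPr_of_mem hJ hm, quotPr_of_mem hI (h d m hm), apply_ite θ, map_zero]

variable {k : Type*} [Field k] {n : ℕ} {J : Ideal (MvPolynomial (Fin n) k[X])}
  {I : Ideal (MvPolynomial (Fin n) k)}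
  (hJ : J.IsHomogeneous (homogeneousSubmodule (Fin n) k[X]))
  (hI : I.IsHomogeneous (homogeneousSubmodule (Fin n) k))
  (hflat : Module.Flat k[X] (MvPolynomial (Fin n) k[X] ⧸ J))

include hflat in
theorem eq_zero_of_smul_eq_zero {a : k[X]} (ha : a ≠ 0) (m : MvPolynomial (Fin n) k[X] ⧸ J)
    (hm : a • m = 0) : m = 0 :=
  (Module.Flat.isSMulRegular_of_nonZeroDivisors (M := MvPolynomial (Fin n) k[X] ⧸ J)
    (mem_nonZeroDivisors_of_ne_zero ha)) (hm.trans (smul_zero a).symm)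

include hflat in
-- Tensoring with k[t]/(t) is passing to the quotient by t, and flatness over the domain k[t] makes
-- t a nonzerodivisor. The map is m ↦ e⁻¹(1 ⊗ m).
theorem exists_isSpecialization_zero
    (e : (MvPolynomial (Fin n) k ⧸ I) ≃ₐ[k] ((k[X] ⧸ Ideal.span {(Polynomial.X : k[X])}) ⊗[k[X]]
      (MvPolynomial (Fin n) k[X] ⧸ J)))
    (he : ∀ d : ℕ, (quotGrading I d).map e.toLinearMap = ((quotGrading J d).baseChange
      (k[X] ⧸ Ideal.span {(Polynomial.X : k[X])})).restrictScalars k) :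
    ∃ θ, IsSpecialization hJ hI (Polynomial.X : k[X]) θ ∧
      ∀ c : k, θ (Ideal.Quotient.mk J (C (Polynomial.C c))) = Ideal.Quotient.mk I (C c) := by
  let Q := k[X] ⧸ Ideal.span {(Polynomial.X : k[X])}
  let ι : (MvPolynomial (Fin n) k[X] ⧸ J) →ₐ[k[X]] Q ⊗[k[X]] (MvPolynomial (Fin n) k[X] ⧸ J) :=
    Algebra.TensorProduct.includeRight
  have hι : ∀ m, ι m = (1 : Q) ⊗ₜ[k[X]] m := fun m => rfl
  have hιker : ∀ m, ι m = 0 ↔ ∃ m', (Polynomial.X : k[X]) • m' = m := by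
    intro m
    rw [← (TensorProduct.quotTensorEquivQuotSMul (MvPolynomial (Fin n) k[X] ⧸ J)
      (Ideal.span {(Polynomial.X : k[X])})).map_eq_zero_iff, hι]
    have h1 := TensorProduct.quotTensorEquivQuotSMul_mk_tmul
      (Ideal.span {(Polynomial.X : k[X])}) (1 : k[X]) m
    rw [map_one] at h1
    rw [h1, one_smul, Submodule.Quotient.mk_eq_zero, Submodule.ideal_span_singleton_smul,
      Submodule.mem_smul_pointwise_iff_exists]
    simp
  have hιsurj : Function.Surjective ι := by
    intro z
    induction z using TensorProduct.induction_on with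
    | zero => exact ⟨0, map_zero _⟩
    | tmul q m =>
      obtain ⟨a, rfl⟩ := Ideal.Quotient.mk_surjective q
      refine ⟨a • m, ?_⟩
      rw [hι, ← TensorProduct.smul_tmul]
      exact congrArg (· ⊗ₜ[k[X]] m) (Algebra.algebraMap_eq_smul_one a).symm
    | add x y hx hy =>
      obtain ⟨x, rfl⟩ := hx
      obtain ⟨y, rfl⟩ := hy
      exact ⟨x + y, map_add _ _ _⟩
  refine ⟨e.symm.toRingEquiv.toRingHom.comp ι.toRingHom, ⟨?_, ?_, ?_, ?_, ?_⟩, ?_⟩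
  · exact e.symm.surjective.comp hιsurj
  · intro m
    exact (congrArg e.symm ((hιker _).2 ⟨m, rfl⟩)).trans (map_zero e.symm)
  · intro m hm
    exact (hιker m).1 ((map_eq_zero_iff e.symm e.symm.injective).1 hm)
  · exact eq_zero_of_smul_eq_zero hflat Polynomial.X_ne_zero
  · refine graded_of_map_mem hJ hI _ fun d m hm => ?_
    have h1 : ι m ∈ ((quotGrading J d).baseChange Q).restrictScalars k :=
      Submodule.tmul_mem_baseChange_of_mem 1 hm
    rw [← he] at h1
    obtain ⟨y, hy, hym⟩ := h1
    have h2 : e.symm (ι m) = y := by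
      rw [← hym]
      exact e.symm_apply_apply y
    change e.symm (ι m) ∈ _
    rw [h2]
    exact hy
  · intro c
    change e.symm (ι (algebraMap k[X] _ (Polynomial.C c))) = algebraMap k _ c
    rw [AlgEquiv.symm_apply_eq, AlgEquiv.commutes, AlgHom.commutes]
    rfl

end Special

end GradedLC

namespace GradedLC

open MvPolynomial

/-! ### Evaluation at t = 1 -/

section EvalOne

variable {k : Type*} [Field k]

variable (k) in
/-- Evaluation of Laurent polynomials at `1`. -/
noncomputable def laurentEvalOne : k[T;T⁻¹] →ₐ[k] k :=
  { LaurentPolynomial.eval₂ (RingHom.id k) (1 : kˣ) with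
    commutes' := fun c => by
      rw [← LaurentPolynomial.C_eq_algebraMap]
      exact LaurentPolynomial.eval₂_C _ _ c }

theorem laurentEvalOne_C_mul_T (c : k) (n : ℤ) :
    laurentEvalOne k (LaurentPolynomial.C c * LaurentPolynomial.T n) = c := by
  refine (LaurentPolynomial.eval₂_C_mul_T (RingHom.id k) (1 : kˣ) c n).trans ?_
  simp

theorem laurentEvalOne_algebraMap (a : k[X]) :
    laurentEvalOne k (algebraMap k[X] k[T;T⁻¹] a) = a.eval 1 :=
  LaurentPolynomial.eval₂_toLaurent (RingHom.id k) (1 : kˣ) a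

/-- Write l = f / t^N. The polynomial f − f(1) t^N vanishes at 1, hence is divisible by t − 1. -/
theorem exists_eq_eval_add (l : k[T;T⁻¹]) : ∃ l' : k[T;T⁻¹],
    l = algebraMap k k[T;T⁻¹] (laurentEvalOne k l) +
      algebraMap k[X] k[T;T⁻¹] (Polynomial.X - 1) * l' := by
  obtain ⟨N, f, hf⟩ := LaurentPolynomial.exists_T_pow l
  have h1 : laurentEvalOne k l = f.eval 1 := by
    rw [← laurentEvalOne_algebraMap, LaurentPolynomial.algebraMap_eq_toLaurent, hf, map_mul]
    have := laurentEvalOne_C_mul_T (1 : k) N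
    rw [map_one, one_mul] at this
    rw [this, mul_one]
  have hroot : (f - Polynomial.C (f.eval 1) * Polynomial.X ^ N).IsRoot 1 := by
    simp [Polynomial.IsRoot]
  obtain ⟨q, hq⟩ := Polynomial.dvd_iff_isRoot.2 hroot
  have h2 : l * LaurentPolynomial.T N - algebraMap k k[T;T⁻¹] (laurentEvalOne k l) *
      LaurentPolynomial.T N = algebraMap k[X] k[T;T⁻¹] (Polynomial.X - 1) *
        algebraMap k[X] k[T;T⁻¹] q := by
    rw [← map_mul, ← Polynomial.C_1, ← hq, h1, ← hf, ← LaurentPolynomial.C_eq_algebraMap, map_sub,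
      map_mul, LaurentPolynomial.algebraMap_X_pow, LaurentPolynomial.algebraMap_eq_toLaurent,
      LaurentPolynomial.algebraMap_eq_toLaurent, Polynomial.toLaurent_C]
  refine ⟨algebraMap k[X] k[T;T⁻¹] q * LaurentPolynomial.T (-N), ?_⟩
  have h3 : (LaurentPolynomial.T N : k[T;T⁻¹]) * LaurentPolynomial.T (-N) = 1 := by
    rw [← LaurentPolynomial.T_add, add_neg_cancel, LaurentPolynomial.T_zero]
  linear_combination (LaurentPolynomial.T (-N)) * h2 -
    (l - algebraMap k k[T;T⁻¹] (laurentEvalOne k l)) * h3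

variable (k) (N : Type*) [CommRing N] [Algebra k N]

/-- Setting `t = 1` in `N[t, t⁻¹]`. -/
noncomputable def evalOne : k[T;T⁻¹] ⊗[k] N →ₐ[k] N :=
  Algebra.TensorProduct.lift ((Algebra.ofId k N).comp (laurentEvalOne k)) (AlgHom.id k N)
    fun _ _ => Commute.all _ _

variable {k N}

theorem evalOne_tmul (l : k[T;T⁻¹]) (m : N) : evalOne k N (l ⊗ₜ m) = laurentEvalOne k l • m := by
  rw [evalOne, Algebra.TensorProduct.lift_tmul, Algebra.smul_def]
  rfl

theorem evalOne_smul (l : k[T;T⁻¹]) (u : k[T;T⁻¹] ⊗[k] N) :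
    evalOne k N (l • u) = laurentEvalOne k l • evalOne k N u := by
  induction u using TensorProduct.induction_on with
  | zero => simp
  | tmul l' m => rw [TensorProduct.smul_tmul', evalOne_tmul, evalOne_tmul, smul_eq_mul, map_mul,
      mul_smul]
  | add x y hx hy => rw [smul_add, map_add, hx, hy, map_add, smul_add]

theorem exists_eq_evalOne_add (u : k[T;T⁻¹] ⊗[k] N) : ∃ u' : k[T;T⁻¹] ⊗[k] N,
    u = 1 ⊗ₜ evalOne k N u + algebraMap k[X] k[T;T⁻¹] (Polynomial.X - 1) • u' := by
  induction u using TensorProduct.induction_on with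
  | zero => exact ⟨0, by simp⟩
  | tmul l m =>
    obtain ⟨l', hl⟩ := exists_eq_eval_add l
    refine ⟨l' ⊗ₜ m, ?_⟩
    rw [evalOne_tmul, ← TensorProduct.smul_tmul, TensorProduct.smul_tmul', ← TensorProduct.add_tmul,
      smul_eq_mul, ← Algebra.algebraMap_eq_smul_one, ← hl]
  | add x y hx hy =>
    obtain ⟨x', hx⟩ := hx
    obtain ⟨y', hy⟩ := hy
    refine ⟨x' + y', ?_⟩
    rw [map_add, TensorProduct.tmul_add, smul_add]
    nth_rw 1 [hx, hy]
    abel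

theorem evalOne_mem {P : Submodule k N} {u : k[T;T⁻¹] ⊗[k] N} (hu : u ∈ P.baseChange k[T;T⁻¹]) :
    evalOne k N u ∈ P := by
  rw [Submodule.baseChange_eq_span] at hu
  induction hu using Submodule.span_induction with
  | mem u hu =>
    obtain ⟨m, hm, rfl⟩ := hu
    refine Submodule.smul_mem _ (laurentEvalOne k 1) hm |> fun h => ?_
    rwa [← evalOne_tmul] at h
  | zero => rw [map_zero]; exact zero_mem _
  | add x y _ _ hx hy => rw [map_add]; exact add_mem hx hy
  | smul l x _ hx => rw [evalOne_smul]; exact Submodule.smul_mem _ _ hx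

end EvalOne

/-! ### Clearing powers of t in the base change to k[t, t⁻¹] -/

section Localization

variable {k : Type*} [Field k] {M : Type*} [AddCommGroup M] [Module k[X] M]

theorem exists_smul_eq_one_tmul (v : k[T;T⁻¹] ⊗[k[X]] M) : ∃ (N : ℕ) (m : M),
    algebraMap k[X] k[T;T⁻¹] (Polynomial.X ^ N) • v = 1 ⊗ₜ m := by
  obtain ⟨⟨m, ⟨_, N, rfl⟩⟩, h⟩ := IsLocalizedModule.surj (Submonoid.powers (Polynomial.X : k[X]))
    (TensorProduct.mk k[X] k[T;T⁻¹] M 1) v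
  refine ⟨N, m, ?_⟩
  rw [algebraMap_smul]
  exact h

theorem one_tmul_injective (hflat : Module.Flat k[X] M) (m : M)
    (h : (1 : k[T;T⁻¹]) ⊗ₜ[k[X]] m = 0) : m = 0 := by
  have h1 : TensorProduct.mk k[X] k[T;T⁻¹] M 1 m = TensorProduct.mk k[X] k[T;T⁻¹] M 1 0 := by
    rw [map_zero]
    exact h
  obtain ⟨⟨_, N, rfl⟩, hN⟩ := (IsLocalizedModule.eq_iff_exists
    (Submonoid.powers (Polynomial.X : k[X])) (TensorProduct.mk k[X] k[T;T⁻¹] M 1)).1 h1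
  exact (Module.Flat.isSMulRegular_of_nonZeroDivisors (M := M)
    (mem_nonZeroDivisors_of_ne_zero (pow_ne_zero N Polynomial.X_ne_zero))) hN

theorem one_tmul_smul (a : k[X]) (m : M) :
    (1 : k[T;T⁻¹]) ⊗ₜ[k[X]] (a • m) = algebraMap k[X] k[T;T⁻¹] a • (1 ⊗ₜ m) := by
  rw [TensorProduct.tmul_smul, algebraMap_smul]

theorem exists_pow_sub_one (N : ℕ) : ∃ q : k[X],
    Polynomial.X ^ N = 1 + (Polynomial.X - 1) * q := by
  obtain ⟨q, hq⟩ := sub_one_dvd_pow_sub_one (Polynomial.X : k[X]) N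
  exact ⟨q, by rw [← hq]; ring⟩

end Localization

/-! ### The fiber over t = 1 -/

section General

attribute [local instance] MvPolynomial.gradedAlgebra

variable {k : Type*} [Field k] {n : ℕ} {J : Ideal (MvPolynomial (Fin n) k[X])}
  {I : Ideal (MvPolynomial (Fin n) k)}
  (hJ : J.IsHomogeneous (homogeneousSubmodule (Fin n) k[X]))
  (hI : I.IsHomogeneous (homogeneousSubmodule (Fin n) k))
  (hflat : Module.Flat k[X] (MvPolynomial (Fin n) k[X] ⧸ J))
  (e : (k[T;T⁻¹] ⊗[k] (MvPolynomial (Fin n) k ⧸ I)) ≃ₐ[k[T;T⁻¹]]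
    (k[T;T⁻¹] ⊗[k[X]] (MvPolynomial (Fin n) k[X] ⧸ J)))
  (he : ∀ d : ℕ, ((quotGrading I d).baseChange k[T;T⁻¹]).map e.toLinearMap =
    (quotGrading J d).baseChange k[T;T⁻¹])

include hflat he in
theorem exists_isSpecialization_one :
    ∃ θ, IsSpecialization hJ hI (Polynomial.X - 1 : k[X]) θ ∧
      ∀ c : k, θ (Ideal.Quotient.mk J (C (Polynomial.C c))) = Ideal.Quotient.mk I (C c) := by
  let ι : (MvPolynomial (Fin n) k[X] ⧸ J) →ₐ[k[X]]
      k[T;T⁻¹] ⊗[k[X]] (MvPolynomial (Fin n) k[X] ⧸ J) := Algebra.TensorProduct.includeRight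
  have hι : ∀ m, ι m = (1 : k[T;T⁻¹]) ⊗ₜ[k[X]] m := fun m => rfl
  let θ : (MvPolynomial (Fin n) k[X] ⧸ J) →+* (MvPolynomial (Fin n) k ⧸ I) :=
    (evalOne k (MvPolynomial (Fin n) k ⧸ I)).toRingHom.comp
      (e.symm.toRingEquiv.toRingHom.comp ι.toRingHom)
  have hθ : ∀ m, θ m = evalOne k _ (e.symm (ι m)) := fun m => rfl
  have h1 : laurentEvalOne k (algebraMap k[X] k[T;T⁻¹] (Polynomial.X - 1)) = 0 := by
    rw [laurentEvalOne_algebraMap]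
    simp
  refine ⟨θ, ⟨?_, ?_, ?_, ?_, ?_⟩, ?_⟩
  · intro y
    -- Clearing denominators multiplies by t^N, which does not change the value at t = 1.
    obtain ⟨N, m, hm⟩ := exists_smul_eq_one_tmul (e (1 ⊗ₜ y))
    refine ⟨m, ?_⟩
    rw [hθ, hι, ← hm, map_smul, AlgEquiv.symm_apply_apply, evalOne_smul, evalOne_tmul,
      laurentEvalOne_algebraMap, map_one]
    simp
  · intro m
    rw [hθ, hι, one_tmul_smul, map_smul, evalOne_smul, h1, zero_smul]
  · intro m hm
    obtain ⟨u', hu'⟩ := exists_eq_evalOne_add (e.symm (ι m))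
    rw [← hθ, hm, TensorProduct.tmul_zero, zero_add, AlgEquiv.symm_apply_eq, map_smul] at hu'
    obtain ⟨N, m', hm'⟩ := exists_smul_eq_one_tmul (e u')
    have h2 : ι ((Polynomial.X ^ N : k[X]) • m) = ι ((Polynomial.X - 1 : k[X]) • m') := by
      rw [hι, hι, one_tmul_smul, one_tmul_smul, ← hm', ← hι, hu', smul_comm]
    rw [← sub_eq_zero, ← map_sub] at h2
    have h3 := sub_eq_zero.1 (one_tmul_injective hflat _ h2)
    -- From t^N m = (t − 1) m' and t^N = 1 + (t − 1) q it follows that m = (t − 1)(m' − q m).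
    obtain ⟨q, hq⟩ := exists_pow_sub_one (k := k) N
    refine ⟨m' - q • m, ?_⟩
    rw [smul_sub, ← h3, hq, add_smul, one_smul, mul_smul, add_sub_cancel_right]
  · exact eq_zero_of_smul_eq_zero hflat (Polynomial.X_sub_C_ne_zero (1 : k))
  · refine graded_of_map_mem hJ hI _ fun d m hm => ?_
    rw [hθ]
    refine evalOne_mem ?_
    have h2 : ι m ∈ (quotGrading J d).baseChange k[T;T⁻¹] :=
      Submodule.tmul_mem_baseChange_of_mem 1 hm
    rw [← he] at h2
    obtain ⟨y, hy, hym⟩ := h2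
    rw [← hym]
    refine (congrArg (· ∈ _) (e.symm_apply_apply y)).mpr hy
  · intro c
    rw [hθ]
    have h2 : ι (Ideal.Quotient.mk J (C (Polynomial.C c))) =
        algebraMap k[X] k[T;T⁻¹] (Polynomial.C c) • 1 := by
      have h3 : Ideal.Quotient.mk J (C (Polynomial.C c)) = Polynomial.C c • 1 :=
        Algebra.algebraMap_eq_smul_one (A := MvPolynomial (Fin n) k[X] ⧸ J) (Polynomial.C c)
      rw [h3]
      exact one_tmul_smul (Polynomial.C c) (1 : MvPolynomial (Fin n) k[X] ⧸ J)
    rw [h2, map_smul, map_one, evalOne_smul, map_one, laurentEvalOne_algebraMap, Polynomial.eval_C,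
      ← Algebra.algebraMap_eq_smul_one]
    rfl

end General

end GradedLC

namespace GradedLC

open MvPolynomial

/-! ### Injectivity of t − 1 on the cohomology of the family -/

theorem mem_span_of_mem_baseChange {R L M : Type*} [CommRing R] [CommRing L] [Algebra R L]
    [CommRing M] [Algebra R M] {n : ℕ} {x : Fin n → M} {P : Submodule R M}
    (hP : ∀ m ∈ P, m ∈ Ideal.span (Set.range x)) {u : L ⊗[R] M} (hu : u ∈ P.baseChange L) :
    u ∈ Ideal.span (Set.range fun j => (1 : L) ⊗ₜ[R] x j) := by
  rw [Submodule.baseChange_eq_span] at hu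
  induction hu using Submodule.span_induction with
  | mem u hu =>
    obtain ⟨m, hm, rfl⟩ := hu
    let ι : M →ₐ[R] L ⊗[R] M := Algebra.TensorProduct.includeRight
    have h := Ideal.mem_map_of_mem ι (hP m hm)
    rw [Ideal.map_span, ← Set.range_comp] at h
    exact h
  | zero => exact zero_mem _
  | add x y _ _ hx hy => exact add_mem hx hy
  | smul l x _ hx =>
    rw [Algebra.smul_def]
    exact Ideal.mul_mem_left _ _ hx

section Laurent

variable {k : Type*} [Field k] {n : ℕ} {M : Type*} [CommRing M] [Algebra k[X] M]
  {N : Type*} [CommRing N] [Algebra k N] (x : Fin n → M) (x' : Fin n → N)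
  (hflat : Module.Flat k[X] M) (e : (k[T;T⁻¹] ⊗[k] N) ≃ₐ[k[T;T⁻¹]] (k[T;T⁻¹] ⊗[k[X]] M))

/-- The images of elements of `M` in `M ⊗ k[t, t⁻¹]`. -/
noncomputable def varL (j : Fin n) : k[T;T⁻¹] ⊗[k[X]] M :=
  1 ⊗ₜ x j

/-- The images in `M ⊗ k[t, t⁻¹]` of elements of `N`. -/
noncomputable def varE (j : Fin n) : k[T;T⁻¹] ⊗[k[X]] M :=
  e (1 ⊗ₜ x' j)

theorem varL_smul (j : Fin n) (m : M) :
    varL (k := k) x j • ((1 : k[T;T⁻¹]) ⊗ₜ[k[X]] m) = 1 ⊗ₜ (x j * m) := by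
  rw [varL, smul_eq_mul, Algebra.TensorProduct.tmul_mul_tmul, one_mul]

theorem varE_smul (j : Fin n) (m : N) : varE x' e j • e (1 ⊗ₜ m) = e (1 ⊗ₜ (x' j * m)) := by
  rw [varE, smul_eq_mul, ← map_mul, Algebra.TensorProduct.tmul_mul_tmul, one_mul]

variable (M) in
/-- An element of `k[t]`, in `M ⊗ k[t, t⁻¹]`. -/
noncomputable def scalarL (a : k[X]) : k[T;T⁻¹] ⊗[k[X]] M :=
  algebraMap k[T;T⁻¹] _ (algebraMap k[X] k[T;T⁻¹] a)

theorem scalarL_smul (a : k[X]) (v : k[T;T⁻¹] ⊗[k[X]] M) :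
    scalarL M a • v = algebraMap k[X] k[T;T⁻¹] a • v :=
  algebraMap_smul _ _ v

/-- Setting `t = 1`, through the trivialization `e`. -/
noncomputable def specOne : (k[T;T⁻¹] ⊗[k[X]] M) →ₐ[k]
    N :=
  (evalOne k N).comp (e.symm.toAlgHom.restrictScalars k)

theorem specOne_apply (v : k[T;T⁻¹] ⊗[k[X]] M) :
    specOne e v = evalOne k _ (e.symm v) := rfl

theorem specOne_e (m : N) : specOne e (e (1 ⊗ₜ m)) = m := by
  rw [specOne_apply, AlgEquiv.symm_apply_apply, evalOne_tmul, map_one, one_smul]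

theorem specOne_varE (j : Fin n) : specOne e (varE x' e j) = x' j :=
  specOne_e e _

theorem specOne_scalarL_smul (v : k[T;T⁻¹] ⊗[k[X]] M) :
    specOne e (scalarL M (Polynomial.X - 1 : k[X]) • v) = 0 := by
  rw [scalarL_smul, specOne_apply, map_smul, evalOne_smul, laurentEvalOne_algebraMap]
  simp

theorem exists_of_specOne_eq_zero (v : k[T;T⁻¹] ⊗[k[X]] M)
    (hv : specOne e v = 0) : ∃ v', scalarL M (Polynomial.X - 1 : k[X]) • v' = v := by
  obtain ⟨u', hu'⟩ := exists_eq_evalOne_add (e.symm v)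
  rw [← specOne_apply, hv, TensorProduct.tmul_zero, zero_add, AlgEquiv.symm_apply_eq, map_smul] at hu'
  exact ⟨e u', by rw [scalarL_smul, hu']⟩

include hflat in
theorem scalarL_smul_injective (v : k[T;T⁻¹] ⊗[k[X]] M)
    (hv : scalarL M (Polynomial.X - 1 : k[X]) • v = 0) : v = 0 := by
  rw [scalarL_smul] at hv
  refine (Module.Flat.isSMulRegular_of_nonZeroDivisors (R := k[T;T⁻¹]) (r :=
    algebraMap k[X] k[T;T⁻¹] (Polynomial.X - 1)) (mem_nonZeroDivisors_of_ne_zero ?_))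
    (hv.trans (smul_zero _).symm)
  rw [LaurentPolynomial.algebraMap_eq_toLaurent, Polynomial.toLaurent_ne_zero]
  exact Polynomial.X_sub_C_ne_zero (1 : k)

/-- The underlying additive map of `specOne`. -/
noncomputable def specOneTw : Tw (varE x' e) (k[T;T⁻¹] ⊗[k[X]] M) →+
    Tw x' N :=
  (toTw _ _).toAddMonoidHom.comp
    ((specOne e).toRingHom.toAddMonoidHom.comp (toTw (varE x' e) _).symm.toAddMonoidHom)

theorem specOneTw_apply (v : k[T;T⁻¹] ⊗[k[X]] M) :
    specOneTw x' e (toTw _ _ v) = toTw _ _ (specOne e v) := rfl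

include hflat in
theorem weakSES_specOne : WeakSES ℤ ℤ ℤ n (mulTw (varE x' e)
    (k[T;T⁻¹] ⊗[k[X]] M) (scalarL M (Polynomial.X - 1 : k[X])) 0)
    (specOneTw x' e) where
  map_X_left j v := (mulTw (varE x' e) _ (scalarL M (Polynomial.X - 1 : k[X]))).map_X_smul 0 j v
  map_X_right j v := by
    obtain ⟨v, rfl⟩ := (toTw (varE x' e) _).surjective v
    rw [X_smul_toTw, specOneTw_apply, specOneTw_apply, X_smul_toTw, smul_eq_mul, map_mul,
      specOne_varE, smul_eq_mul]
  torsion v hv j := ⟨0, by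
    obtain ⟨v, rfl⟩ := (toTw (varE x' e) _).surjective v
    rw [mulTw_apply, AddEquiv.map_eq_zero_iff] at hv
    rw [scalarL_smul_injective hflat v hv, map_zero, smul_zero]⟩
  comp_zero v := by
    obtain ⟨v, rfl⟩ := (toTw (varE x' e) _).surjective v
    rw [mulTw_apply, specOneTw_apply, specOne_scalarL_smul, map_zero]
  exact v hv := by
    obtain ⟨v, rfl⟩ := (toTw (varE x' e) _).surjective v
    rw [specOneTw_apply, AddEquiv.map_eq_zero_iff] at hv
    obtain ⟨v', rfl⟩ := exists_of_specOne_eq_zero e v hv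
    exact ⟨toTw _ _ v', rfl⟩
  surj m := by
    obtain ⟨m, rfl⟩ := (toTw _ _).surjective m
    exact ⟨toTw _ _ (e (1 ⊗ₜ m)), by rw [specOneTw_apply, specOne_e]⟩

/-- The section of `specOneTw`. -/
noncomputable def secOne : ShiftHom ℤ ℤ n
    (Tw x' N)
    (Tw (varE x' e) (k[T;T⁻¹] ⊗[k[X]] M)) :=
  ShiftHom.const ((toTw _ _).toAddMonoidHom.comp (((e : _ →+* _).toAddMonoidHom.comp
    (Algebra.TensorProduct.includeRight : N →ₐ[k]
      k[T;T⁻¹] ⊗[k] N).toRingHom.toAddMonoidHom).comp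
        (toTw _ _).symm.toAddMonoidHom)) fun j m => by
    obtain ⟨m, rfl⟩ := (toTw _ _).surjective m
    rw [X_smul_toTw]
    exact (congrArg (toTw _ _) (varE_smul x' e j m).symm).trans (X_smul_toTw _ j _).symm

include hflat in
-- With the variables of the trivialization, evaluation at t = 1 is split by m ↦ e(1 ⊗ m). It is
-- therefore surjective on cohomology, the connecting map vanishes, and t − 1 has no kernel.
theorem eq_zero_of_mulTw_varE {p : ℕ}
    (z : H ℤ n (Tw (varE x' e) (k[T;T⁻¹] ⊗[k[X]] M)) p)
    (hz : (mulTw (varE x' e) (k[T;T⁻¹] ⊗[k[X]] M)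
      (scalarL M (Polynomial.X - 1 : k[X]))).Hmap 0 p z = 0) : z = 0 := by
  let S := weakSES_specOne x' hflat e
  have hz' : S.left.Hmap 0 p z = 0 := hz ▸ DFunLike.congr_fun (ShiftHom.Hmap_congr (fun _ => rfl) p) z
  cases p with
  | zero =>
    refine S.exact_left_zero ?_ z hz'
    rw [injective_iff_map_eq_zero]
    intro v hv
    obtain ⟨v, rfl⟩ := (toTw (varE x' e) _).surjective v
    rw [mulTw_apply, AddEquiv.map_eq_zero_iff] at hv
    rw [scalarL_smul_injective hflat v hv, map_zero]
  | succ p =>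
    obtain ⟨w, rfl⟩ := S.exact_left z hz'
    have h : S.right.Hmap 0 p ((secOne x' e).Hmap 0 p w) = w := by
      rw [← ShiftHom.Hmap_comp]
      exact ShiftHom.Hmap_id (fun _ m => congrArg (toTw _ _) (specOne_e e ((toTw _ _).symm m))) p w
    rw [← h, S.delta_Hmap]

variable [Module (MvPolynomial (Fin n) k[X]) M] [IsScalarTower k[X] (MvPolynomial (Fin n) k[X]) M]
  (hx : ∀ j (m : M), (X j : MvPolynomial (Fin n) k[X]) • m = x j * m)

/-- The map `M → M ⊗ k[t, t⁻¹]`. -/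
noncomputable def toLaurentTw : ShiftHom k[X] ℤ n M
    (Tw (varL (k := k) x) (k[T;T⁻¹] ⊗[k[X]] M)) :=
  ShiftHom.const ((toTw _ _).toAddMonoidHom.comp (Algebra.TensorProduct.includeRight :
    M →ₐ[k[X]]
      k[T;T⁻¹] ⊗[k[X]] M).toRingHom.toAddMonoidHom) fun j m => by
    exact (congrArg (fun m => toTw (varL (k := k) x) (k[T;T⁻¹] ⊗[k[X]] M) (1 ⊗ₜ m)) (hx j m)).trans
      ((congrArg (toTw _ _) (varL_smul x j m).symm).trans (X_smul_toTw _ j _).symm)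

theorem toLaurentTw_apply (μ : ℤ) (m : M) :
    toLaurentTw x hx μ m = toTw _ _ (1 ⊗ₜ m) := rfl

theorem toLaurentTw_smul (a : k[X]) (μ μ' : ℤ) (m : M) :
    toLaurentTw x hx μ (a • m) = mulTw (varL (k := k) x) _ (scalarL M a) μ' (toLaurentTw x hx μ m) := by
  rw [toLaurentTw_apply, toLaurentTw_apply, mulTw_apply, scalarL_smul, one_tmul_smul]

include hflat in
-- By flatness M embeds in its localization at t, and each element of the localization enters M
-- after multiplication by any large power of t.
theorem exists_pow_smul_eq_zero_of_toLaurentTw {p : ℕ}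
    (z : H k[X] n M p) (hz : (toLaurentTw x hx).Hmap 0 p z = 0) :
    ∃ e : ℕ, (Polynomial.X : k[X]) ^ e • z = 0 := by
  refine exists_pow_smul_eq_zero_of_Hmap Polynomial.X (toLaurentTw x hx) (fun μ m hm => ?_)
    (fun e => mulTw (varL (k := k) x) _ (scalarL M (Polynomial.X ^ e))) (fun μ v => ?_)
    (fun e μ m => toLaurentTw_smul x hx _ μ μ m) z hz
  · rw [toLaurentTw_apply, AddEquiv.map_eq_zero_iff] at hm
    exact one_tmul_injective hflat m hm
  · obtain ⟨v, rfl⟩ := (toTw (varL (k := k) x) _).surjective v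
    obtain ⟨N, m, hm⟩ := exists_smul_eq_one_tmul v
    refine ⟨N, fun e he => ⟨(Polynomial.X : k[X]) ^ (e - N) • m, ?_⟩⟩
    rw [toLaurentTw_apply, mulTw_apply, scalarL_smul, one_tmul_smul, ← hm, ← mul_smul, ← map_mul,
      ← pow_add, Nat.sub_add_cancel he]

include hflat hx in
/-- Multiplication by `t - 1` is injective on the local cohomology of a family that is trivial
away from `t = 0`. -/
theorem eq_zero_of_X_sub_one_smul (hL : ∀ j, varL (k := k) x j ∈ Ideal.span (Set.range (varE x' e)))
    (hE : ∀ j, varE x' e j ∈ Ideal.span (Set.range (varL (k := k) x))) {p : ℕ} (z : H k[X] n M p)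
    (hz : (Polynomial.X - 1 : k[X]) • z = 0) : z = 0 := by
  -- Over k[t, t⁻¹] the variables of the family are exchanged for those of the constant family,
  -- transported by e; the two sets generate the same ideal.
  obtain ⟨E, hE'⟩ := exists_equiv hL hE p (k[T;T⁻¹] ⊗[k[X]] M)
  have h1 : (mulTw (varL (k := k) x) _ (scalarL M (Polynomial.X - 1 : k[X]))).Hmap 0 p
      ((toLaurentTw x hx).Hmap 0 p z) = 0 := by
    rw [← map_zero ((toLaurentTw x hx).Hmap 0 p), ← hz, ← C_smul_H, ← ShiftHom.Hmap_ofLinear_smul _ 0]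
    refine (ShiftHom.Hmap_comm (fun d m => ?_) p z).symm
    exact (congrArg (toLaurentTw x hx (0 + d)) (C_smul' _ m)).trans (toLaurentTw_smul x hx _ _ _ m)
  have h2 : (toLaurentTw x hx).Hmap 0 p z = 0 := by
    rw [← E.map_eq_zero_iff]
    refine eq_zero_of_mulTw_varE x' hflat e _ ?_
    have h3 := hE' (mulBi (varL (k := k) x) (varE x' e) _ (scalarL M (Polynomial.X - 1 : k[X]))) 0
      ((toLaurentTw x hx).Hmap 0 p z)
    rw [mulBi_fst, mulBi_snd, h1, map_zero] at h3
    exact h3.symm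
  obtain ⟨N, hN⟩ := exists_pow_smul_eq_zero_of_toLaurentTw x hflat hx z h2
  -- Both t^N and t − 1 kill z, and t^N ≡ 1 modulo t − 1.
  obtain ⟨q, hq⟩ := exists_pow_sub_one (k := k) N
  rw [hq, add_smul, one_smul, mul_comm, mul_smul, hz, smul_zero, add_zero] at hN
  exact hN

include hflat hx in
-- `P` and `P'` stand for the degree-one pieces: they contain the variables and lie in the ideals
-- generated by them. Since e matches their base changes, the two sets of variables generate the
-- same ideal over k[t, t⁻¹].
theorem eq_zero_of_baseChange_eq {P : Submodule k[X] M} {P' : Submodule k N}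
    (hP : ∀ m ∈ P, m ∈ Ideal.span (Set.range x)) (hP' : ∀ m ∈ P', m ∈ Ideal.span (Set.range x'))
    (hxP : ∀ j, x j ∈ P) (hxP' : ∀ j, x' j ∈ P')
    (he : (P'.baseChange k[T;T⁻¹]).map e.toLinearMap = P.baseChange k[T;T⁻¹]) {p : ℕ}
    (z : H k[X] n M p) (hz : (Polynomial.X - 1 : k[X]) • z = 0) : z = 0 := by
  refine eq_zero_of_X_sub_one_smul x x' hflat e hx (fun j => ?_) (fun j => ?_) z hz
  · have h : varL (k := k) x j ∈ P.baseChange k[T;T⁻¹] :=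
      Submodule.tmul_mem_baseChange_of_mem 1 (hxP j)
    rw [← he] at h
    obtain ⟨u, hu, hu'⟩ := h
    have h2 := Ideal.mem_map_of_mem e (mem_span_of_mem_baseChange hP' hu)
    rw [Ideal.map_span, ← Set.range_comp] at h2
    rw [← hu']
    exact h2
  · refine mem_span_of_mem_baseChange hP ?_
    rw [← he]
    exact ⟨_, Submodule.tmul_mem_baseChange_of_mem 1 (hxP' j), rfl⟩

end Laurent

theorem eq_zero_of_trivial_family {k : Type*} [Field k] {n : ℕ}
    {J : Ideal (MvPolynomial (Fin n) k[X])} {I : Ideal (MvPolynomial (Fin n) k)}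
    (hflat : Module.Flat k[X] (MvPolynomial (Fin n) k[X] ⧸ J))
    (e : (k[T;T⁻¹] ⊗[k] (MvPolynomial (Fin n) k ⧸ I)) ≃ₐ[k[T;T⁻¹]]
      (k[T;T⁻¹] ⊗[k[X]] (MvPolynomial (Fin n) k[X] ⧸ J)))
    (he : ∀ d : ℕ, ((quotGrading I d).baseChange k[T;T⁻¹]).map e.toLinearMap =
      (quotGrading J d).baseChange k[T;T⁻¹]) {p : ℕ}
    (z : H k[X] n (MvPolynomial (Fin n) k[X] ⧸ J) p)
    (hz : (Polynomial.X - 1 : k[X]) • z = 0) : z = 0 := by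
  let x : Fin n → MvPolynomial (Fin n) k[X] ⧸ J := fun j => Ideal.Quotient.mk J (X j)
  let x' : Fin n → MvPolynomial (Fin n) k ⧸ I := fun j => Ideal.Quotient.mk I (X j)
  have hx : ∀ j (m : MvPolynomial (Fin n) k[X] ⧸ J),
    (X j : MvPolynomial (Fin n) k[X]) • m = x j * m := fun j m => rfl
  have h1 := @eq_zero_of_baseChange_eq k _ n (MvPolynomial (Fin n) k[X] ⧸ J) _ _
    (MvPolynomial (Fin n) k ⧸ I) _ _ x x' hflat e _ _ hx
  have h2 := @h1 (quotGrading J 1) (quotGrading I 1) (fun m hm => quotGrading_le_span hm)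
    (fun m hm => quotGrading_le_span hm) mk_X_mem_quotGrading mk_X_mem_quotGrading
  have h3 := @h2 (he 1)
  have h4 := @h3 p z
  exact h4 hz

end GradedLC

namespace GradedLC

open MvPolynomial

/-! ### Fiber dimension and generic rank over k[t] -/

section Rank

variable {k : Type*} [Field k] {V : Type*} [AddCommGroup V] [Module k[X] V]

/-- Injectivity allows the factors t − τ to be stripped from an annihilating polynomial, leaving b
with b(τ) ≠ 0. Such a b is a unit modulo t − τ, so 1 is a combination of b and t − τ. -/
theorem exists_smul_of_mem_torsion {τ : k}
    (hinj : ∀ v : V, (Polynomial.X - Polynomial.C τ) • v = 0 → v = 0) {t : V}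
    (ht : t ∈ Submodule.torsion k[X] V) : ∃ w, (Polynomial.X - Polynomial.C τ) • w = t := by
  obtain ⟨⟨a, ha⟩, hat⟩ := ht
  obtain ⟨b, hb, hdvd⟩ := Polynomial.exists_eq_pow_rootMultiplicity_mul_and_not_dvd a
    (nonZeroDivisors.ne_zero ha) τ
  have hbt : b • t = 0 := by
    have h : ∀ m : ℕ, ((Polynomial.X - Polynomial.C τ) ^ m) • (b • t) = 0 → b • t = 0 := by
      intro m
      induction m with
      | zero => intro h; rwa [pow_zero, one_smul] at h
      | succ m ih => intro h; exact ih (hinj _ (by rwa [pow_succ', mul_smul] at h))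
    refine h (a.rootMultiplicity τ) ?_
    rw [← mul_smul, ← hb]
    exact hat
  obtain ⟨q, hq⟩ := Polynomial.X_sub_C_dvd_sub_C_eval (p := b) (a := τ)
  have hτ : b.eval τ ≠ 0 := fun h => hdvd (Polynomial.dvd_iff_isRoot.2 h)
  refine ⟨-(Polynomial.C (b.eval τ)⁻¹ * q) • t, ?_⟩
  have h1 : (Polynomial.X - Polynomial.C τ) * -(Polynomial.C (b.eval τ)⁻¹ * q) =
      1 - Polynomial.C (b.eval τ)⁻¹ * b := by
    have h2 : Polynomial.C (b.eval τ)⁻¹ * Polynomial.C (b.eval τ) = 1 := by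
      rw [← map_mul, inv_mul_cancel₀ hτ, map_one]
    linear_combination Polynomial.C (b.eval τ)⁻¹ * hq + h2
  rw [← mul_smul, h1, sub_smul, mul_smul, hbt, smul_zero, sub_zero, one_smul]

/-- The fiber at `τ` of a finitely generated module without `(t - τ)`-torsion has the dimension of
the generic fiber. -/
theorem rank_fiber_eq [Module.Finite k[X] V] {W : Type*} [AddCommGroup W] [Module k W] {τ : k}
    (hinj : ∀ v : V, (Polynomial.X - Polynomial.C τ) • v = 0 → v = 0) (T : V →+ W)
    (hT : Function.Surjective T) (hC : ∀ (c : k) v, T (Polynomial.C c • v) = c • T v)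
    (h0 : ∀ v, T ((Polynomial.X - Polynomial.C τ) • v) = 0)
    (hker : ∀ v, T v = 0 → ∃ w, (Polynomial.X - Polynomial.C τ) • w = v) :
    Module.rank k W = Module.finrank k[X] (V ⧸ Submodule.torsion k[X] V) := by
  let Q := V ⧸ Submodule.torsion k[X] V
  -- The quotient by torsion is free since k[t] is a principal ideal domain. The images under T of
  -- lifts of a basis turn out to be a basis of the fiber.
  let b : Module.Basis (Fin (Module.finrank k[X] Q)) k[X] Q := Module.finBasis k[X] Q
  have hsmul : ∀ (a : k[X]) v, T (a • v) = a.eval τ • T v := by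
    intro a v
    obtain ⟨q, hq⟩ := Polynomial.X_sub_C_dvd_sub_C_eval (p := a) (a := τ)
    rw [eq_add_of_sub_eq hq, add_smul, map_add, mul_smul, h0, zero_add, hC]
    simp
  choose v hv using fun i => Submodule.mkQ_surjective (Submodule.torsion k[X] V) (b i)
  have hdecomp : ∀ (c : Fin (Module.finrank k[X] Q) → k[X]),
      (Submodule.torsion k[X] V).mkQ (∑ i, c i • v i) = ∑ i, c i • b i := by
    intro c
    rw [map_sum]
    exact Finset.sum_congr rfl fun i _ => by rw [map_smul, hv]
  let L : (Fin (Module.finrank k[X] Q) → k) →ₗ[k] W := Fintype.linearCombination k fun i => T (v i)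
  have hL : ∀ c : Fin (Module.finrank k[X] Q) → k[X],
      L (fun i => (c i).eval τ) = T (∑ i, c i • v i) := by
    intro c
    rw [Fintype.linearCombination_apply, map_sum]
    exact Finset.sum_congr rfl fun i _ => (hsmul _ _).symm
  have hbij : Function.Bijective L := by
    constructor
    · rw [injective_iff_map_eq_zero]
      intro c hc
      have h1 := hL fun i => Polynomial.C (c i)
      simp only [Polynomial.eval_C] at h1
      rw [h1] at hc
      -- A relation in the fiber lifts to a multiple of t − τ. Its coordinates modulo torsion are
      -- the constants c i, and evaluating them at τ gives zero.
      obtain ⟨u, hu⟩ := hker _ hc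
      have h2 := congrArg (Submodule.torsion k[X] V).mkQ hu
      rw [hdecomp, map_smul] at h2
      have h3 := congrArg b.repr h2
      ext i
      have h4 := DFunLike.congr_fun h3 i
      rw [b.repr_sum_self, map_smul, Finsupp.smul_apply, smul_eq_mul] at h4
      have h5 := congrArg (Polynomial.eval τ) h4
      rw [Polynomial.eval_mul, Polynomial.eval_C] at h5
      simpa using h5.symm
    · intro y
      obtain ⟨u, rfl⟩ := hT y
      refine ⟨fun i => (b.repr ((Submodule.torsion k[X] V).mkQ u) i).eval τ, ?_⟩
      rw [hL, ← sub_eq_zero, ← map_sub]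
      -- The error is torsion, hence divisible by t − τ, and T does not see it.
      have h1 : (∑ i, b.repr ((Submodule.torsion k[X] V).mkQ u) i • v i) - u ∈
          Submodule.torsion k[X] V := by
        rw [← Submodule.Quotient.mk_eq_zero, ← Submodule.mkQ_apply, map_sub, hdecomp, b.sum_repr,
          sub_self]
      obtain ⟨w, hw⟩ := exists_smul_of_mem_torsion hinj h1
      rw [← hw, h0]
  rw [rank_eq_card_basis (Module.Basis.ofEquivFun (LinearEquiv.ofBijective L hbij).symm),
    Fintype.card_fin]

/-- The fiber of a graded piece, through a projection `P` onto the piece. -/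
theorem rank_fiber_of_projection {HM HK HN : Type*} [AddCommGroup HM] [Module k[X] HM]
    [AddCommGroup HK] [AddCommGroup HN] [Module k HN] (P : HM →ₗ[k[X]] HM)
    (idem : ∀ z, P (P z) = P z) [Module.Finite k[X] (LinearMap.range P)] (W : Submodule k HN)
    (Q : HN → HN) (hW : ∀ y, y ∈ W ↔ Q y = y) (T : HM →+ HN) (δ : HN →+ HK) {τ : k} {a : k[X]}
    (ha : a = Polynomial.X - Polynomial.C τ) (T_smul : ∀ z, T (a • z) = 0)
    (exact_T : ∀ z, T z = 0 → ∃ w, a • w = z) (exact_δ : ∀ y, δ y = 0 → ∃ z, T z = y)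
    (T_C : ∀ (c : k) z, T (Polynomial.C c • z) = c • T z) (T_P : ∀ z, T (P z) = Q (T z))
    (hinj : ∀ z, P z = z → a • z = 0 → z = 0) (hδ : ∀ y, Q y = y → δ y = 0) :
    Module.rank k W = Module.finrank k[X]
      (LinearMap.range P ⧸ Submodule.torsion k[X] (LinearMap.range P)) := by
  have hV : ∀ z : LinearMap.range P, P z = z := by
    rintro ⟨_, z, rfl⟩
    exact idem z
  let T' : LinearMap.range P →+ W :=
    (T.comp (LinearMap.range P).subtype.toAddMonoidHom).codRestrict W fun z => by
      rw [hW]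
      refine (T_P z).symm.trans ?_
      rw [hV]
      rfl
  have hT : ∀ z, (T' z : HN) = T z := fun _ => rfl
  subst ha
  refine rank_fiber_eq (τ := τ) (fun z hz => ?_) T' (fun y => ?_) (fun c z => ?_) (fun z => ?_)
    (fun z hz => ?_)
  · exact Subtype.ext (hinj z (hV z) (congrArg Subtype.val hz))
  · have hy := (hW _).1 y.2
    obtain ⟨z, hz⟩ := exact_δ y (hδ y hy)
    refine ⟨⟨P z, z, rfl⟩, Subtype.ext ?_⟩
    rw [hT, T_P, hz, hy]
  · exact Subtype.ext (T_C c z)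
  · exact Subtype.ext (T_smul z)
  · obtain ⟨w, hw⟩ := exact_T z (congrArg Subtype.val hz)
    refine ⟨⟨P w, w, rfl⟩, Subtype.ext ?_⟩
    rw [Submodule.coe_smul, ← map_smul, hw, hV]

end Rank

/-! ### Higher Bockstein maps and Krull's theorem -/

section Divisibility

/-- The Bockstein argument: if all graded linear maps `N → N'` vanish, the `a`-torsion of `M` is
divisible by all powers of `a`. -/
theorem exists_pow_smul_eq_of_hom_eq_zero {A S R M N N' ι : Type*} [CommRing A] [CommRing S]
    [CommRing R] [AddCommGroup M] [Module A M] [Module S M] [SMulCommClass S A M] [AddCommGroup N]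
    [Module R N] [AddCommGroup N'] [Module R N'] (a : A) (T : M →+ N') (δ : N →+ M)
    (P : ι → M →ₗ[A] M) (Q : ι → N → N) (Q' : ι → N' → N') (T_smul : ∀ z, T (a • z) = 0)
    (exact_T : ∀ z, T z = 0 → ∃ w, a • w = z) (smul_δ : ∀ y, a • δ y = 0)
    (exact_smul : ∀ z, a • z = 0 → ∃ y, δ y = z)
    (poly : ∀ r : R, ∃ g : S, (∀ z, T (g • z) = r • T z) ∧ ∀ y, δ (r • y) = g • δ y)
    (T_P : ∀ ν z, T (P ν z) = Q' ν (T z)) (δ_Q : ∀ ν y, δ (Q ν y) = P ν (δ y))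
    (hhom : ∀ f : N →ₗ[R] N', (∀ ν y, Q ν y = y → Q' ν (f y) = f y) → f = 0) (e : ℕ) :
    ∀ z : M, a • z = 0 → ∃ w, a ^ e • w = z := by
  induction e with
  | zero => exact fun z _ => ⟨z, by rw [pow_zero, one_smul]⟩
  | succ e ih =>
    -- This makes T of a lift through a^e independent of the lift. If a^(j+1) u = 0, then a^j u is
    -- a-torsion and so equals a^e v; subtracting a^(e−j) v, which T kills because e − j ≥ 1, leaves
    -- an element killed by a^j.
    have hwd : ∀ j ≤ e, ∀ u : M, a ^ j • u = 0 → T u = 0 := by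
      intro j
      induction j with
      | zero => intro _ u hu; rw [pow_zero, one_smul] at hu; rw [hu, map_zero]
      | succ j ihj =>
        intro hj u hu
        obtain ⟨v, hv⟩ := ih (a ^ j • u) (by rw [← mul_smul, ← pow_succ', hu])
        have h1 : T (u - a ^ (e - j) • v) = 0 := by
          refine ihj (by omega) _ ?_
          rw [smul_sub, ← mul_smul, ← pow_add, Nat.add_sub_cancel' (by omega), hv, sub_self]
        obtain ⟨i, hi⟩ : ∃ i, e - j = i + 1 := ⟨e - j - 1, by omega⟩
        rwa [map_sub, hi, pow_succ', mul_smul, T_smul, sub_zero] at h1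
    have hδ : ∀ y, ∃ w, a ^ e • w = δ y := fun y => ih _ (smul_δ y)
    choose w hw using hδ
    have hTw : ∀ y u, a ^ e • u = δ y → T u = T (w y) := by
      intro y u hu
      rw [← sub_eq_zero, ← map_sub]
      exact hwd e le_rfl _ (by rw [smul_sub, hu, hw, sub_self])
    -- The Bockstein map of order e + 1: lift δ(y) through a^e, then specialize. Uniqueness of the
    -- result gives additivity and R-linearity, and below it gives compatibility with the grading.
    let f : N →ₗ[R] N' :=
      { toFun := fun y => T (w y)
        map_add' := fun y y' => by
          rw [← map_add]
          exact (hTw _ _ (by rw [smul_add, hw, hw, map_add])).symm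
        map_smul' := fun r y => by
          obtain ⟨g, hg, hg'⟩ := poly r
          rw [RingHom.id_apply, ← hg]
          refine (hTw _ _ ?_).symm
          rw [← smul_comm g, hw, hg'] }
    have hf : f = 0 := by
      refine hhom f fun ν y hy => ?_
      change Q' ν (T (w y)) = T (w y)
      rw [← T_P]
      refine hTw _ _ ?_
      rw [← map_smul, hw, ← δ_Q, hy]
    intro z hz
    obtain ⟨y, rfl⟩ := exact_smul z hz
    -- Vanishing of the Bockstein map means that the lift of δ(y) through a^e is itself divisible by
    -- a.
    obtain ⟨u, hu⟩ := exact_T _ (DFunLike.congr_fun hf y)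
    exact ⟨u, by rw [pow_succ, mul_smul, hu, hw]⟩

/-- Krull's intersection theorem for the image of a projection. -/
theorem eq_zero_of_divisible {A M : Type*} [CommRing A] [IsNoetherianRing A] [AddCommGroup M]
    [Module A M] (P : M →ₗ[A] M) [Module.Finite A (LinearMap.range P)] {a : A} (z : M)
    (hz : P z = z) (haz : a • z = 0) (h : ∀ e : ℕ, ∃ w, a ^ e • w = z) : z = 0 := by
  let v : LinearMap.range P := ⟨z, z, hz⟩
  have hv : v ∈ (⨅ i : ℕ, Ideal.span {a} ^ i • ⊤ : Submodule A (LinearMap.range P)) := by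
    rw [Submodule.mem_iInf]
    intro e
    obtain ⟨w, hw⟩ := h e
    have hvw : v = a ^ e • (⟨P w, w, rfl⟩ : LinearMap.range P) := by
      refine Subtype.ext ?_
      rw [Submodule.coe_smul, ← map_smul, hw, hz]
    rw [hvw]
    exact Submodule.smul_mem_smul (Ideal.pow_mem_pow (Ideal.mem_span_singleton_self a) e) trivial
  -- Krull's theorem gives a multiple of a that fixes z, whereas a kills z.
  obtain ⟨⟨b, hb⟩, hbv⟩ := (Ideal.mem_iInf_smul_pow_eq_bot_iff (Ideal.span {a}) v).1 hv
  obtain ⟨q, rfl⟩ := Ideal.mem_span_singleton'.1 hb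
  have h1 : (q * a) • z = z := congrArg Subtype.val hbv
  rw [← h1, mul_smul, haz, smul_zero]

end Divisibility

/-! ### Injectivity of the parameter, and the dimension of the fibers -/

section Bockstein

attribute [local instance] MvPolynomial.gradedAlgebra

variable {k : Type*} [Field k] {n : ℕ} {J : Ideal (MvPolynomial (Fin n) k[X])}
  {I : Ideal (MvPolynomial (Fin n) k)}
  {hJ : J.IsHomogeneous (homogeneousSubmodule (Fin n) k[X])}
  {hI : I.IsHomogeneous (homogeneousSubmodule (Fin n) k)}
  {θ : (MvPolynomial (Fin n) k[X] ⧸ J) →+* (MvPolynomial (Fin n) k ⧸ I)}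

theorem finite_range_quotPr (hJ : J.IsHomogeneous (homogeneousSubmodule (Fin n) k[X])) (p : ℕ)
    (ν : ℤ) : Module.Finite k[X] (LinearMap.range ((quotPr J hJ).HmapL ν p)) :=
  Module.Finite.iff_fg.2 ((finite_pieces n _ (quotPr J hJ)
    (fun j hj => absurd (lt_of_le_of_lt hj j.2) (lt_irrefl _)) p).2 ν)

theorem SpecSeq.rank_piece {a : k[X]} {τ : k} (D : SpecSeq hJ hI a θ)
    (ha : a = Polynomial.X - Polynomial.C τ)
    (hθC : ∀ c : k, θ (Ideal.Quotient.mk J (C (Polynomial.C c))) = Ideal.Quotient.mk I (C c))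
    (hinj : ∀ p ν (z : H k[X] n (MvPolynomial (Fin n) k[X] ⧸ J) p),
      (quotPr J hJ).Hmap ν p z = z → a • z = 0 → z = 0) (p : ℕ) (ν : ℤ) :
    Module.rank k (piece n (quotGrading I) p ν) =
      Module.finrank k[X] (LinearMap.range ((quotPr J hJ).HmapL ν p) ⧸
        Submodule.torsion k[X] (LinearMap.range ((quotPr J hJ).HmapL ν p))) := by
  have := finite_range_quotPr hJ p ν
  refine rank_fiber_of_projection ((quotPr J hJ).HmapL ν p) ((quotPr J hJ).Hmap_idem ν) _
    ((quotPr I hI).Hmap ν p) (mem_piece_iff hI) (D.T p) (D.δ p) ha (D.T_smul p) (D.exact_T p)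
    (D.exact_δ p) (fun c z => ?_) (D.T_graded p ν) (hinj p ν) (fun y hy => ?_)
  · rw [← C_smul_H, ← C_smul_H]
    exact D.T_poly p _ _ (hθC c) z
  · refine hinj (p + 1) ν _ ?_ (D.smul_δ p y)
    rw [← D.δ_graded, hy]

/-- If all graded maps `H^p(R/I) → H^{p+1}(R/I)` vanish, the `a`-torsion of the local cohomology
of the family is divisible by all powers of `a`. -/
theorem SpecSeq.exists_pow_smul_eq {a : k[X]} (D : SpecSeq hJ hI a θ)
    (hθ : Function.Surjective θ) (p : ℕ)
    (hhom : ∀ f : H k n (MvPolynomial (Fin n) k ⧸ I) p →ₗ[MvPolynomial (Fin n) k]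
        H k n (MvPolynomial (Fin n) k ⧸ I) (p + 1),
      (∀ ν, ∀ z ∈ piece n (quotGrading I) p ν, f z ∈ piece n (quotGrading I) (p + 1) ν) → f = 0)
    (e : ℕ) : ∀ z : H k[X] n (MvPolynomial (Fin n) k[X] ⧸ J) (p + 1), a • z = 0 →
      ∃ w, a ^ e • w = z := by
  refine exists_pow_smul_eq_of_hom_eq_zero (S := MvPolynomial (Fin n) k[X]) a (D.T (p + 1)) (D.δ p)
    (fun ν => (quotPr J hJ).HmapL ν (p + 1)) (fun ν => (quotPr I hI).Hmap ν p)
    (fun ν => (quotPr I hI).Hmap ν (p + 1)) (D.T_smul _) (D.exact_T _) (D.smul_δ p)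
    (D.exact_smul p) (fun r => ?_) (D.T_graded _) (D.δ_graded p)
    (fun f hf => hhom f fun ν z hz => ?_) e
  · obtain ⟨m, hm⟩ := hθ (Ideal.Quotient.mk I r)
    obtain ⟨g, rfl⟩ := Ideal.Quotient.mk_surjective m
    exact ⟨g, D.T_poly _ g r hm, D.δ_poly _ g r hm⟩
  · rw [mem_piece_iff hI] at hz ⊢
    exact hf ν z hz

theorem H_eq_zero_of_lt {A : Type*} [CommRing A] {M : Type*} [AddCommGroup M]
    [Module (MvPolynomial (Fin n) A) M] {p : ℕ} (hp : n < p) (z : H A n M p) : z = 0 := by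
  obtain ⟨c, hc, rfl⟩ := cls_surjective z
  rw [cls_eq_zero_iff]
  have : c = 0 := by
    funext s
    have := s.2
    have h2 := Finset.card_le_univ s.1
    rw [Fintype.card_fin] at h2
    omega
  rw [this]
  exact zero_mem _

/-- Under the vanishing of the graded maps `H^p(R/I) → H^{p+1}(R/I)`, the parameter acts
injectively on the graded pieces of the local cohomology of the family. -/
theorem SpecSeq.smul_eq_zero {r : ℕ} {J : Ideal (MvPolynomial (Fin (r + 1)) k[X])}
    {I : Ideal (MvPolynomial (Fin (r + 1)) k)}
    {hJ : J.IsHomogeneous (homogeneousSubmodule (Fin (r + 1)) k[X])}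
    {hI : I.IsHomogeneous (homogeneousSubmodule (Fin (r + 1)) k)}
    {θ : (MvPolynomial (Fin (r + 1)) k[X] ⧸ J) →+* (MvPolynomial (Fin (r + 1)) k ⧸ I)} {a : k[X]}
    (D : SpecSeq hJ hI a θ) (hθ : Function.Surjective θ)
    (hhom : ∀ i : ℕ, 1 ≤ i → i ≤ r →
      ∀ f : H k (r + 1) (MvPolynomial (Fin (r + 1)) k ⧸ I) (i - 1)
          →ₗ[MvPolynomial (Fin (r + 1)) k] H k (r + 1) (MvPolynomial (Fin (r + 1)) k ⧸ I) i,
        (∀ (ν : ℤ), ∀ z ∈ piece (r + 1) (quotGrading I) (i - 1) ν,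
          f z ∈ piece (r + 1) (quotGrading I) i ν) → f = 0) (p : ℕ) (ν : ℤ)
    (z : H k[X] (r + 1) (MvPolynomial (Fin (r + 1)) k[X] ⧸ J) p)
    (hz : (quotPr J hJ).Hmap ν p z = z) (haz : a • z = 0) : z = 0 := by
  obtain _ | p := p
  · exact D.smul_zero z haz
  obtain hp | hp := lt_or_ge r p
  · exact H_eq_zero_of_lt (by omega) z
  have := finite_range_quotPr hJ (p + 1) ν
  refine eq_zero_of_divisible ((quotPr J hJ).HmapL ν (p + 1)) z hz haz fun e =>
    D.exists_pow_smul_eq hθ p (fun f hf => ?_) e z haz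
  obtain hp | rfl := lt_or_eq_of_le hp
  · exact hhom (p + 1) (by omega) (by omega) f hf
  -- The case p = r lies outside the range of the hypothesis, but here the source or the target of f
  -- is zero.
  · rcases eq_zero_or_top_eq_zero I with h | h
    · refine LinearMap.ext fun y => ?_
      rw [h y, map_zero, map_zero]
    · refine LinearMap.ext fun y => ?_
      rw [LinearMap.zero_apply]
      exact h _

end Bockstein

end GradedLC

theorem theorem5p3 {k : Type*} [Field k] (r : ℕ)
    (𝓘 : Ideal (MvPolynomial (Fin (r + 1)) k[X]))
    (I₀ I₁ : Ideal (MvPolynomial (Fin (r + 1)) k))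
    (hfam : IsOneParameterFlatFamily 𝓘 I₀ I₁)
    (hhom : ∀ i : ℕ, 1 ≤ i → i ≤ r →
      ∀ f : GradedLC.H k (r + 1) (MvPolynomial (Fin (r + 1)) k ⧸ I₀) (i - 1)
          →ₗ[MvPolynomial (Fin (r + 1)) k]
          GradedLC.H k (r + 1) (MvPolynomial (Fin (r + 1)) k ⧸ I₀) i,
        (∀ (ν : ℤ), ∀ z ∈ GradedLC.piece (r + 1) (quotGrading I₀) (i - 1) ν,
          f z ∈ GradedLC.piece (r + 1) (quotGrading I₀) i ν) → f = 0) :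
    ∀ (i : ℕ) (ν : ℤ),
      Module.rank k (GradedLC.piece (r + 1) (quotGrading I₀) i ν) =
        Module.rank k (GradedLC.piece (r + 1) (quotGrading I₁) i ν) := by
  intro i ν
  obtain ⟨e₀, he₀⟩ := hfam.special
  obtain ⟨e₁, he₁⟩ := hfam.general
  obtain ⟨θ₀, hθ₀, hC₀⟩ := GradedLC.exists_isSpecialization_zero hfam.homogeneous
    hfam.homogeneous_special hfam.flat e₀ he₀
  obtain ⟨θ₁, hθ₁, hC₁⟩ := GradedLC.exists_isSpecialization_one hfam.homogeneous
    hfam.homogeneous_general hfam.flat e₁ he₁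
  -- Injectivity of t − 1 uses only the triviality of the family away from t = 0; the hypothesis on
  -- graded homomorphisms enters only for t. Both fibers then have the rank, modulo torsion, of the
  -- same graded piece of the cohomology of the family.
  have hX1 := fun p (ν : ℤ) z (_ : (GradedLC.quotPr 𝓘 hfam.homogeneous).Hmap ν p z = z) hz =>
    GradedLC.eq_zero_of_trivial_family hfam.flat e₁ he₁ (p := p) z hz
  have hX := hθ₀.exists_specSeq.some.smul_eq_zero hθ₀.surj hhom
  have h₀ := hθ₀.exists_specSeq.some.rank_piece (τ := 0) (by rw [map_zero, sub_zero]) hC₀ hX i ν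
  have h₁ := hθ₁.exists_specSeq.some.rank_piece (τ := 1) (by rw [map_one]) hC₁ hX1 i ν
  exact h₀.trans h₁.symm
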